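/- **Setting.** Let $n\in\mathbb N$, $N\ge 1$ an integer, $\rho,s>0$, $\Delta>\delta>0$, and let $\mathcal I\subset\mathbb R^n$ be open, connected and non-empty. For a subset $A$ of $\mathbb R^k$ and $r>0$, $A_r\subset\mathbb C^k$ denotes the union of the open complex balls of radius $r$ centred at points of $A$ (Euclidean norms throughout). Put $\mathbb T=\mathbb R/2\pi\mathbb Z$, $\mathbb T^n_s=\mathbb T^n+i[-s,s]^n$ and $B^2_R=\{(y,x)\in\mathbb C^2: |y|^2+|x|^2<R^2\}$. "Holomorphic on a set" means holomorphic in a neighbourhood of each of its points. Let $$H(I,\varphi,y,x)=h(I)+\frac{\omega_0(I)}2(x^2+y^2)+f(I,\varphi,y,x)$$ be holomorphic on $\mathcal I_\rho\times\mathbb T^n_s\times B^2_{\Delta+\delta}$, with $h,\omega_0,f$ holomorphic and real on real arguments. For a function $u=\sum_{k\in\mathbb Z^n}u_k(I,y,x)e^{ik\cdot\varphi}$ and a domain $W$ of $(I,y,x)$ put $\|u\|_{W,s}=\sum_k\sup_W|u_k|\,e^{s|k|}$ with $|k|=|k_1|+\dots+|k_n|$, and let $\bar u=u_0$ be the average of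 $u$ over $\varphi\in\mathbb T^n$. Put $$a=\inf_{\mathcal I_\rho}|\omega_0|,\quad M_0=\sup_{\mathcal I_\rho}|\omega_0|,\quad M_1=\sup_{I\in\mathcal I_\rho,\ y\in\mathbb C,\ |y|<\Delta+\delta}\Big\|\partial_I\Big(h+\frac{\omega_0}2y^2\Big)\Big\|,\quad \mathrm E=\|f\|_{\mathcal I_\rho\times B^2_{\Delta+\delta},\,s},$$ and assume $a>0$ and $M_0,M_1,\mathrm E<\infty$. Let $R_\theta$ be the rotation of $\mathbb C^2$, $R_\theta(y,x)=(y\cos\theta-x\sin\theta,\ y\sin\theta+x\cos\theta)$. For $c>0$ and $\theta_0\in\mathbb R$ put, for $d,e>0$ and $j\ge1$, $$\mathcal R^{(j)}_{d,e}=R_{(j-1)\theta_0}\Big(\{y\in\mathbb R:\tfrac\delta2<|y|<\Delta+\tfrac\delta2\}_d\times\{x\in\mathbb R:|x|<\tfrac c2\}_e\Big),\qquad (\mathcal U_j)_{r,\sigma,d,e}=\mathcal I_r\times\mathbb T^n_\sigma\times\mathcal R^{(j)}_{d,e},$$ and let $\mathcal U_j=\mathcal I\times\mathbb T^n\times R_{(j-1)\theta_0}\big(\{y\in\mathbb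 R:\frac\delta2<|y|<\Delta+\frac\delta2\}\times\{x\in\mathbb R:|x|<\frac c2\}\big)$ be the corresponding real set. Finally let $\mathcal M=\mathcal I\times\mathbb T^n\times\{(y,x)\in\mathbb R^2:\delta^2<x^2+y^2<\Delta^2\}$. **Proposition 2.1.** There are a pure number $p_*>0$ and, for each $n$, a number $\mathtt c_n>0$ depending only on $n$ such that, in the above setting, the following holds for all $\mathtt c_*\ge\mathtt c_n$ and all $0<c<\delta+\Delta$ with $$8Nc\frac{M_1}{a\delta}<s,\qquad \mathtt c_*\Big(\frac{c^3M_0}{a\delta\rho s}+\frac{2c\mathrm E}{a\delta\rho s}\Big)N<1,\qquad \mathtt c_*\Big(4\frac{c^2M_0}{a\delta^2}+\frac{8\mathrm E}{a\delta^2}\Big)N<1 .$$ 1. For every $p\in\mathbb N$, every $\theta_0$ and every $j=1,\dots,p$ there is a real-analytic (that is, holomorphic, and real on real points) canonical injective map $$\phi_j:(\mathcal U_j)_{\rho/3,s/3,\delta/6,c/6}\to(\mathcal U_j)_{\rho,s,\delta/2,c/2},\qquad(\tilde I,\tilde\varphi,\tilde y,\tilde x)\mapsto(I,\varphi,y,x),$$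 with values in the domain of $H$, and there are holomorphic functions $g_j(\tilde I,\tilde y,\tilde x)$ and $f_{j,*}(\tilde I,\tilde\varphi,\tilde y,\tilde x)$, real on real points, with $$H\circ\phi_j=h(\tilde I)+\frac{\omega_0(\tilde I)}2(\tilde x^2+\tilde y^2)+\bar f(\tilde I,\tilde y,\tilde x)+g_j(\tilde I,\tilde y,\tilde x)+f_{j,*}(\tilde I,\tilde\varphi,\tilde y,\tilde x).$$ With $\|\cdot\|=\|\cdot\|_{\mathcal I_{\rho/3}\times\mathcal R^{(j)}_{\delta/6,c/6},\,s/3}$, $$\|g_j\|\le\max\Big\{\mathtt c_n\Big(\frac{c^3M_0}{a\delta\rho s}+\frac{2c\mathrm E}{a\delta\rho s}\Big),\ \mathtt c_n\Big(4\frac{c^2M_0}{a\delta^2}+\frac{8\mathrm E}{a\delta^2}\Big)\Big\}\Big(\frac{M_0}2c^2+\mathrm E\Big),\qquad \|f_{j,*}\|\le\Big(\frac{M_0}2c^2+\mathrm E\Big)2^{-N}.$$ Moreover, on the domain of $\phi_j$, $$\max\Big\{\frac{|\tilde I-I|}\rho,\ \frac{|\tilde\varphi-\varphi|}s,\ \frac{2|\eta|}\delta,\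 \frac{2|\xi|}c\Big\}\le\frac4{\mathtt c_*N},\qquad(\eta,\xi)=R_{-(j-1)\theta_0}(\tilde y-y,\tilde x-x),$$ so that $\eta,\xi$ are the components of the displacement of $(y,x)$ along the sides of the $j$-th rectangle. 2. In particular, for $\theta_0=\arctan\frac c{2\Delta}$ and $p=\big[\frac{2\pi}{\theta_0}\big]+1$, one has $p\le p_*\frac\Delta c$ and $\{\mathcal U_j,\phi_j\}_{j=1,\dots,p}$ is an atlas for $\mathcal M$: $\mathcal M\subset\bigcup_j\mathcal U_j$ and, for each $j$, $\mathcal U_j$ is contained in the image under $\phi_j$ of the real points of its domain, with $\phi_j^{-1}$ real-analytic on $\mathcal U_j$. -/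

import Mathlib

noncomputable section

namespace AnnularNormalForm

open MeasureTheory

/-- `ℂⁿ` with its Hermitian (Euclidean) norm. -/
abbrev CVec (n : ℕ) := EuclideanSpace ℂ (Fin n)

/-- Complexified phase space, lifted to the universal cover of the torus:
`(I, (φ, (y, x)))` with `I, φ ∈ ℂⁿ` and `(y, x) ∈ ℂ²`.  Functions on `𝕋ⁿ` are represented by
`2π`-periodic functions of `φ`. -/
abbrev Phase (n : ℕ) := CVec n × CVec n × ℂ × ℂ

/-- The inclusion `ℝⁿ → ℂⁿ`. -/
def ofRealVec {n : ℕ} (v : Fin n → ℝ) : CVec n := WithLp.toLp 2 (fun i => (v i : ℂ))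

/-- `S_r`: the union of the open balls of `ℂⁿ` of radius `r` centred at points of `S ⊆ ℝⁿ`. -/
def actionNhd {n : ℕ} (S : Set (EuclideanSpace ℝ (Fin n))) (r : ℝ) : Set (CVec n) :=
  Metric.thickening r ((fun v : EuclideanSpace ℝ (Fin n) => ofRealVec v.ofLp) '' S)

/-- `S_r` for `S ⊆ ℝ`: the union of the open discs of `ℂ` of radius `r` centred in `S`. -/
def lineNhd (S : Set ℝ) (r : ℝ) : Set ℂ :=
  Metric.thickening r ((fun t : ℝ => (t : ℂ)) '' S)

/-- The lift of `𝕋ⁿ_s = 𝕋ⁿ + i[-s, s]ⁿ`. -/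
def strip (n : ℕ) (s : ℝ) : Set (CVec n) := {w | ∀ i, |(w i).im| ≤ s}

/-- The complex ball `B²_R` of `ℂ²`, centred at the origin. -/
def ballTwo (R : ℝ) : Set (ℂ × ℂ) := {q | ‖q.1‖ ^ 2 + ‖q.2‖ ^ 2 < R ^ 2}

/-- The rotation `R_θ` acting on column vectors `(y, x)`. -/
def rot (θ : ℝ) (q : ℂ × ℂ) : ℂ × ℂ :=
  ((Real.cos θ : ℂ) * q.1 - (Real.sin θ : ℂ) * q.2,
   (Real.sin θ : ℂ) * q.1 + (Real.cos θ : ℂ) * q.2)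

/-- `{y ∈ ℝ : δ/2 < |y| < Δ + δ/2}`. -/
def longSide (δ Δ : ℝ) : Set ℝ := {y | δ / 2 < |y| ∧ |y| < Δ + δ / 2}

/-- `{x ∈ ℝ : |x| < c/2}`. -/
def shortSide (c : ℝ) : Set ℝ := {x | |x| < c / 2}

/-- The rotated complex rectangle
`R_θ ({δ/2 < |y| < Δ + δ/2}_d × {|x| < c/2}_e) ⊆ ℂ²`. -/
def rectNhd (δ Δ c θ d e : ℝ) : Set (ℂ × ℂ) :=
  rot θ '' (lineNhd (longSide δ Δ) d ×ˢ lineNhd (shortSide c) e)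

/-- `𝒰_{r, s, d, e} = 𝓘_r × 𝕋ⁿ_s × R_θ ({δ/2 < |y| < Δ + δ/2}_d × {|x| < c/2}_e)`. -/
def boxNhd {n : ℕ} (S : Set (EuclideanSpace ℝ (Fin n))) (δ Δ c θ r s d e : ℝ) :
    Set (Phase n) :=
  {z | z.1 ∈ actionNhd S r ∧ z.2.1 ∈ strip n s ∧ z.2.2 ∈ rectNhd δ Δ c θ d e}

/-- The domain `𝓘_r × 𝕋ⁿ_s × B²_R`. -/
def hamDomain {n : ℕ} (S : Set (EuclideanSpace ℝ (Fin n))) (r s R : ℝ) : Set (Phase n) :=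
  {z | z.1 ∈ actionNhd S r ∧ z.2.1 ∈ strip n s ∧ z.2.2 ∈ ballTwo R}

/-- The point of the complexified phase space with real coordinates `(I, φ, y, x)`. -/
def realPoint {n : ℕ} (I φ : EuclideanSpace ℝ (Fin n)) (y x : ℝ) : Phase n :=
  (ofRealVec I.ofLp, ofRealVec φ.ofLp, (y : ℂ), (x : ℂ))

/-- The points all of whose coordinates are real. -/
def realPoints (n : ℕ) : Set (Phase n) := {z | ∃ I φ y x, z = realPoint I φ y x}

/-- The real set `𝒰 = 𝓘 × 𝕋ⁿ × R_θ ({δ/2 < |y| < Δ + δ/2} × {|x| < c/2})`. -/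
def realBox {n : ℕ} (S : Set (EuclideanSpace ℝ (Fin n))) (δ Δ c θ : ℝ) : Set (Phase n) :=
  {z | ∃ I ∈ S, ∃ φ, ∃ y ∈ longSide δ Δ, ∃ x ∈ shortSide c,
    z = realPoint I φ (Real.cos θ * y - Real.sin θ * x) (Real.sin θ * y + Real.cos θ * x)}

/-- The real manifold `𝓜 = 𝓘 × 𝕋ⁿ × {δ² < x² + y² < Δ²}`. -/
def annulus {n : ℕ} (S : Set (EuclideanSpace ℝ (Fin n))) (δ Δ : ℝ) : Set (Phase n) :=
  {z | ∃ I ∈ S, ∃ φ y x, δ ^ 2 < x ^ 2 + y ^ 2 ∧ x ^ 2 + y ^ 2 < Δ ^ 2 ∧ z = realPoint I φ y x}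

/-- Translation of the angles by `2π m`, `m ∈ ℤⁿ`. -/
def shift {n : ℕ} (m : Fin n → ℤ) (z : Phase n) : Phase n :=
  (z.1, z.2.1 + ofRealVec (fun i => 2 * Real.pi * (m i : ℝ)), z.2.2)

/-- `f` is `2π`-periodic in each angle on `D`, i.e. a function on the torus. -/
def PeriodicOn {n : ℕ} (f : Phase n → ℂ) (D : Set (Phase n)) : Prop :=
  ∀ z ∈ D, ∀ m : Fin n → ℤ, f (shift m z) = f z

/-- The Fourier coefficient
`f_k(I, y, x) = (2π)⁻ⁿ ∫_{[0, 2π]ⁿ} f(I, φ, y, x) e^{-i k·φ} dφ`. -/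
def fourierCoef {n : ℕ} (f : Phase n → ℂ) (k : Fin n → ℤ) (I : CVec n) (q : ℂ × ℂ) : ℂ :=
  ((2 * Real.pi : ℝ) : ℂ)⁻¹ ^ n *
    ∫ θ in Set.Icc (0 : Fin n → ℝ) (fun _ => 2 * Real.pi),
      f (I, ofRealVec θ, q) * Complex.exp (-Complex.I * ∑ i, (k i : ℂ) * (θ i : ℂ))

/-- The average `f̄ = f_0` over the angles. -/
def average {n : ℕ} (f : Phase n → ℂ) (I : CVec n) (q : ℂ × ℂ) : ℂ := fourierCoef f 0 I q

/-- The weighted Fourier norm `∑_k sup_{A × Q} |f_k| e^{s|k|}`, `|k| = |k_1| + … + |k_n|`, with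
values in `[0, ∞]`; `A` is the domain of the actions and `Q` that of `(y, x)`. -/
def wnorm {n : ℕ} (A : Set (CVec n)) (s : ℝ) (Q : Set (ℂ × ℂ)) (f : Phase n → ℂ) : ENNReal :=
  ∑' k : Fin n → ℤ,
    (⨆ I ∈ A, ⨆ q ∈ Q, ‖fourierCoef f k I q‖ₑ) *
      ENNReal.ofReal (Real.exp (s * ∑ i, |(k i : ℝ)|))

/-- `H = h(I) + ω₀(I)/2 (x² + y²) + f(I, φ, y, x)`. -/
def ham {n : ℕ} (h ω₀ : CVec n → ℂ) (f : Phase n → ℂ) (z : Phase n) : ℂ :=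
  h z.1 + ω₀ z.1 / 2 * (z.2.2.2 ^ 2 + z.2.2.1 ^ 2) + f z

/-- `‖ω₁(I, y)‖`, where `ω₁ = ∂_I (h + ω₀ y²/2)`.  The operator norm of the complex differential
is the Euclidean norm of the vector of partial derivatives. -/
def omegaOneNorm {n : ℕ} (h ω₀ : CVec n → ℂ) (I : CVec n) (y : ℂ) : ℝ :=
  ‖fderiv ℂ (fun J => h J + ω₀ J / 2 * y ^ 2) I‖

/-- The standard symplectic form `∑ dI_i ∧ dφ_i + dy ∧ dx`. -/
def sympl {n : ℕ} (u v : Phase n) : ℂ :=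
  (∑ i, (u.1 i * v.2.1 i - v.1 i * u.2.1 i)) + (u.2.2.1 * v.2.2.2 - v.2.2.1 * u.2.2.2)

/-- `φ` is a real-analytic canonical transformation from `D` into `T`: holomorphic near `D`, real
on real points, injective, preserving the symplectic form, and commuting with the translations of
the angles by `2πℤⁿ`, so that it descends to an (injective) map over the torus. -/
structure IsCanonicalMap {n : ℕ} (φ : Phase n → Phase n) (D T : Set (Phase n)) : Prop where
  mapsTo : Set.MapsTo φ D T
  analytic : AnalyticOnNhd ℂ φ D
  real : Set.MapsTo φ (D ∩ realPoints n) (realPoints n)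
  injOn : Set.InjOn φ D
  canonical : ∀ z ∈ D, ∀ u v : Phase n, sympl (fderiv ℂ φ z u) (fderiv ℂ φ z v) = sympl u v
  equivariant : ∀ z ∈ D, ∀ m : Fin n → ℤ, φ (shift m z) = shift m (φ z)

/-- The collection `(U_j, φ_j)` is an atlas for `M`: the sets `U_j` cover `M`, and `φ_j`, defined on
`D_j`, parametrizes `U_j` by real coordinates, with a real-analytic inverse (the chart)
`ψ_j : U_j → D_j`. -/
def IsAtlas {n : ℕ} {ι : Type} (M : Set (Phase n)) (U D : ι → Set (Phase n))
    (φ : ι → Phase n → Phase n) : Prop :=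
  M ⊆ (⋃ j, U j) ∧
  ∀ j, ∃ ψ : Phase n → Phase n, AnalyticOnNhd ℂ ψ (U j) ∧
    Set.MapsTo ψ (U j) (D j ∩ realPoints n) ∧ (∀ z ∈ U j, φ j (ψ z) = z) ∧
    (∀ z ∈ D j, φ j z ∈ U j → ψ (φ j z) = z)

end AnnularNormalForm

end

/-! On each rectangle `|y|` stays above a fixed fraction of `δ`, while `|ω₀| ≥ a` and `f` is small
compared with `a δ²`. Hence `∂_y H`, which is the speed of `x` under the Hamiltonian flow, does not
vanish there. The flow crosses the thin rectangle transversally, and the equation that removes the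
angles can be solved by integrating along orbits from the section `x = 0`. No small divisors occur.
The Hamiltonian is therefore conjugated to its average exactly: `g_j = 0` and `f_{j,*} = 0` satisfy
the claim, and the bounds on them are trivial.

After rotating the rectangle to the axes, set `G_τ = h + ω₀ (x² + y²) / 2 + f₀ + τ f₁`, with `f₀`
the average of `f` and `f₁ = f - f₀`. This is a deformation argument in the style of Moser. A
time-dependent generator `F` is sought with `dF(X_G) = f₁`, where `X_G` is the Hamiltonian field of
`G_τ` at fixed `τ`. By antisymmetry of the bracket, `dG(X_F) + ∂_τ G = 0`, so the flow of `X_F +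
∂_τ` preserves `G` (`energy_const`). Its time-one map, from `τ = 0` to `τ = 1`, is canonical
(`sympl_linearized_flow`) and carries `G_0` to `G_1`.

The generator is `F(z) = ∫ f₁ / ∂_y G` along the characteristic joining `{x = 0}` to `z`
(`transportSolution`, `exists_generator`). Characteristics must stay where `G` is holomorphic. Their
length in `x` is less than `c`, and the angles drift at rate about `M₁ / (a |y|)` per unit of `x`,
so `8 c M₁ ≤ s a δ` keeps them in the strip; the other smallness conditions control the remaining
components (`exists_characteristic`). The bound `|F| ≤ |x| E / (0.999 a |y|)` and Cauchy estimates
make the flow of `F` close to the identity (`hamVec_generator_le`), with smallness parameter `ν = 1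
/ (c_* N)`. Fourier series convert the weighted norm into sup bounds on `f₀` and `f₁`
(`norm_average_le`, `norm_sub_average_le`).

The analytic tools are Osgood's lemma, holomorphic dependence of flows on the initial point
(`exists_hasFDerivAt_flow`), and invariance of the real subspace under a real field
(`IsCurve.apply_eq_zero`). The atlas follows from polar coordinates, since a sector of opening `θ₀`
fits into one rectangle (`annulus_subset_iUnion`). No constant depends on `n`, because gradients are
bounded through unit directional derivatives. -/

noncomputable section

namespace AnnularNormalForm

open Metric Set MeasureTheory

universe u

/-! ### Cauchy estimates and analyticity of complex differentiable maps in several variables. -/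

section Osgood

variable {E : Type u} [NormedAddCommGroup E] [NormedSpace ℂ E]

/-- Cauchy's estimate for the Fréchet derivative. -/
theorem norm_fderiv_le_of_norm_le {G : Type*} [NormedAddCommGroup G] [NormedSpace ℂ G]
    {f : E → G} {z : E} {r M : ℝ} (hr : 0 < r)
    (hf : DifferentiableOn ℂ f (ball z r)) (hM : ∀ w ∈ ball z r, ‖f w‖ ≤ M) :
    ‖fderiv ℂ f z‖ ≤ 2 * M / r := by
  refine Complex.norm_fderiv_le_div_of_mapsTo_ball hf (fun w hw => ?_) hr
  rw [mem_closedBall, dist_eq_norm]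
  linarith [norm_sub_le (f w) (f z), hM w hw, hM z (mem_ball_self hr)]

/-- Cauchy's formula for the derivative on the complex line through `z` in direction `v`. It
expresses a directional derivative by values of `f` alone, so the derivative can be differentiated
under the integral sign. -/
theorem fderiv_apply_eq_circleIntegral {G : Type*} [NormedAddCommGroup G] [NormedSpace ℂ G]
    [CompleteSpace G] {f : E → G} {z v : E} {r : ℝ} (hr : 0 < r) {U : Set E} (hU : IsOpen U)
    (hf : DifferentiableOn ℂ f U) (hz : ∀ ζ ∈ closedBall (0 : ℂ) r, z + ζ • v ∈ U) :
    fderiv ℂ f z v = (2 * Real.pi * Complex.I : ℂ)⁻¹ •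
      ∮ ζ in C(0, r), ((ζ - 0) ^ 2)⁻¹ • f (z + ζ • v) := by
  have hg : ∀ ζ ∈ closedBall (0 : ℂ) r,
      HasDerivAt (fun ζ : ℂ => f (z + ζ • v)) (fderiv ℂ f (z + ζ • v) v) ζ := by
    intro ζ hζ
    have h1 : HasDerivAt (fun ζ : ℂ => z + ζ • v) v ζ := by
      simpa using ((hasDerivAt_id ζ).smul_const v).const_add z
    exact ((hf.differentiableAt (hU.mem_nhds (hz ζ hζ))).hasFDerivAt).comp_hasDerivAt ζ h1
  have h0 : deriv (fun ζ : ℂ => f (z + ζ • v)) 0 = fderiv ℂ f z v := by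
    simpa using (hg 0 (mem_closedBall_self hr.le)).deriv
  have hopen : IsOpen ((fun ζ : ℂ => z + ζ • v) ⁻¹' U) := hU.preimage (by fun_prop)
  have hd : DifferentiableOn ℂ (fun ζ : ℂ => f (z + ζ • v)) ((fun ζ : ℂ => z + ζ • v) ⁻¹' U) :=
    hf.comp (by fun_prop) (fun _ h => h)
  rw [← h0, Complex.two_pi_I_inv_smul_circleIntegral_sub_sq_inv_smul_of_differentiable hopen
    (c := 0) (R := r) (fun ζ hζ => hz ζ hζ) hd (mem_ball_self hr)]

variable [FiniteDimensional ℂ E]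

/-- A choice of basis identifies `E →L[ℂ] G` with finitely many copies of `G`, so differentiability
can be tested on each vector separately. -/
theorem differentiableAt_clm_of_apply {H : Type*} [NormedAddCommGroup H] [NormedSpace ℂ H]
    {G : Type*} [NormedAddCommGroup G] [NormedSpace ℂ G]
    {A : H → E →L[ℂ] G} {z : H} (h : ∀ v, DifferentiableAt ℂ (fun w => A w v) z) :
    DifferentiableAt ℂ A z := by
  let d := Module.finrank ℂ E
  have hd : d = Module.finrank ℂ (Fin d → ℂ) := (Module.finrank_fin_fun ℂ).symm
  let e₁ := ContinuousLinearEquiv.ofFinrankEq hd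
  let e₂ := (e₁.arrowCongr (1 : G ≃L[ℂ] G)).trans (ContinuousLinearEquiv.piRing (Fin d))
  rw [← Function.id_comp A, ← e₂.symm_comp_self, Function.comp_assoc]
  refine e₂.symm.differentiableAt.comp z ?_
  rw [differentiableAt_pi]
  intro i
  exact h _

/-- Each directional derivative is a circle integral of translates of `f`. Differentiating under the
integral needs only a locally uniform bound on `fderiv ℂ f`, which Cauchy's estimate supplies. -/
theorem differentiableOn_fderiv {G : Type*} [NormedAddCommGroup G] [NormedSpace ℂ G]
    [FiniteDimensional ℂ G] {f : E → G} {U : Set E} (hU : IsOpen U)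
    (hf : DifferentiableOn ℂ f U) : DifferentiableOn ℂ (fderiv ℂ f) U := by
  intro z₀ hz₀
  refine DifferentiableAt.differentiableWithinAt (differentiableAt_clm_of_apply fun v => ?_)
  have : ProperSpace E := FiniteDimensional.proper ℂ E
  have : ProperSpace G := FiniteDimensional.proper ℂ G
  have : FiniteDimensional ℂ (E →L[ℂ] G) := inferInstance
  have : ProperSpace (E →L[ℂ] G) := FiniteDimensional.proper ℂ _
  borelize E
  borelize G
  have hcont := (hf.continuousOn.continuousAt (hU.mem_nhds hz₀))
  obtain ⟨R, hR, hRU⟩ : ∃ R > 0, ball z₀ R ⊆ U ∩ {w | ‖f w‖ ≤ ‖f z₀‖ + 1} := by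
    apply Metric.mem_nhds_iff.mp
    refine Filter.inter_mem (hU.mem_nhds hz₀) ?_
    filter_upwards [hcont.norm.eventually (gt_mem_nhds (lt_add_one ‖f z₀‖))] with w hw using hw.le
  set M := ‖f z₀‖ + 1
  -- The circle of radius `r` in direction `v` moves a point by at most `R / 4`; adding one to `‖v‖`
  -- covers `v = 0`.
  set r := R / 4 / (‖v‖ + 1) with hr_def
  have hv : 0 < ‖v‖ + 1 := by positivity
  have hr : 0 < r := by positivity
  have hrv : r * ‖v‖ ≤ R / 4 := by
    rw [hr_def, div_mul_eq_mul_div, div_le_iff₀ hv]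
    nlinarith [norm_nonneg v]
  have hmem : ∀ z ∈ ball z₀ (R / 4), ∀ ζ ∈ closedBall (0 : ℂ) r, z + ζ • v ∈ ball z₀ (R / 2) := by
    intro z hz ζ hζ
    rw [mem_ball, dist_eq_norm] at *
    rw [mem_closedBall, dist_zero_right] at hζ
    calc ‖z + ζ • v - z₀‖ = ‖(z - z₀) + ζ • v‖ := by congr 1; abel
      _ ≤ ‖z - z₀‖ + ‖ζ‖ * ‖v‖ := (norm_add_le _ _).trans_eq (by rw [norm_smul])
      _ < R / 2 := by nlinarith [mul_le_mul_of_nonneg_right hζ (norm_nonneg v)]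
  have hsub : ∀ w ∈ ball z₀ (R / 2), ball w (R / 2) ⊆ ball z₀ R := by
    intro w hw
    apply ball_subset_ball'
    rw [mem_ball] at hw; linarith
  have hfd : ∀ w ∈ ball z₀ (R / 2), ‖fderiv ℂ f w‖ ≤ 2 * M / (R / 2) := fun w hw =>
    norm_fderiv_le_of_norm_le (by positivity)
      (hf.mono ((hsub w hw).trans (hRU.trans inter_subset_left)))
      (fun x hx => (hRU (hsub w hw hx)).2)
  have hRU2 : ball z₀ (R / 2) ⊆ U :=
    (ball_subset_ball (by linarith)).trans (hRU.trans inter_subset_left)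
  have hformula : (fun w => fderiv ℂ f w v) =ᶠ[nhds z₀] fun w =>
      (2 * Real.pi * Complex.I : ℂ)⁻¹ • ∮ ζ in C(0, r), ((ζ - 0) ^ 2)⁻¹ • f (w + ζ • v) := by
    filter_upwards [ball_mem_nhds z₀ (by positivity : 0 < R / 4)] with w hw
    exact fderiv_apply_eq_circleIntegral hr hU hf (fun ζ hζ => hRU2 (hmem w hw ζ hζ))
  refine DifferentiableAt.congr_of_eventuallyEq ?_ hformula
  refine DifferentiableAt.const_smul ?_ _
  unfold circleIntegral
  have hcm : ∀ θ : ℝ, circleMap 0 r θ ∈ closedBall (0 : ℂ) r := fun θ =>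
    circleMap_mem_closedBall 0 hr.le θ
  have hcmn : ∀ θ : ℝ, ‖circleMap 0 r θ‖ = r := fun θ => by
    rw [norm_circleMap_zero, abs_of_pos hr]
  have hcontF : ∀ w ∈ ball z₀ (R / 4), Continuous fun θ : ℝ =>
      deriv (circleMap 0 r) θ • ((circleMap 0 r θ - 0) ^ 2)⁻¹ • f (w + circleMap 0 r θ • v) := by
    intro w hw
    have h1 : Continuous fun θ : ℝ => f (w + circleMap 0 r θ • v) := by
      refine (hf.continuousOn.mono hRU2).comp_continuous (by fun_prop) fun θ => hmem w hw _ (hcm θ)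
    have h2 : Continuous fun θ : ℝ => ((circleMap 0 r θ - 0) ^ 2)⁻¹ := by
      refine Continuous.inv₀ (by fun_prop) fun θ => ?_
      simp [circleMap_ne_center hr.ne']
    have h3 : Continuous fun θ : ℝ => deriv (circleMap 0 r) θ := by
      simp only [deriv_circleMap]; fun_prop
    exact h3.smul (h2.smul h1)
  refine (intervalIntegral.hasFDerivAt_integral_of_dominated_of_fderiv_le
    (F' := fun w θ => deriv (circleMap 0 r) θ • ((circleMap 0 r θ - 0) ^ 2)⁻¹ •
      fderiv ℂ f (w + circleMap 0 r θ • v))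
    (bound := fun _ => r * ((r ^ 2)⁻¹ * (2 * M / (R / 2))))
    (ball_mem_nhds z₀ (by positivity : 0 < R / 4)) ?_ ?_ ?_ ?_ ?_ ?_).differentiableAt
  · filter_upwards [ball_mem_nhds z₀ (by positivity : 0 < R / 4)] with w hw
    exact (hcontF w hw).aestronglyMeasurable
  · exact (hcontF z₀ (mem_ball_self (by positivity))).intervalIntegrable _ _
  · have h3 : Measurable fun θ : ℝ => deriv (circleMap 0 r) θ := by
      simp only [deriv_circleMap]; fun_prop
    -- Continuity of the derivative is not yet available here; measurability of `fderiv` holds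
    -- without it and suffices.
    have h1 : Measurable fun θ : ℝ => fderiv ℂ f (z₀ + circleMap 0 r θ • v) :=
      (measurable_fderiv ℂ f).comp
        (Continuous.measurable (by fun_prop))
    have h2 : Measurable fun θ : ℝ => ((circleMap 0 r θ - 0) ^ 2)⁻¹ := by
      have : Measurable (circleMap (0 : ℂ) r) := (continuous_circleMap 0 r).measurable
      fun_prop
    exact (h3.smul (h2.smul h1)).aestronglyMeasurable
  · refine Filter.Eventually.of_forall fun θ _ w hw => ?_
    rw [norm_smul, norm_smul, deriv_circleMap, norm_mul, hcmn, Complex.norm_I, mul_one, norm_inv,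
      norm_pow, sub_zero, hcmn]
    gcongr
    exact hfd _ (hmem w hw _ (hcm θ))
  · exact intervalIntegrable_const
  · refine Filter.Eventually.of_forall fun θ _ w hw => ?_
    have h1 : HasFDerivAt f (fderiv ℂ f (w + circleMap 0 r θ • v)) (w + circleMap 0 r θ • v) :=
      (hf.differentiableAt (hU.mem_nhds (hRU2 (hmem w hw _ (hcm θ))))).hasFDerivAt
    have h2 : HasFDerivAt (fun w => f (w + circleMap 0 r θ • v))
        (fderiv ℂ f (w + circleMap 0 r θ • v)) w :=
      (hasFDerivAt_comp_add_right _).mpr h1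
    exact (h2.const_smul _).const_smul _

theorem contDiffOn_nat_of_differentiableOn (n : ℕ) :
    ∀ {G : Type u} [NormedAddCommGroup G] [NormedSpace ℂ G] [FiniteDimensional ℂ G]
    {f : E → G} {U : Set E}, IsOpen U → DifferentiableOn ℂ f U → ContDiffOn ℂ n f U := by
  induction n with
  | zero => intro G _ _ _ f U _ hf; simpa using hf.continuousOn
  | succ n ih =>
    intro G _ _ _ f U hU hf
    push_cast
    rw [contDiffOn_succ_iff_fderiv_of_isOpen hU]
    exact ⟨hf, by simp, ih hU (differentiableOn_fderiv hU hf)⟩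

/-- Cauchy's estimate is applied once per derivative; each application costs a width `h` of the ball
and a factor `2 / h`. -/
theorem norm_iteratedFDeriv_le_of_norm_le (n : ℕ) :
    ∀ {G : Type u} [NormedAddCommGroup G] [NormedSpace ℂ G] [FiniteDimensional ℂ G]
    {f : E → G} {z₀ : E} {r h M : ℝ}, 0 < h → DifferentiableOn ℂ f (ball z₀ (r + n * h)) →
    (∀ w ∈ ball z₀ (r + n * h), ‖f w‖ ≤ M) →
    ∀ z ∈ ball z₀ r, ‖iteratedFDeriv ℂ n f z‖ ≤ M * (2 / h) ^ n := by
  induction n with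
  | zero => intro G _ _ _ f z₀ r h M _ _ hM z hz; simpa using hM z (by simpa using hz)
  | succ n ih =>
    intro G _ _ _ f z₀ r h M hh hf hM z hz
    rw [← norm_iteratedFDeriv_fderiv, pow_succ', ← mul_assoc]
    have hsub : ∀ w ∈ ball z₀ (r + n * h), ball w h ⊆ ball z₀ (r + (n + 1 : ℕ) * h) := by
      intro w hw
      apply ball_subset_ball'
      rw [mem_ball] at hw; push_cast; linarith
    refine ih (G := E →L[ℂ] G) hh ?_ ?_ z hz
    · refine (differentiableOn_fderiv isOpen_ball hf).mono (ball_subset_ball ?_)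
      push_cast; linarith
    · intro w hw
      refine (norm_fderiv_le_of_norm_le hh (hf.mono (hsub w hw))
        (fun x hx => hM x (hsub w hw hx))).trans_eq (by ring)

/-- **Osgood's lemma**: a complex differentiable map on an open subset of a finite-dimensional
space is analytic. -/
theorem analyticOnNhd_of_differentiableOn {G : Type u} [NormedAddCommGroup G] [NormedSpace ℂ G]
    [FiniteDimensional ℂ G] {f : E → G} {U : Set E} (hU : IsOpen U)
    (hf : DifferentiableOn ℂ f U) : AnalyticOnNhd ℂ f U := by
  intro z₀ hz₀
  have : CompleteSpace G := FiniteDimensional.complete ℂ G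
  have hcont := (hf.continuousOn.continuousAt (hU.mem_nhds hz₀))
  obtain ⟨R, hR, hRU⟩ : ∃ R > 0, ball z₀ R ⊆ U ∩ {w | ‖f w‖ ≤ ‖f z₀‖ + 1} := by
    apply Metric.mem_nhds_iff.mp
    refine Filter.inter_mem (hU.mem_nhds hz₀) ?_
    filter_upwards [hcont.norm.eventually (gt_mem_nhds (lt_add_one ‖f z₀‖))] with w hw using hw.le
  set M := ‖f z₀‖ + 1 with hM
  have hM0 : 0 ≤ M := by positivity
  have hfR : DifferentiableOn ℂ f (ball z₀ R) := hf.mono (hRU.trans inter_subset_left)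
  let p : FormalMultilinearSeries ℂ E G := fun n => ((n.factorial : ℂ)⁻¹) • iteratedFDeriv ℂ n f z₀
  have hbound : ∀ n : ℕ, ‖p n‖ ≤ M * (4 * Real.exp 1 / R) ^ n := by
    intro n
    rcases Nat.eq_zero_or_pos n with rfl | hn
    · simpa [p] using (hRU (mem_ball_self hR)).2
    have hn' : (0 : ℝ) < n := by exact_mod_cast hn
    -- Splitting the available `R / 2` into `n` equal shrinkings gives a factor `n ^ n`, which `n!`
    -- absorbs up to `e ^ n`. The Taylor coefficients thus grow geometrically.
    have h1 := norm_iteratedFDeriv_le_of_norm_le n (f := f) (z₀ := z₀) (r := R / 2)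
      (h := R / (2 * n)) (M := M) (by positivity)
      (by rwa [show R / 2 + n * (R / (2 * n)) = R by field_simp; ring])
      (by rw [show R / 2 + n * (R / (2 * n)) = R by field_simp; ring]
          exact fun w hw => (hRU hw).2) z₀ (mem_ball_self (by positivity))
    have h2 := Real.pow_div_factorial_le_exp n hn'.le n
    have h3 : Real.exp n = Real.exp 1 ^ n := by rw [← Real.exp_nat_mul]; simp
    rw [h3] at h2
    calc ‖p n‖ = (n.factorial : ℝ)⁻¹ * ‖iteratedFDeriv ℂ n f z₀‖ := by
          simp [p, norm_smul]
      _ ≤ (n.factorial : ℝ)⁻¹ * (M * (2 / (R / (2 * n))) ^ n) := by gcongr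
      _ = M * (4 / R) ^ n * ((n : ℝ) ^ n / n.factorial) := by
          rw [show 2 / (R / (2 * (n : ℝ))) = 4 / R * n by field_simp; ring, mul_pow]; ring
      _ ≤ M * (4 / R) ^ n * Real.exp 1 ^ n := by gcongr
      _ = _ := by rw [mul_assoc, ← mul_pow]; congr 2; ring
  have hexp : 1 ≤ Real.exp 1 := Real.one_le_exp (by norm_num)
  set ρ : ℝ := R / (4 * Real.exp 1) with hρ
  have hρ0 : 0 < ρ := by positivity
  have hρR : ρ < R := by
    rw [hρ, div_lt_iff₀ (by positivity)]; nlinarith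
  lift ρ to NNReal using hρ0.le with ρ' hρ'
  refine ⟨p, (ρ' : ENNReal), ?_, by exact_mod_cast hρ0, ?_⟩
  · refine p.le_radius_of_bound M fun n => ?_
    calc ‖p n‖ * (ρ' : ℝ) ^ n ≤ M * (4 * Real.exp 1 / R) ^ n * (ρ' : ℝ) ^ n := by
          gcongr; exact hbound n
      _ = M := by
          rw [mul_assoc, ← mul_pow, hρ]
          have : 4 * Real.exp 1 / R * (R / (4 * Real.exp 1)) = 1 := by field_simp
          rw [this, one_pow, mul_one]
  · intro y hy
    have hy' : ‖y‖ < ρ' := by simpa using hy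
    have hyR : ‖y‖ < R := hy'.trans hρR
    -- Restriction to the complex line through `y` reduces convergence to the one-variable Taylor
    -- theorem, evaluated at `1` in a disc of radius greater than `1`.
    let L : ℂ →L[ℂ] E := ContinuousLinearMap.toSpanSingleton ℂ y
    let g : E → G := fun w => f (z₀ + w)
    have hg : DifferentiableOn ℂ g (ball 0 R) := by
      refine hfR.comp (by fun_prop) fun w hw => ?_
      simpa [mem_ball, dist_eq_norm] using hw
    have hgL : DifferentiableOn ℂ (g ∘ L) (L ⁻¹' ball 0 R) := hg.comp (by fun_prop) fun _ h => h
    obtain ⟨r, hr1, hr⟩ : ∃ r : ℝ, 1 < r ∧ r * ‖y‖ < R := by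
      rcases (norm_nonneg y).eq_or_lt with h0 | h0
      · exact ⟨2, by norm_num, by rw [← h0]; simpa using hR⟩
      · obtain ⟨r, hr⟩ := exists_between ((one_lt_div h0).mpr hyR)
        exact ⟨r, hr.1, (lt_div_iff₀ h0).mp hr.2⟩
    have hball : ball (0 : ℂ) r ⊆ L ⁻¹' ball 0 R := by
      intro t ht
      have ht' : ‖t‖ < r := by simpa using ht
      simp only [L, mem_preimage, mem_ball, dist_zero_right,
        ContinuousLinearMap.toSpanSingleton_apply, norm_smul]
      nlinarith [norm_nonneg y]
    have hs := Complex.hasSum_taylorSeries_on_ball (hgL.mono hball) (z := 1)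
      (by simpa using hr1)
    have hL1 : (g ∘ L) 1 = f (z₀ + y) := by simp [g, L]
    rw [hL1] at hs
    refine hs.congr_fun (g := fun n => _) ?_ |> fun h => h
    intro n
    have hop : IsOpen (L ⁻¹' ball (0 : E) R) := isOpen_ball.preimage L.continuous
    have h0 : L 0 ∈ ball (0 : E) R := by simpa using hR
    have hcomp := L.iteratedFDerivWithin_comp_right (n := n) (i := n)
      (contDiffOn_nat_of_differentiableOn n isOpen_ball hg) isOpen_ball.uniqueDiffOn
      hop.uniqueDiffOn h0 le_rfl
    rw [iteratedFDerivWithin_of_isOpen n hop h0, iteratedFDerivWithin_of_isOpen n isOpen_ball h0]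
      at hcomp
    have hg0 : iteratedFDeriv ℂ n g (L 0) = iteratedFDeriv ℂ n f z₀ := by
      rw [iteratedFDeriv_comp_add_left]; simp
    simp only [p, iteratedDeriv_eq_iteratedFDeriv, hcomp, hg0]
    simp [L]

end Osgood

/-! ### Integral curves over the unit time interval: stability, uniqueness, invariant subspaces. -/

section Curves

variable {E : Type u} [NormedAddCommGroup E] [NormedSpace ℂ E]

/-- `γ` is an integral curve of `V` over `[0, 1]`, inside `U`, starting at `z`. -/
structure IsCurve (V : E → E) (U : Set E) (γ : ℝ → E) (z : E) : Prop where
  start : γ 0 = z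
  mem : ∀ t ∈ Icc (0 : ℝ) 1, γ t ∈ U
  deriv : ∀ t ∈ Icc (0 : ℝ) 1, HasDerivWithinAt γ (V (γ t)) (Icc 0 1) t

theorem hasDerivWithinAt_Ici_of_Icc {F : Type*} [NormedAddCommGroup F] [NormedSpace ℝ F]
    {f : ℝ → F} {f' : F} {t : ℝ} (h : HasDerivWithinAt f f' (Icc 0 1) t)
    (ht : t ∈ Ico (0 : ℝ) 1) : HasDerivWithinAt f f' (Ici t) t :=
  h.mono_of_mem_nhdsWithin (Icc_mem_nhdsGE_of_mem ht)

theorem IsCurve.continuousOn {V : E → E} {U : Set E} {γ : ℝ → E} {z : E} (h : IsCurve V U γ z) :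
    ContinuousOn γ (Icc 0 1) := fun t ht => (h.deriv t ht).continuousWithinAt

theorem IsCurve.mono {V : E → E} {U U' : Set E} {γ : ℝ → E} {z : E} (h : IsCurve V U γ z)
    (hU : U ⊆ U') : IsCurve V U' γ z := ⟨h.start, fun t ht => hU (h.mem t ht), h.deriv⟩

/-- The time reversal of an integral curve. -/
theorem IsCurve.reverse {V : E → E} {U : Set E} {γ : ℝ → E} {z : E} (h : IsCurve V U γ z) :
    IsCurve (fun w => -V w) U (fun t => γ (1 - t)) (γ 1) := by
  have hr : ∀ t ∈ Icc (0 : ℝ) 1, 1 - t ∈ Icc (0 : ℝ) 1 := fun t ht =>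
    ⟨by linarith [ht.2], by linarith [ht.1]⟩
  refine ⟨by simp, fun t ht => h.mem _ (hr t ht), fun t ht => ?_⟩
  have h1 : HasDerivWithinAt (fun t : ℝ => 1 - t) (-1) (Icc 0 1) t := by
    simpa using ((hasDerivAt_id t).const_sub 1).hasDerivWithinAt
  simpa [Function.comp_def] using (h.deriv _ (hr t ht)).scomp t h1 hr

theorem IsCurve.isCompact_image {V : E → E} {U : Set E} {γ : ℝ → E} {z : E}
    (h : IsCurve V U γ z) : IsCompact (γ '' Icc 0 1) ∧ γ '' Icc 0 1 ⊆ U :=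
  ⟨isCompact_Icc.image_of_continuousOn h.continuousOn, by
    rintro _ ⟨t, ht, rfl⟩; exact h.mem t ht⟩

/-- A Grönwall estimate with a bound needed only while the function is small. -/
theorem norm_le_exp_of_norm_deriv_le_of_small {F : Type*} [NormedAddCommGroup F] [NormedSpace ℝ F]
    {f f' : ℝ → F} {C ε η : ℝ} (hε : 0 < ε) (hC : 0 ≤ C) (hη : ε * Real.exp (C + 1) < η)
    (hf : ∀ t ∈ Icc (0 : ℝ) 1, HasDerivWithinAt f (f' t) (Icc 0 1) t)
    (h0 : ‖f 0‖ ≤ ε) (hb : ∀ t ∈ Icc (0 : ℝ) 1, ‖f t‖ < η → ‖f' t‖ ≤ C * ‖f t‖) :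
    ∀ t ∈ Icc (0 : ℝ) 1, ‖f t‖ ≤ ε * Real.exp (C + 1) := by
  -- The comparison function grows at rate `C + 1` rather than `C`, which makes the derivative
  -- inequality strict at a contact point. It stays below `η`, so the hypothesis `hb` applies at
  -- such a point.
  have hB : ∀ t : ℝ, HasDerivAt (fun t => ε * Real.exp ((C + 1) * t))
      (ε * (Real.exp ((C + 1) * t) * (C + 1))) t := fun t => by
    have := ((hasDerivAt_id t).const_mul (C + 1)).exp.const_mul ε
    simpa using this
  have hle : ∀ t ∈ Icc (0 : ℝ) 1, ε * Real.exp ((C + 1) * t) ≤ ε * Real.exp (C + 1) := by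
    intro t ht
    have : (C + 1) * t ≤ C + 1 := mul_le_of_le_one_right (by positivity) ht.2
    gcongr
  intro t ht
  refine le_trans ?_ (hle t ht)
  refine image_norm_le_of_norm_deriv_right_lt_deriv_boundary' (f := f) (f' := f')
    (B := fun t => ε * Real.exp ((C + 1) * t)) (fun t ht => (hf t ht).continuousWithinAt)
    (fun t ht => hasDerivWithinAt_Ici_of_Icc (hf t (Ico_subset_Icc_self ht)) ht)
    (by simpa using h0) (fun t _ => (hB t).continuousAt.continuousWithinAt)
    (fun t _ => (hB t).hasDerivWithinAt) ?_ ht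
  intro t ht h
  have ht' := Ico_subset_Icc_self ht
  have hpos : 0 < ε * Real.exp ((C + 1) * t) := by positivity
  have := hb t ht' (by rw [h]; exact (hle t ht').trans_lt hη)
  rw [h] at this
  nlinarith

variable [FiniteDimensional ℂ E]

/-- Uniform first and second order Taylor estimates around a compact set. -/
theorem exists_uniform_taylor {G : Type u} [NormedAddCommGroup G] [NormedSpace ℂ G]
    [FiniteDimensional ℂ G] {V : E → G} {U K : Set E} (hU : IsOpen U)
    (hV : DifferentiableOn ℂ V U) (hK : IsCompact K) (hKU : K ⊆ U) :
    ∃ η > 0, ∃ C ≥ 0, ∀ y ∈ K, ball y η ⊆ U ∧ ‖fderiv ℂ V y‖ ≤ C ∧ ∀ x ∈ ball y η,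
      ‖V x - V y‖ ≤ C * ‖x - y‖ ∧
      ‖V x - V y - fderiv ℂ V y (x - y)‖ ≤ C * ‖x - y‖ ^ 2 := by
  have : ProperSpace E := FiniteDimensional.proper ℂ E
  obtain ⟨η, hη, hηU⟩ := hK.exists_cthickening_subset_open hU hKU
  have hcomp : IsCompact (cthickening η K) := hK.cthickening
  obtain ⟨M, hM⟩ := hcomp.exists_bound_of_continuousOn (hV.continuousOn.mono hηU)
  set M' := max M 0
  have hM' : ∀ x ∈ cthickening η K, ‖V x‖ ≤ M' := fun x hx => (hM x hx).trans (le_max_left _ _)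
  have hM0 : 0 ≤ M' := le_max_right _ _
  have hball : ∀ y ∈ K, ball y η ⊆ cthickening η K := fun y hy =>
    (ball_subset_thickening hy η).trans (thickening_subset_cthickening _ _)
  have hD1 : ∀ y ∈ K, ∀ x ∈ ball y (η / 2), ‖fderiv ℂ V x‖ ≤ 2 * M' / (η / 2) := by
    intro y hy x hx
    have hs : ball x (η / 2) ⊆ cthickening η K :=
      (ball_subset_ball' (by rw [mem_ball] at hx; linarith)).trans (hball y hy)
    exact norm_fderiv_le_of_norm_le (by positivity) (hV.mono (hs.trans hηU))
      fun w hw => hM' w (hs hw)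
  set M1 := 2 * M' / (η / 2)
  have hM1 : 0 ≤ M1 := by positivity
  have hA := differentiableOn_fderiv hU hV
  -- A second Cauchy estimate, for `fderiv ℂ V` in place of `V`, bounds the second derivative; the
  -- radius shrinks from `η` to `η / 2` to `η / 4`.
  have hD2 : ∀ y ∈ K, ∀ x ∈ ball y (η / 4),
      ‖fderiv ℂ (fderiv ℂ V) x‖ ≤ 2 * M1 / (η / 4) := by
    intro y hy x hx
    have hs : ball x (η / 4) ⊆ ball y (η / 2) :=
      ball_subset_ball' (by rw [mem_ball] at hx; linarith)
    have hs' : ball y (η / 2) ⊆ U :=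
      (ball_subset_ball (by linarith)).trans ((hball y hy).trans hηU)
    exact norm_fderiv_le_of_norm_le (by positivity) (hA.mono (hs.trans hs'))
      fun w hw => hD1 y hy w (hs hw)
  set M2 := 2 * M1 / (η / 4)
  have hM2 : 0 ≤ M2 := by positivity
  refine ⟨η / 4, by positivity, max M1 M2, le_max_of_le_left hM1, fun y hy => ?_⟩
  have hyU : ball y (η / 4) ⊆ U :=
    (ball_subset_ball (by linarith)).trans ((hball y hy).trans hηU)
  have h42 : ball y (η / 4) ⊆ ball y (η / 2) := ball_subset_ball (by linarith)
  have hyy : y ∈ ball y (η / 4) := mem_ball_self (by positivity)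
  have hd : ∀ x ∈ ball y (η / 4), DifferentiableAt ℂ V x := fun x hx =>
    hV.differentiableAt (hU.mem_nhds (hyU hx))
  have hdA : ∀ x ∈ ball y (η / 4), DifferentiableAt ℂ (fderiv ℂ V) x := fun x hx =>
    hA.differentiableAt (hU.mem_nhds (hyU hx))
  refine ⟨hyU, (hD1 y hy y (h42 hyy)).trans (le_max_left _ _), fun x hx => ⟨?_, ?_⟩⟩
  · exact (convex_ball y (η / 4)).norm_image_sub_le_of_norm_fderiv_le hd
      (fun w hw => (hD1 y hy w (h42 hw)).trans (le_max_left _ _)) hyy hx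
  · have hseg : segment ℝ y x ⊆ ball y (η / 4) := (convex_ball y _).segment_subset hyy hx
    have key := (convex_segment y x).norm_image_sub_le_of_norm_fderiv_le' (𝕜 := ℂ) (f := V)
      (φ := fderiv ℂ V y) (C := M2 * ‖x - y‖) (fun w hw => hd w (hseg hw)) ?_
      (left_mem_segment ℝ y x) (right_mem_segment ℝ y x)
    · refine key.trans ?_
      rw [mul_assoc, ← sq]
      gcongr
      exact le_max_right _ _
    · intro w hw
      have h1 := (convex_ball y (η / 4)).norm_image_sub_le_of_norm_fderiv_le hdA
        (fun w hw => hD2 y hy w hw) hyy (hseg hw)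
      refine h1.trans ?_
      gcongr
      obtain ⟨a, b, ha, hb, hab, rfl⟩ := hw
      have : a • y + b • x - y = b • (x - y) := by
        rw [← eq_sub_iff_add_eq] at hab; subst hab
        module
      rw [this, norm_smul, Real.norm_of_nonneg hb]
      exact mul_le_of_le_one_left (norm_nonneg _) (by linarith)

/-- Integral curves depend on the initial point in a locally Lipschitz way. -/
theorem IsCurve.exists_stability {V : E → E} {U : Set E} (hU : IsOpen U)
    (hV : DifferentiableOn ℂ V U) {γ : ℝ → E} {z₀ : E} (h : IsCurve V U γ z₀) :
    ∃ ε₀ > 0, ∃ C ≥ 0, ∀ ε > 0, ε < ε₀ → ∀ z γ' U', IsCurve V U' γ' z → ‖z - z₀‖ ≤ ε →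
      ∀ t ∈ Icc (0 : ℝ) 1, ‖γ' t - γ t‖ ≤ C * ε := by
  obtain ⟨hc, hcU⟩ := h.isCompact_image
  obtain ⟨η, hη, C, hC, hT⟩ := exists_uniform_taylor hU hV hc hcU
  have he : 0 < Real.exp (C + 1) := Real.exp_pos _
  refine ⟨η / Real.exp (C + 1), by positivity, Real.exp (C + 1), he.le, ?_⟩
  intro ε hε hεη z γ' U' h' hz t ht
  rw [mul_comm]
  refine norm_le_exp_of_norm_deriv_le_of_small (f := fun t => γ' t - γ t)
    (f' := fun t => V (γ' t) - V (γ t)) (η := η) hε hC ((lt_div_iff₀ he).mp hεη)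
    (fun t ht => (h'.deriv t ht).sub (h.deriv t ht)) (by rwa [h'.start, h.start]) ?_ t ht
  intro t ht hs
  exact ((hT _ (mem_image_of_mem γ ht)).2.2 _ (by rwa [mem_ball, dist_eq_norm])).1

/-- Uniqueness of integral curves. -/
theorem IsCurve.unique {V : E → E} {U U' : Set E} (hU : IsOpen U)
    (hV : DifferentiableOn ℂ V U) {γ γ' : ℝ → E} {z : E} (h : IsCurve V U γ z)
    (h' : IsCurve V U' γ' z) : ∀ t ∈ Icc (0 : ℝ) 1, γ' t = γ t := by
  obtain ⟨ε₀, hε₀, C, hC, hs⟩ := h.exists_stability hU hV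
  intro t ht
  rw [← sub_eq_zero, ← norm_le_zero_iff]
  refine le_of_forall_pos_le_add fun e he => ?_
  have h1 := hs (min (ε₀ / 2) (e / (C + 1))) (by positivity)
    ((min_le_left _ _).trans_lt (by linarith)) z γ' U' h' (by rw [sub_self, norm_zero]; positivity) t ht
  refine h1.trans ?_
  calc C * min (ε₀ / 2) (e / (C + 1)) ≤ (C + 1) * (e / (C + 1)) := by
        gcongr
        · linarith
        · exact min_le_right _ _
    _ = 0 + e := by field_simp; ring

/-- A real subspace, the kernel of a projection, to which the field is tangent is invariant. -/
theorem IsCurve.apply_eq_zero {V : E → E} {U : Set E} (hU : IsOpen U)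
    (hV : DifferentiableOn ℂ V U) {γ : ℝ → E} {z : E} (h : IsCurve V U γ z)
    (π : E →L[ℝ] E) (hπ : ∀ w, π (π w) = π w) (hπV : ∀ w ∈ U, π w = 0 → π (V w) = 0)
    (hz : π z = 0) : ∀ t ∈ Icc (0 : ℝ) 1, π (γ t) = 0 := by
  obtain ⟨hc, hcU⟩ := h.isCompact_image
  obtain ⟨η, hη, C, hC, hT⟩ := exists_uniform_taylor hU hV hc hcU
  have hC' : 0 ≤ ‖π‖ * C := by positivity
  intro t ht
  rw [← norm_le_zero_iff]
  refine le_of_forall_pos_le_add fun e he => ?_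
  have hexp : 0 < Real.exp (‖π‖ * C + 1) := Real.exp_pos _
  set ε := min (η / 2) e / Real.exp (‖π‖ * C + 1) with hε
  have hεe : ε * Real.exp (‖π‖ * C + 1) = min (η / 2) e := by rw [hε]; field_simp
  have := norm_le_exp_of_norm_deriv_le_of_small (f := fun t => π (γ t))
    (f' := fun t => π (V (γ t))) (C := ‖π‖ * C) (η := η) (ε := ε) (by positivity) hC'
    (by rw [hεe]; exact (min_le_left _ _).trans_lt (by linarith))
    (fun t ht => π.hasFDerivAt.comp_hasDerivWithinAt t (h.deriv t ht))
    (by rw [h.start, hz, norm_zero]; positivity) ?_ t ht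
  · rw [hεe] at this
    rw [zero_add]; exact this.trans (min_le_right _ _)
  · intro t ht hs
    -- The point `γ t - π (γ t)` lies in the kernel of `π`, where the field is tangent. Comparing
    -- the field at `γ t` with its value there bounds the derivative of `π ∘ γ` by a multiple of `π
    -- ∘ γ` itself.
    have hb : γ t - π (γ t) ∈ ball (γ t) η := by
      simpa [mem_ball, dist_eq_norm] using hs
    obtain ⟨hbU, -, hx⟩ := hT _ (mem_image_of_mem γ ht)
    have h0 : π (V (γ t - π (γ t))) = 0 := hπV _ (hbU hb) (by rw [map_sub, hπ, sub_self])
    have h1 := (hx _ hb).1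
    have h2 : π (V (γ t)) = -π (V (γ t - π (γ t)) - V (γ t)) := by rw [map_sub, h0]; simp
    rw [h2, norm_neg, mul_assoc]
    refine (π.le_opNorm _).trans ?_
    gcongr
    simpa using h1

end Curves

/-! ### Linear differential equations in a Banach algebra, by the Volterra series. -/

section LinearODE

variable {R : Type*} [NormedRing R] [NormedAlgebra ℝ R]

/-- The terms of the Volterra series of `M' = A M`, `M(0) = 1`. -/
def volterra (A : ℝ → R) : ℕ → ℝ → R
  | 0 => fun _ => 1
  | k + 1 => fun t => ∫ s in (0 : ℝ)..t, A s * volterra A k s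

theorem continuous_volterra {A : ℝ → R} (hA : Continuous A) (k : ℕ) :
    Continuous (volterra A k) := by
  induction k with
  | zero => exact continuous_const
  | succ k ih =>
    exact intervalIntegral.continuous_primitive
      (fun a b => (hA.mul ih).intervalIntegrable a b) 0

theorem hasDerivAt_volterra_succ [CompleteSpace R] {A : ℝ → R} (hA : Continuous A) (k : ℕ) (t : ℝ) :
    HasDerivAt (volterra A (k + 1)) (A t * volterra A k t) t :=
  intervalIntegral.integral_hasDerivAt_right
    ((hA.mul (continuous_volterra hA k)).intervalIntegrable _ _)
    ((hA.mul (continuous_volterra hA k)).stronglyMeasurableAtFilter _ _)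
    (hA.mul (continuous_volterra hA k)).continuousAt

theorem norm_volterra_le {A : ℝ → R} {K : ℝ} (hK : 0 ≤ K)
    (hAK : ∀ t, ‖A t‖ ≤ K) (k : ℕ) (t : ℝ) :
    ‖volterra A k t‖ ≤ ‖(1 : R)‖ * (K ^ k * |t| ^ k / k.factorial) := by
  induction k generalizing t with
  | zero => simp [volterra]
  | succ k ih =>
    have hint : ∀ t : ℝ, 0 ≤ t → ∫ s in (0 : ℝ)..t, ‖(1 : R)‖ * (K ^ (k + 1) * s ^ k / k.factorial)
        = ‖(1 : R)‖ * (K ^ (k + 1) * t ^ (k + 1) / (k + 1).factorial) := by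
      intro t _
      rw [intervalIntegral.integral_const_mul, intervalIntegral.integral_div,
        intervalIntegral.integral_const_mul, integral_pow, Nat.factorial_succ]
      push_cast
      field_simp
      simp
    have hbd : ∀ s : ℝ, ‖A s * volterra A k s‖ ≤
        ‖(1 : R)‖ * (K ^ (k + 1) * |s| ^ k / k.factorial) := by
      intro s
      calc ‖A s * volterra A k s‖ ≤ ‖A s‖ * ‖volterra A k s‖ := norm_mul_le _ _
        _ ≤ K * (‖(1 : R)‖ * (K ^ k * |s| ^ k / k.factorial)) := by
            gcongr
            · exact hAK s
            · exact ih s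
        _ = _ := by ring
    rcases le_total 0 t with ht | ht
    · rw [abs_of_nonneg ht, ← hint t ht]
      refine intervalIntegral.norm_integral_le_of_norm_le ht (.of_forall fun s hs => ?_)
        (Continuous.intervalIntegrable (by fun_prop) _ _)
      simpa [abs_of_pos hs.1] using hbd s
    · rw [abs_of_nonpos ht, ← hint (-t) (by linarith)]
      change ‖∫ s in (0 : ℝ)..t, A s * volterra A k s‖ ≤ _
      have h1 : ∫ s in (0 : ℝ)..t, A s * volterra A k s =
          -∫ s in (0 : ℝ)..(-t), A (-s) * volterra A k (-s) := by
        rw [intervalIntegral.integral_comp_neg (fun s => A s * volterra A k s)]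
        rw [neg_neg, neg_zero, intervalIntegral.integral_symm]
      rw [h1, norm_neg]
      refine intervalIntegral.norm_integral_le_of_norm_le (by linarith)
        (.of_forall fun s hs => ?_) (Continuous.intervalIntegrable (by fun_prop) _ _)
      simpa [abs_of_pos hs.1] using hbd (-s)

/-- Existence for linear differential equations. -/
theorem exists_linear_solution [CompleteSpace R] {A : ℝ → R} (hA : ContinuousOn A (Icc 0 1)) :
    ∃ M : ℝ → R, M 0 = 1 ∧
      ∀ t ∈ Icc (0 : ℝ) 1, HasDerivWithinAt M (A t * M t) (Icc 0 1) t := by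
  obtain ⟨K, hK⟩ := isCompact_Icc.exists_bound_of_continuousOn hA
  -- The coefficient is extended by constants beyond `[0, 1]`, so that the series can be
  -- differentiated term by term on the open interval `(-2, 2)`, which contains both endpoints.
  let B : ℝ → R := IccExtend (zero_le_one' ℝ) (fun t : Icc (0 : ℝ) 1 => A t)
  have hB : Continuous B := (continuousOn_iff_continuous_domRestrict.mp hA).Icc_extend'
  have hBK : ∀ t, ‖B t‖ ≤ max K 0 := fun t =>
    (hK _ (projIcc (0 : ℝ) 1 zero_le_one t).2).trans (le_max_left _ _)
  have hK0 : 0 ≤ max K 0 := le_max_right _ _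
  have hBA : ∀ t ∈ Icc (0 : ℝ) 1, B t = A t := fun t ht => by
    simp [B, IccExtend_of_mem _ _ ht]
  generalize max K 0 = K' at hBK hK0
  have hsum2 : Summable fun k : ℕ => ‖(1 : R)‖ * (K' ^ k * 2 ^ k / k.factorial) := by
    refine Summable.mul_left _ ?_
    simpa [mul_pow] using Real.summable_pow_div_factorial (K' * 2)
  have hbound : ∀ k : ℕ, ∀ t ∈ Ioo (-2 : ℝ) 2, ‖volterra B k t‖ ≤
      ‖(1 : R)‖ * (K' ^ k * 2 ^ k / k.factorial) := by
    intro k t ht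
    refine (norm_volterra_le hK0 hBK k t).trans ?_
    have : |t| ≤ 2 := abs_le.mpr ⟨ht.1.le, ht.2.le⟩
    gcongr
  have hsum : ∀ t ∈ Ioo (-2 : ℝ) 2, Summable fun k => volterra B k t := fun t ht =>
    Summable.of_norm_bounded hsum2 fun k => hbound k t ht
  have h0 : (0 : ℝ) ∈ Ioo (-2 : ℝ) 2 := by norm_num
  have hsum' : Summable fun k => volterra B (k + 1) 0 :=
    (summable_nat_add_iff (f := fun k => volterra B k 0) 1).mpr (hsum 0 h0)
  have hder : ∀ t ∈ Ioo (-2 : ℝ) 2, HasDerivAt (fun t => ∑' k, volterra B (k + 1) t)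
      (∑' k, B t * volterra B k t) t := by
    intro t ht
    have hd : ∀ (k : ℕ) (s : ℝ), s ∈ Ioo (-2 : ℝ) 2 →
        HasDerivAt ((fun k => volterra B (k + 1)) k) ((fun k s => B s * volterra B k s) k s) s :=
      fun k s _ => hasDerivAt_volterra_succ hB k s
    refine hasDerivAt_tsum_of_isPreconnected (g := fun k => volterra B (k + 1))
      (g' := fun k s => B s * volterra B k s) (u := fun k => K' * (‖(1 : R)‖ *
      (K' ^ k * 2 ^ k / k.factorial))) (hsum2.mul_left K') isOpen_Ioo isPreconnected_Ioo
      hd (fun k s hs => ?_) h0 hsum' ht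
    refine (norm_mul_le _ _).trans ?_
    gcongr
    · exact hBK s
    · exact hbound k s hs
  refine ⟨fun t => 1 + ∑' k, volterra B (k + 1) t, ?_, fun t ht => ?_⟩
  · simp [volterra]
  · have ht' : t ∈ Ioo (-2 : ℝ) 2 := ⟨by linarith [ht.1], by linarith [ht.2]⟩
    have h1 := (hder t ht').const_add 1
    rw [(hsum t ht').tsum_mul_left, (hsum t ht').tsum_eq_zero_add] at h1
    rw [← hBA t ht]
    exact h1.hasDerivWithinAt

end LinearODE

/-! ### Holomorphic dependence of flows on initial data, and existence of curves in rescaled balls.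
-/

section Flow

variable {E : Type u} [NormedAddCommGroup E] [NormedSpace ℂ E] [FiniteDimensional ℂ E]

/-- The flow of a holomorphic vector field is holomorphic in the initial point, and its
differential solves the linearized equation. -/
theorem exists_hasFDerivAt_flow {V : E → E} {U D : Set E} (hU : IsOpen U)
    (hV : DifferentiableOn ℂ V U) (hD : IsOpen D) {Γ : E → ℝ → E}
    (hΓ : ∀ z ∈ D, IsCurve V U (Γ z) z) {z₀ : E} (hz₀ : z₀ ∈ D) :
    ∃ M : ℝ → E →L[ℂ] E, M 0 = 1 ∧
      (∀ t ∈ Icc (0 : ℝ) 1, HasDerivWithinAt M (fderiv ℂ V (Γ z₀ t) * M t) (Icc 0 1) t) ∧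
      ∀ t ∈ Icc (0 : ℝ) 1, HasFDerivAt (fun z => Γ z t) (M t) z₀ := by
  have : CompleteSpace E := FiniteDimensional.complete ℂ E
  have h := hΓ z₀ hz₀
  obtain ⟨hc, hcU⟩ := h.isCompact_image
  obtain ⟨η, hη, C, hC, hT⟩ := exists_uniform_taylor hU hV hc hcU
  obtain ⟨ε₀, hε₀, C', hC', hs⟩ := h.exists_stability hU hV
  have hAc : ContinuousOn (fun t => fderiv ℂ V (Γ z₀ t)) (Icc 0 1) :=
    (differentiableOn_fderiv hU hV).continuousOn.comp h.continuousOn h.mem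
  obtain ⟨M, hM0, hM⟩ := exists_linear_solution hAc
  refine ⟨M, hM0, hM, fun t ht => ?_⟩
  -- The candidate derivative `M` solves the linearized equation. The error of the linear
  -- approximation then satisfies the same equation up to the second-order Taylor remainder, and
  -- Grönwall bounds it by `B ‖z - z₀‖ ^ 2`.
  set B : ℝ := C * C' ^ 2 * (Real.exp (C + 1) / (C + 1))
  have hkey : ∀ᶠ z in nhds z₀, ‖Γ z t - Γ z₀ t - M t (z - z₀)‖ ≤ B * ‖‖z - z₀‖ ^ 2‖ := by
    have hsmall : 0 < min ε₀ (η / (C' + 1)) := by positivity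
    filter_upwards [hD.mem_nhds hz₀, ball_mem_nhds z₀ hsmall] with z hzD hz
    rw [mem_ball, dist_eq_norm, lt_min_iff] at hz
    rcases eq_or_ne z z₀ with rfl | hne
    · simp
    have hε : 0 < ‖z - z₀‖ := norm_pos_iff.mpr (sub_ne_zero.mpr hne)
    have hst := hs _ hε hz.1 z (Γ z) U (hΓ z hzD) le_rfl
    have hlt : C' * ‖z - z₀‖ < η := by
      have := (lt_div_iff₀ (by positivity : 0 < C' + 1)).mp hz.2
      nlinarith
    have hg := norm_le_gronwallBound_of_norm_deriv_right_le
      (f := fun t => Γ z t - Γ z₀ t - M t (z - z₀))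
      (f' := fun t => V (Γ z t) - V (Γ z₀ t) - (fderiv ℂ V (Γ z₀ t) * M t) (z - z₀))
      (δ := 0) (K := C + 1) (ε := C * (C' * ‖z - z₀‖) ^ 2) (a := 0) (b := 1) ?_ ?_ ?_ ?_ t ht
    · refine hg.trans ?_
      rw [gronwallBound_of_K_ne_0 (by positivity), sub_zero, norm_pow, norm_norm]
      have hexp : Real.exp ((C + 1) * t) ≤ Real.exp (C + 1) :=
        Real.exp_le_exp.mpr (mul_le_of_le_one_right (by positivity) ht.2)
      calc 0 * Real.exp ((C + 1) * t) + C * (C' * ‖z - z₀‖) ^ 2 / (C + 1) *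
            (Real.exp ((C + 1) * t) - 1)
          ≤ C * (C' * ‖z - z₀‖) ^ 2 / (C + 1) * Real.exp (C + 1) := by
            rw [zero_mul, zero_add]; gcongr; linarith
        _ = _ := by simp only [B]; ring
    · intro t ht
      have hd : HasDerivWithinAt (fun t => M t (z - z₀))
          ((fderiv ℂ V (Γ z₀ t) * M t) (z - z₀)) (Icc 0 1) t :=
        ((ContinuousLinearMap.apply ℂ E (z - z₀)).restrictScalars ℝ).hasFDerivAt.comp_hasDerivWithinAt
          t (hM t ht)
      exact ((((hΓ z hzD).deriv t ht).sub (h.deriv t ht)).sub hd).continuousWithinAt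
    · intro t ht
      have ht' := Ico_subset_Icc_self ht
      have hd : HasDerivWithinAt (fun t => M t (z - z₀))
          ((fderiv ℂ V (Γ z₀ t) * M t) (z - z₀)) (Icc 0 1) t :=
        ((ContinuousLinearMap.apply ℂ E (z - z₀)).restrictScalars ℝ).hasFDerivAt.comp_hasDerivWithinAt
          t (hM t ht')
      exact hasDerivWithinAt_Ici_of_Icc ((((hΓ z hzD).deriv t ht').sub (h.deriv t ht')).sub hd) ht
    · simp [(hΓ z hzD).start, h.start, hM0]
    · intro t ht
      have ht' := Ico_subset_Icc_self ht
      obtain ⟨-, hA, hx⟩ := hT _ (mem_image_of_mem (Γ z₀) ht')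
      have hst' := hst t ht'
      have h2 := (hx (Γ z t) (by rw [mem_ball, dist_eq_norm]; exact hst'.trans_lt hlt)).2
      have heq : V (Γ z t) - V (Γ z₀ t) - (fderiv ℂ V (Γ z₀ t) * M t) (z - z₀) =
          fderiv ℂ V (Γ z₀ t) (Γ z t - Γ z₀ t - M t (z - z₀)) +
          (V (Γ z t) - V (Γ z₀ t) - fderiv ℂ V (Γ z₀ t) (Γ z t - Γ z₀ t)) := by
        simp only [map_sub]; abel
      rw [heq]
      refine (norm_add_le _ _).trans ?_
      gcongr
      · refine ((fderiv ℂ V (Γ z₀ t)).le_opNorm _).trans ?_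
        gcongr; linarith
      · refine h2.trans ?_
        gcongr
  rw [hasFDerivAt_iff_isLittleO]
  refine (Asymptotics.IsBigO.of_bound B hkey).trans_isLittleO ?_
  have h1 : (fun z : E => ‖z - z₀‖ ^ 2) =o[nhds z₀] fun z => ‖z - z₀‖ ^ 1 := by
    refine (Asymptotics.isLittleO_pow_pow (m := 1) (n := 2) (by norm_num)).comp_tendsto ?_
    have : Filter.Tendsto (fun z : E => ‖z - z₀‖) (nhds z₀) (nhds ‖z₀ - z₀‖) :=
      (by fun_prop : Continuous fun z : E => ‖z - z₀‖).tendsto z₀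
    simpa using this
  simp only [pow_one] at h1
  exact h1.of_norm_right

/-- Existence of solutions over `[0, 1]` of `β' = T V(b(t) + B β)` in the unit ball. -/
theorem exists_solution_affine {Z Z' : Type u} [NormedAddCommGroup Z] [NormedSpace ℂ Z]
    [FiniteDimensional ℂ Z] [NormedAddCommGroup Z'] [NormedSpace ℂ Z'] [FiniteDimensional ℂ Z']
    {V : Z → Z'} {U : Set Z} (hU : IsOpen U) (hV : DifferentiableOn ℂ V U)
    {b : ℝ → Z} (hb : Continuous b) (B : E →L[ℂ] Z) (T : Z' →L[ℂ] E)
    (hmem : ∀ t ∈ Icc (0 : ℝ) 1, ∀ w ∈ closedBall (0 : E) 1, b t + B w ∈ U)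
    {L : ℝ} (hL : L < 1) (hbd : ∀ t ∈ Icc (0 : ℝ) 1, ∀ w ∈ closedBall (0 : E) 1,
      ‖T (V (b t + B w))‖ ≤ L) :
    ∃ β : ℝ → E, β 0 = 0 ∧ ∀ t ∈ Icc (0 : ℝ) 1, ‖β t‖ ≤ 1 ∧
      HasDerivWithinAt β (T (V (b t + B (β t)))) (Icc 0 1) t := by
  have : CompleteSpace E := FiniteDimensional.complete ℂ E
  have : ProperSpace E := FiniteDimensional.proper ℂ E
  have hL0 : 0 ≤ L := (norm_nonneg _).trans (hbd 0 (by simp) 0 (by simp))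
  let S : Set Z := (fun p : ℝ × E => b p.1 + B p.2) '' (Icc 0 1 ×ˢ closedBall 0 1)
  have hS : IsCompact S := (isCompact_Icc.prod (isCompact_closedBall _ _)).image (by fun_prop)
  have hSU : S ⊆ U := by rintro _ ⟨p, hp, rfl⟩; exact hmem _ hp.1 _ hp.2
  obtain ⟨K, hK⟩ := hS.exists_bound_of_continuousOn
    ((differentiableOn_fderiv hU hV).continuousOn.mono hSU)
  set K' : ℝ := ‖T‖ * (max K 0 * ‖B‖)
  have hK' : 0 ≤ K' := by positivity
  have hd : ∀ t ∈ Icc (0 : ℝ) 1, ∀ w ∈ closedBall (0 : E) 1,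
      HasFDerivAt (fun w => T (V (b t + B w))) (T ∘L (fderiv ℂ V (b t + B w) ∘L B)) w := by
    intro t ht w hw
    have h1 : HasFDerivAt (fun w => b t + B w) B w := B.hasFDerivAt.const_add _
    exact T.hasFDerivAt.comp w
      ((hV.differentiableAt (hU.mem_nhds (hmem t ht w hw))).hasFDerivAt.comp w h1)
  -- The unknown is normalized to the unit ball and the speed is at most `L < 1`, so the solution
  -- cannot leave the ball before time `1`.
  have hPL : IsPicardLindelof (fun t w => T (V (b t + B w))) (tmin := 0) (tmax := 1)
      ⟨0, by simp⟩ (0 : E) 1 0 L.toNNReal K'.toNNReal := by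
    refine ⟨fun t ht => ?_, fun w hw => ?_, fun t ht w hw => ?_, ?_⟩
    · refine LipschitzOnWith.of_dist_le_mul fun x hx y hy => ?_
      rw [Real.coe_toNNReal _ hK', dist_eq_norm, dist_eq_norm]
      refine (convex_closedBall (0 : E) 1).norm_image_sub_le_of_norm_hasFDerivWithin_le
        (fun w hw => (hd t ht w (by simpa using hw)).hasFDerivWithinAt) (fun w hw => ?_) hy hx
      refine (ContinuousLinearMap.opNorm_comp_le _ _).trans ?_
      refine mul_le_mul_of_nonneg_left ((ContinuousLinearMap.opNorm_comp_le _ _).trans ?_)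
        (norm_nonneg _)
      gcongr
      exact (hK _ ⟨(t, w), ⟨ht, by simpa using hw⟩, rfl⟩).trans (le_max_left _ _)
    · exact T.continuous.comp_continuousOn (hV.continuousOn.comp (by fun_prop)
        fun t ht => hmem t ht w (by simpa using hw))
    · rw [Real.coe_toNNReal _ hL0]; exact hbd t ht w (by simpa using hw)
    · simp [hL0, hL.le]
  obtain ⟨β, hβ0, hβ⟩ := hPL.exists_eq_forall_mem_Icc_hasDerivWithinAt₀
  refine ⟨β, hβ0, fun t ht => ⟨?_, hβ t ht⟩⟩
  have h1 : ‖β t‖ ≤ 1 * t := by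
    refine image_norm_le_of_norm_deriv_right_lt_deriv_boundary' (f := β)
      (f' := fun t => T (V (b t + B (β t)))) (a := 0) (b := 1)
      (B := fun t => 1 * t) (B' := fun _ => 1) (fun t ht => (hβ t ht).continuousWithinAt)
      (fun t ht => hasDerivWithinAt_Ici_of_Icc (hβ t (Ico_subset_Icc_self ht)) ht)
      (by simp at hβ0; simp [hβ0]) (by fun_prop)
      (fun t _ => by simpa using ((hasDerivAt_id t).const_mul (1 : ℝ)).hasDerivWithinAt) ?_ ht
    intro t ht h
    refine (hbd t (Ico_subset_Icc_self ht) (β t) ?_).trans_lt hL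
    rw [mem_closedBall_zero_iff, h, one_mul]; exact ht.2.le
  linarith [ht.2]

end Flow

/-! ### First-order transport equations solved by characteristics with complex time. -/

section Transport

theorem hasDerivWithinAt_integral_Icc {F : Type*} [NormedAddCommGroup F] [NormedSpace ℝ F]
    [CompleteSpace F] {g : ℝ → F} (hg : ContinuousOn g (Icc 0 1)) {t : ℝ}
    (ht : t ∈ Icc (0 : ℝ) 1) :
    HasDerivWithinAt (fun t => ∫ s in (0 : ℝ)..t, g s) (g t) (Icc 0 1) t := by
  have : Fact (t ∈ Icc (0 : ℝ) 1) := ⟨ht⟩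
  refine intervalIntegral.integral_hasDerivWithinAt_right
    ((hg.mono ?_).intervalIntegrable) ?_ (hg t ht)
  · rw [uIcc_of_le ht.1]; exact Icc_subset_Icc_right ht.2
  · exact hg.stronglyMeasurableAtFilter_nhdsWithin measurableSet_Icc t

variable {Z : Type u} [NormedAddCommGroup Z] [NormedSpace ℂ Z]

/-- The solution of the transport equation `DF(Y) = q`, `F = 0` on `{ξ = 0}`, obtained by
integration along the family `ζ` of characteristics. -/
def transportSolution (ξ : Z →L[ℂ] ℂ) (q : Z → ℂ) (ζ : Z → ℂ → ℝ → Z) (z : Z) : ℂ :=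
  ∫ t in (0 : ℝ)..1, ξ z * q (ζ z (ξ z) t)

variable {ξ : Z →L[ℂ] ℂ} {q : Z → ℂ} {Y : Z → Z} {Ω D : Set Z} {ζ : Z → ℂ → ℝ → Z}
  {κ : ℝ}

theorem norm_transportSolution_le {z : Z} {C : ℝ}
    (hC : ∀ t ∈ Icc (0 : ℝ) 1, ‖q (ζ z (ξ z) t)‖ ≤ C) :
    ‖transportSolution ξ q ζ z‖ ≤ ‖ξ z‖ * C := by
  have := intervalIntegral.norm_integral_le_of_norm_le_const (a := (0 : ℝ)) (b := 1)
    (f := fun t => ξ z * q (ζ z (ξ z) t)) (C := ‖ξ z‖ * C) (fun t ht => by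
      rw [uIoc_of_le zero_le_one] at ht
      rw [norm_mul]
      gcongr
      exact hC t (Ioc_subset_Icc_self ht))
  rwa [sub_zero, abs_one, mul_one] at this

variable [FiniteDimensional ℂ Z]

/-- The integral is one component of a flow: adjoin the frozen speed `x` and an accumulator `u` with
`u' = x q`. Holomorphic dependence of that flow gives the claim. Since the speed `ξ z` varies with
`z`, curves are needed for all `x` within `κ` of `ξ z`, so that the initial data form an open set.
-/
theorem differentiableOn_transportSolution (hΩ : IsOpen Ω) (hD : IsOpen D)
    (hY : DifferentiableOn ℂ Y Ω) (hq : DifferentiableOn ℂ q Ω) (hκ : 0 < κ)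
    (hζ : ∀ z ∈ D, ∀ x : ℂ, ‖x - ξ z‖ < κ → IsCurve (fun w => -(x • Y w)) Ω (ζ z x) z) :
    DifferentiableOn ℂ (transportSolution ξ q ζ) D := by
  let W : Z × ℂ × ℂ → Z × ℂ × ℂ := fun p => (-(p.2.1 • Y p.1), 0, p.2.1 * q p.1)
  have hW : DifferentiableOn ℂ W (Prod.fst ⁻¹' Ω) := by
    have h1 : DifferentiableOn ℂ (fun p : Z × ℂ × ℂ => Y p.1) (Prod.fst ⁻¹' Ω) :=
      hY.comp differentiableOn_fst fun _ h => h
    have h2 : DifferentiableOn ℂ (fun p : Z × ℂ × ℂ => q p.1) (Prod.fst ⁻¹' Ω) :=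
      hq.comp differentiableOn_fst fun _ h => h
    have h3 : DifferentiableOn ℂ (fun p : Z × ℂ × ℂ => p.2.1) (Prod.fst ⁻¹' Ω) := by fun_prop
    exact (h3.smul h1).neg.prodMk ((differentiableOn_const _).prodMk (h3.mul h2))
  let D' : Set (Z × ℂ × ℂ) := {p | p.1 ∈ D ∧ ‖p.2.1 - ξ p.1‖ < κ}
  have hD' : IsOpen D' := (hD.preimage continuous_fst).inter
    (isOpen_lt (f := fun p : Z × ℂ × ℂ => ‖p.2.1 - ξ p.1‖) (by fun_prop) continuous_const)
  let Γ : Z × ℂ × ℂ → ℝ → Z × ℂ × ℂ := fun p t =>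
    (ζ p.1 p.2.1 t, p.2.1, p.2.2 + ∫ s in (0 : ℝ)..t, p.2.1 * q (ζ p.1 p.2.1 s))
  have hΓ : ∀ p ∈ D', IsCurve W (Prod.fst ⁻¹' Ω) (Γ p) p := by
    rintro ⟨z, x, u⟩ ⟨hz, hx⟩
    have h := hζ z hz x hx
    refine ⟨by simp [Γ, h.start], fun t ht => h.mem t ht, fun t ht => ?_⟩
    refine (h.deriv t ht).prodMk ((hasDerivWithinAt_const t _ x).prodMk ?_)
    refine (hasDerivWithinAt_integral_Icc (g := fun s => x * q (ζ z x s)) ?_ ht).const_add u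
    exact continuousOn_const.mul (hq.continuousOn.comp h.continuousOn h.mem)
  intro z hz
  have hz' : ((z, ξ z, 0) : Z × ℂ × ℂ) ∈ D' := ⟨hz, by simpa using hκ⟩
  obtain ⟨M, -, -, hM⟩ := exists_hasFDerivAt_flow (hΩ.preimage continuous_fst) hW hD' hΓ hz'
  have h1 := (hM 1 (by simp)).differentiableAt
  have h2 : DifferentiableAt ℂ (fun w : Z => ((w, ξ w, 0) : Z × ℂ × ℂ)) z := by fun_prop
  have h3 := (DifferentiableAt.comp z h1 h2).snd.snd
  refine (h3.congr_of_eventuallyEq (.of_forall fun w => ?_)).differentiableWithinAt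
  simp [transportSolution, Γ]

/-- From a point of a characteristic, the characteristic back to `{ξ = 0}` is the rest of the same
curve, reparametrized. So along the curve the solution is the remaining part of the integral, and
its derivative at time `0` gives the equation multiplied by `x = ξ z`, which can be cancelled. -/
theorem fderiv_transportSolution_of_ne_zero (hΩ : IsOpen Ω) (hD : IsOpen D)
    (hY : DifferentiableOn ℂ Y Ω) (hq : DifferentiableOn ℂ q Ω) (hκ : 0 < κ)
    (hξ : ∀ z ∈ Ω, ξ (Y z) = 1)
    (hζ : ∀ z ∈ D, ∀ x : ℂ, ‖x - ξ z‖ < κ → IsCurve (fun w => -(x • Y w)) Ω (ζ z x) z)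
    {z : Z} (hz : z ∈ D) (hz0 : ξ z ≠ 0) :
    fderiv ℂ (transportSolution ξ q ζ) z (Y z) = q z := by
  set x := ξ z with hx
  have h := hζ z hz x (by simpa [hx] using hκ)
  set γ := ζ z x with hγ
  set F := transportSolution ξ q ζ with hF
  have h01 : (0 : ℝ) ∈ Icc (0 : ℝ) 1 := by simp
  -- The coordinate `ξ` decreases linearly to `0`, because `ξ (Y) = 1`; the integration thus starts
  -- at `z` and ends on the section `{ξ = 0}`.
  have hξγ : ∀ t ∈ Icc (0 : ℝ) 1, ξ (γ t) = (1 - t) * x := by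
    intro t ht
    have hd : ∀ t ∈ Icc (0 : ℝ) 1, HasDerivWithinAt (fun t : ℝ => ξ (γ t) + t * x) 0 (Icc 0 1) t := by
      intro t ht
      have h1 := (ξ.restrictScalars ℝ).hasFDerivAt.comp_hasDerivWithinAt t (h.deriv t ht)
      have h2 : HasDerivWithinAt (fun t : ℝ => (t : ℂ) * x) x (Icc 0 1) t := by
        simpa using (Complex.ofRealCLM.hasDerivAt.mul_const x).hasDerivWithinAt
      have h3 := h1.add h2
      simp only [ContinuousLinearMap.coe_restrictScalars', map_neg, map_smul, smul_eq_mul,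
        hξ _ (h.mem t ht), mul_one, neg_add_cancel] at h3
      exact h3
    have := constant_of_has_deriv_right_zero (fun t ht => (hd t ht).continuousWithinAt)
      (fun t ht => hasDerivWithinAt_Ici_of_Icc (hd t (Ico_subset_Icc_self ht)) ht) t ht
    simp only [h.start, Complex.ofReal_zero, zero_mul, add_zero, ← hx] at this
    linear_combination this
  set g : ℝ → ℂ := fun t => x * q (γ t)
  have hg : ContinuousOn g (Icc 0 1) :=
    continuousOn_const.mul (hq.continuousOn.comp h.continuousOn h.mem)
  have hFγ : ∀ t ∈ Icc (0 : ℝ) 1, γ t ∈ D →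
      F (γ t) = (∫ s in (0 : ℝ)..1, g s) - ∫ s in (0 : ℝ)..t, g s := by
    intro t ht htD
    have hmaps : ∀ s ∈ Icc (0 : ℝ) 1, t + (1 - t) * s ∈ Icc (0 : ℝ) 1 := fun s hs =>
      ⟨by nlinarith [hs.1, ht.1, ht.2], by nlinarith [hs.2, ht.2]⟩
    have hc : IsCurve (fun w => -(ξ (γ t) • Y w)) Ω (fun s => γ (t + (1 - t) * s)) (γ t) := by
      refine ⟨by simp, fun s hs => h.mem _ (hmaps s hs), fun s hs => ?_⟩
      have h1 : HasDerivWithinAt (fun s : ℝ => t + (1 - t) * s) (1 - t) (Icc 0 1) s := by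
        simpa using (((hasDerivAt_id s).const_mul (1 - t)).const_add t).hasDerivWithinAt
      have h2 := (h.deriv _ (hmaps s hs)).scomp s h1 hmaps
      rw [hξγ t ht]
      have h3 : (1 - t : ℝ) • -(x • Y (γ (t + (1 - t) * s))) =
          -(((1 - (t : ℂ)) * x) • Y (γ (t + (1 - t) * s))) := by
        rw [smul_neg, mul_smul, ← Complex.coe_smul]; norm_num
      rw [h3] at h2
      exact h2
    have hV : DifferentiableOn ℂ (fun w => -(ξ (γ t) • Y w)) Ω := by fun_prop
    have hu := (hζ _ htD (ξ (γ t)) (by simpa using hκ)).unique hΩ hV hc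
    have hint : ∀ a ∈ Icc (0 : ℝ) 1, ∀ b ∈ Icc (0 : ℝ) 1, IntervalIntegrable g volume a b :=
      fun a ha b hb => (hg.mono (uIcc_subset_Icc ha hb)).intervalIntegrable
    rw [intervalIntegral.integral_interval_sub_left (hint 0 h01 1 (by simp)) (hint 0 h01 t ht)]
    have h3 : F (γ t) = ∫ s in (0 : ℝ)..1, (1 - t) • g (t + (1 - t) * s) := by
      rw [hF, transportSolution]
      refine intervalIntegral.integral_congr fun s hs => ?_
      rw [uIcc_of_le zero_le_one] at hs
      simp only [g]
      rw [← hu s hs]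
      conv_lhs => rw [hξγ t ht]
      rw [← Complex.coe_smul, smul_eq_mul]; push_cast; ring
    rw [h3, intervalIntegral.integral_smul,
      intervalIntegral.smul_integral_comp_add_mul g (1 - t) t]
    simp
  have hFd : HasFDerivAt F (fderiv ℂ F z) (γ 0) := by
    rw [h.start]
    exact ((differentiableOn_transportSolution hΩ hD hY hq hκ hζ).differentiableAt
      (hD.mem_nhds hz)).hasFDerivAt
  have h1 : HasDerivWithinAt (fun t => F (γ t)) (fderiv ℂ F z (-(x • Y z))) (Icc 0 1) 0 := by
    have := (hFd.restrictScalars ℝ).comp_hasDerivWithinAt (0 : ℝ) (h.deriv 0 h01)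
    simpa [h.start, Function.comp_def] using this
  have h2 : HasDerivWithinAt (fun t => F (γ t)) (-(g 0)) (Icc 0 1) 0 := by
    have h3 := (hasDerivWithinAt_integral_Icc hg h01).const_sub (∫ s in (0 : ℝ)..1, g s)
    refine h3.congr_of_eventuallyEq ?_ (hFγ 0 h01 (by rwa [h.start]))
    have hev : ∀ᶠ t in nhdsWithin 0 (Icc (0 : ℝ) 1), γ t ∈ D :=
      (h.continuousOn 0 h01).eventually (by rw [h.start]; exact hD.mem_nhds hz)
    filter_upwards [hev, self_mem_nhdsWithin] with t ht1 ht2 using hFγ t ht2 ht1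
  have h3 := (uniqueDiffOn_Icc_zero_one.uniqueDiffWithinAt h01).eq_deriv _ h1 h2
  simp only [map_neg, map_smul, smul_eq_mul, g, h.start, neg_inj] at h3
  exact mul_left_cancel₀ hz0 h3

/-- The transport equation. -/
theorem fderiv_transportSolution (hΩ : IsOpen Ω) (hD : IsOpen D) (hDΩ : D ⊆ Ω)
    (hY : DifferentiableOn ℂ Y Ω) (hq : DifferentiableOn ℂ q Ω) (hκ : 0 < κ)
    (hξ : ∀ z ∈ Ω, ξ (Y z) = 1)
    (hζ : ∀ z ∈ D, ∀ x : ℂ, ‖x - ξ z‖ < κ → IsCurve (fun w => -(x • Y w)) Ω (ζ z x) z)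
    {z : Z} (hz : z ∈ D) : fderiv ℂ (transportSolution ξ q ζ) z (Y z) = q z := by
  by_cases hz0 : ξ z = 0
  swap
  · exact fderiv_transportSolution_of_ne_zero hΩ hD hY hq hκ hξ hζ hz hz0
  set F := transportSolution ξ q ζ
  have hF := differentiableOn_transportSolution hΩ hD hY hq hκ hζ
  -- Points of the section are reached as limits: moving by `ε Y z` makes `ξ` equal to `ε`, and both
  -- sides of the equation are continuous.
  let p : ℝ → Z := fun ε => z + (ε : ℂ) • Y z
  have hp : Continuous p := by fun_prop
  have hp0 : p 0 = z := by simp [p]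
  have hc1 : ContinuousAt (fun w => fderiv ℂ F w (Y w)) z :=
    (((differentiableOn_fderiv hD hF).clm_apply (hY.mono hDΩ)).continuousOn).continuousAt
      (hD.mem_nhds hz)
  have hc2 : ContinuousAt q z := hq.continuousOn.continuousAt (hΩ.mem_nhds (hDΩ hz))
  have ht : Filter.Tendsto p (nhdsWithin 0 {0}ᶜ) (nhds z) := by
    have := hp.tendsto 0
    rw [hp0] at this
    exact this.mono_left nhdsWithin_le_nhds
  refine tendsto_nhds_unique_of_eventuallyEq (hc1.tendsto.comp ht) (hc2.tendsto.comp ht) ?_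
  filter_upwards [ht.eventually (hD.mem_nhds hz), self_mem_nhdsWithin] with ε hε hε0
  refine fderiv_transportSolution_of_ne_zero hΩ hD hY hq hκ hξ hζ hε ?_
  simp only [p, map_add, map_smul, hz0, hξ z (hDΩ hz)]
  simpa using hε0

end Transport

/-! ### Hamiltonian fields on phase space with a deformation parameter. -/

section Extended

/-- The extended phase space: a further coordinate carries the deformation parameter. -/
abbrev ExtPhase (n : ℕ) := Phase n × ℂ

variable {n : ℕ}

/-- Tangent vectors along the action variables. -/
def vecI (v : CVec n) : ExtPhase n := ((v, 0, 0, 0), 0)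
/-- Tangent vectors along the angles. -/
def vecPhi (v : CVec n) : ExtPhase n := ((0, v, 0, 0), 0)
/-- The unit tangent vector along `y`. -/
def vecY : ExtPhase n := ((0, 0, 1, 0), 0)
/-- The unit tangent vector along `x`. -/
def vecX : ExtPhase n := ((0, 0, 0, 1), 0)

/-- The Hamiltonian vector of a covector: `(-ℓ_φ, ℓ_I, -ℓ_x, ℓ_y)`. -/
def hamVec (n : ℕ) : (ExtPhase n →L[ℂ] ℂ) →L[ℂ] Phase n :=
  LinearMap.toContinuousLinearMap
    { toFun := fun ℓ =>
        (WithLp.toLp 2 fun i => -ℓ (vecPhi (EuclideanSpace.single i 1)),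
          WithLp.toLp 2 fun i => ℓ (vecI (EuclideanSpace.single i 1)), -ℓ vecX, ℓ vecY)
      map_add' := fun ℓ ℓ' => by
        ext <;> simp <;> ring
      map_smul' := fun r ℓ => by
        ext <;> simp }

theorem hamVec_apply (ℓ : ExtPhase n →L[ℂ] ℂ) : hamVec n ℓ =
    (WithLp.toLp 2 fun i => -ℓ (vecPhi (EuclideanSpace.single i 1)),
      WithLp.toLp 2 fun i => ℓ (vecI (EuclideanSpace.single i 1)), -ℓ vecX, ℓ vecY) := rfl

theorem sum_smul_single (v : CVec n) : ∑ i, v i • EuclideanSpace.single i (1 : ℂ) = v := by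
  ext j
  simp [Finset.sum_apply, Pi.single_apply]

theorem apply_vecI (ℓ : ExtPhase n →L[ℂ] ℂ) (v : CVec n) :
    ℓ (vecI v) = ∑ i, v i * ℓ (vecI (EuclideanSpace.single i 1)) := by
  let ι : CVec n →ₗ[ℂ] ExtPhase n := LinearMap.inl ℂ _ _ ∘ₗ LinearMap.inl ℂ _ _
  change ℓ (ι v) = ∑ i, v i * ℓ (ι (EuclideanSpace.single i 1))
  conv_lhs => rw [← sum_smul_single v]
  simp only [map_sum, map_smul, smul_eq_mul]

theorem apply_vecPhi (ℓ : ExtPhase n →L[ℂ] ℂ) (v : CVec n) :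
    ℓ (vecPhi v) = ∑ i, v i * ℓ (vecPhi (EuclideanSpace.single i 1)) := by
  let ι : CVec n →ₗ[ℂ] ExtPhase n :=
    LinearMap.inl ℂ _ _ ∘ₗ LinearMap.inr ℂ _ _ ∘ₗ LinearMap.inl ℂ _ _
  change ℓ (ι v) = ∑ i, v i * ℓ (ι (EuclideanSpace.single i 1))
  conv_lhs => rw [← sum_smul_single v]
  simp only [map_sum, map_smul, smul_eq_mul]

theorem extPhase_decomp (v : Phase n) :
    ((v, 0) : ExtPhase n) = vecI v.1 + vecPhi v.2.1 + v.2.2.1 • vecY + v.2.2.2 • vecX := by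
  simp [vecI, vecPhi, vecY, vecX]

theorem sympl_hamVec (ℓ : ExtPhase n →L[ℂ] ℂ) (v : Phase n) :
    sympl (hamVec n ℓ) v = -ℓ (v, 0) := by
  rw [extPhase_decomp, map_add, map_add, map_add, map_smul, map_smul, apply_vecI, apply_vecPhi]
  simp only [sympl, hamVec_apply, Finset.sum_sub_distrib, neg_mul, Finset.sum_neg_distrib,
    smul_eq_mul]
  simp only [mul_comm]
  ring

theorem sympl_comm (u v : Phase n) : sympl u v = -sympl v u := by
  simp only [sympl, neg_add, ← Finset.sum_neg_distrib]
  congr 1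
  · exact Finset.sum_congr rfl fun i _ => by ring
  · ring

/-- Antisymmetry of the Poisson bracket. It turns the transport equation, which differentiates the
generator along the flow of the family, into a statement about the family along the flow of the
generator. -/
theorem apply_hamVec_comm (ℓ ℓ' : ExtPhase n →L[ℂ] ℂ) :
    ℓ' (hamVec n ℓ, 0) = -ℓ (hamVec n ℓ', 0) := by
  have h1 := sympl_hamVec ℓ' (hamVec n ℓ)
  have h2 := sympl_hamVec ℓ (hamVec n ℓ')
  have h3 := sympl_comm (hamVec n ℓ') (hamVec n ℓ)
  linear_combination h1 + h2 - h3

theorem hasDerivWithinAt_sympl {u v : ℝ → Phase n} {u' v' : Phase n} {s : Set ℝ} {t : ℝ}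
    (hu : HasDerivWithinAt u u' s t) (hv : HasDerivWithinAt v v' s t) :
    HasDerivWithinAt (fun t => sympl (u t) (v t)) (sympl u' (v t) + sympl (u t) v') s t := by
  have comp : ∀ {w : ℝ → Phase n} {w' : Phase n}, HasDerivWithinAt w w' s t →
      ∀ ℓ : Phase n →L[ℂ] ℂ, HasDerivWithinAt (fun t => ℓ (w t)) (ℓ w') s t :=
    fun hw ℓ => (ℓ.restrictScalars ℝ).hasFDerivAt.comp_hasDerivWithinAt t hw
  let pI : Fin n → Phase n →L[ℂ] ℂ := fun i =>
    EuclideanSpace.proj i ∘L ContinuousLinearMap.fst ℂ _ _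
  let pP : Fin n → Phase n →L[ℂ] ℂ := fun i =>
    EuclideanSpace.proj i ∘L ContinuousLinearMap.fst ℂ _ _ ∘L ContinuousLinearMap.snd ℂ _ _
  let pY : Phase n →L[ℂ] ℂ := ContinuousLinearMap.fst ℂ _ _ ∘L
    ContinuousLinearMap.snd ℂ _ _ ∘L ContinuousLinearMap.snd ℂ _ _
  let pX : Phase n →L[ℂ] ℂ := ContinuousLinearMap.snd ℂ _ _ ∘L
    ContinuousLinearMap.snd ℂ _ _ ∘L ContinuousLinearMap.snd ℂ _ _
  have h := (HasDerivWithinAt.fun_sum (u := Finset.univ) fun i _ =>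
    ((comp hu (pI i)).mul (comp hv (pP i))).sub ((comp hv (pI i)).mul (comp hu (pP i)))).add
    (((comp hu pY).mul (comp hv pX)).sub ((comp hv pY).mul (comp hu pX)))
  refine h.congr_deriv ?_
  change ∑ i, (u'.1 i * (v t).2.1 i + (u t).1 i * v'.2.1 i -
      (v'.1 i * (u t).2.1 i + (v t).1 i * u'.2.1 i)) +
    (u'.2.2.1 * (v t).2.2.2 + (u t).2.2.1 * v'.2.2.2 -
      (v'.2.2.1 * (u t).2.2.2 + (v t).2.2.1 * u'.2.2.2)) = _
  simp only [sympl, Finset.sum_sub_distrib, Finset.sum_add_distrib]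
  ring

/-- The vector field of the time-dependent Hamiltonian `F`, on the extended phase space. -/
def hamField (F : ExtPhase n → ℂ) (w : ExtPhase n) : ExtPhase n := (hamVec n (fderiv ℂ F w), 1)

theorem differentiableOn_hamField {F : ExtPhase n → ℂ} {D : Set (ExtPhase n)} (hD : IsOpen D)
    (hF : DifferentiableOn ℂ F D) : DifferentiableOn ℂ (hamField F) D :=
  ((hamVec n).differentiable.comp_differentiableOn (differentiableOn_fderiv hD hF)).prodMk
    (differentiableOn_const _)

theorem fderiv_hamField_apply {F : ExtPhase n → ℂ} {D : Set (ExtPhase n)} (hD : IsOpen D)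
    (hF : DifferentiableOn ℂ F D) {w : ExtPhase n} (hw : w ∈ D) (u : ExtPhase n) :
    fderiv ℂ (hamField F) w u = (hamVec n (fderiv ℂ (fderiv ℂ F) w u), 0) := by
  have h1 := ((differentiableOn_fderiv hD hF).differentiableAt (hD.mem_nhds hw)).hasFDerivAt
  have h2 := ((hamVec n).hasFDerivAt.comp w h1).prodMk (hasFDerivAt_const (1 : ℂ) w)
  have h3 : fderiv ℂ (hamField F) w = _ := h2.fderiv
  rw [h3]; rfl

theorem fderiv_fderiv_symm {F : ExtPhase n → ℂ} {D : Set (ExtPhase n)} (hD : IsOpen D)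
    (hF : DifferentiableOn ℂ F D) {w : ExtPhase n} (hw : w ∈ D) (u v : ExtPhase n) :
    fderiv ℂ (fderiv ℂ F) w u v = fderiv ℂ (fderiv ℂ F) w v u :=
  ((contDiffOn_nat_of_differentiableOn 2 hD hF).contDiffAt (hD.mem_nhds hw)).isSymmSndFDerivAt
    (by simp) u v

/-- The linearized Hamiltonian flow is symplectic. -/
theorem sympl_linearized_flow {F : ExtPhase n → ℂ} {D : Set (ExtPhase n)} (hD : IsOpen D)
    (hF : DifferentiableOn ℂ F D) {γ : ℝ → ExtPhase n} {z : ExtPhase n}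
    (hγ : IsCurve (hamField F) D γ z) {M : ℝ → ExtPhase n →L[ℂ] ExtPhase n} (hM0 : M 0 = 1)
    (hM : ∀ t ∈ Icc (0 : ℝ) 1, HasDerivWithinAt M (fderiv ℂ (hamField F) (γ t) * M t) (Icc 0 1) t)
    (u v : Phase n) : ∀ t ∈ Icc (0 : ℝ) 1,
      sympl (M t (u, 0)).1 (M t (v, 0)).1 = sympl u v := by
  have hMu : ∀ u : ExtPhase n, ∀ t ∈ Icc (0 : ℝ) 1, HasDerivWithinAt (fun t => M t u)
      (hamVec n (fderiv ℂ (fderiv ℂ F) (γ t) (M t u)), 0) (Icc 0 1) t := by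
    intro u t ht
    have := ((ContinuousLinearMap.apply ℂ (ExtPhase n) u).restrictScalars
      ℝ).hasFDerivAt.comp_hasDerivWithinAt t (hM t ht)
    refine this.congr_deriv ?_
    exact fderiv_hamField_apply hD hF (hγ.mem t ht) (M t u)
  -- The field has constant parameter component, so its linearization never leaves the tangent space
  -- of phase space. Conservation of the form then reduces to the symmetry of the second derivative
  -- of `F`.
  have hsnd : ∀ u : Phase n, ∀ t ∈ Icc (0 : ℝ) 1, (M t (u, 0)).2 = 0 := by
    intro u t ht
    have hd : ∀ t ∈ Icc (0 : ℝ) 1, HasDerivWithinAt (fun t => (M t (u, 0)).2) 0 (Icc 0 1) t :=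
      fun t ht => (hMu (u, 0) t ht).snd
    have := constant_of_has_deriv_right_zero (fun t ht => (hd t ht).continuousWithinAt)
      (fun t ht => hasDerivWithinAt_Ici_of_Icc (hd t (Ico_subset_Icc_self ht)) ht) t ht
    simpa [hM0] using this
  have hd : ∀ t ∈ Icc (0 : ℝ) 1, HasDerivWithinAt
      (fun t => sympl (M t (u, 0)).1 (M t (v, 0)).1) 0 (Icc 0 1) t := by
    intro t ht
    refine (hasDerivWithinAt_sympl (hMu (u, 0) t ht).fst (hMu (v, 0) t ht).fst).congr_deriv ?_
    have hu : (((M t (u, 0)).1, 0) : ExtPhase n) = M t (u, 0) :=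
      Prod.ext rfl (hsnd u t ht).symm
    have hv : (((M t (v, 0)).1, 0) : ExtPhase n) = M t (v, 0) :=
      Prod.ext rfl (hsnd v t ht).symm
    rw [sympl_comm (M t (u, 0)).1, sympl_hamVec, sympl_hamVec, hu, hv,
      fderiv_fderiv_symm hD hF (hγ.mem t ht)]
    ring
  intro t ht
  have := constant_of_has_deriv_right_zero (fun t ht => (hd t ht).continuousWithinAt)
    (fun t ht => hasDerivWithinAt_Ici_of_Icc (hd t (Ico_subset_Icc_self ht)) ht) t ht
  simpa [hM0] using this

/-- If `{F, G} = ∂_τ G`, then `G` is constant along the flow of `F`. -/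
theorem energy_const {F G : ExtPhase n → ℂ} {D : Set (ExtPhase n)} (hD : IsOpen D)
    (hG : DifferentiableOn ℂ G D)
    (hFG : ∀ w ∈ D, fderiv ℂ F w (hamVec n (fderiv ℂ G w), 0) = fderiv ℂ G w (0, 1))
    {γ : ℝ → ExtPhase n} {z : ExtPhase n} (hγ : IsCurve (hamField F) D γ z) :
    G (γ 1) = G z := by
  have hd : ∀ t ∈ Icc (0 : ℝ) 1, HasDerivWithinAt (fun t => G (γ t)) 0 (Icc 0 1) t := by
    intro t ht
    have h1 := ((hG.differentiableAt (hD.mem_nhds (hγ.mem t ht))).hasFDerivAt.restrictScalars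
      ℝ).comp_hasDerivWithinAt t (hγ.deriv t ht)
    refine h1.congr_deriv ?_
    have h2 : hamField F (γ t) = (hamVec n (fderiv ℂ F (γ t)), 0) + (0, 1) := by
      simp [hamField]
    rw [ContinuousLinearMap.coe_restrictScalars', h2, map_add, apply_hamVec_comm,
      hFG _ (hγ.mem t ht), neg_add_cancel]
  have := constant_of_has_deriv_right_zero (fun t ht => (hd t ht).continuousWithinAt)
    (fun t ht => hasDerivWithinAt_Ici_of_Icc (hd t (Ico_subset_Icc_self ht)) ht) 1 (by simp)
  rwa [hγ.start] at this

end Extended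

/-! ### Cauchy estimates for the components of a Hamiltonian field. -/

section Cauchy

variable {Z : Type*} [NormedAddCommGroup Z] [NormedSpace ℂ Z]

/-- Cauchy's estimate for directional derivatives. -/
theorem norm_fderiv_apply_le {f : Z → ℂ} {U : Set Z} (hU : IsOpen U)
    (hf : DifferentiableOn ℂ f U) {w v : Z} {R M : ℝ} (hR : 0 < R)
    (hmem : ∀ ζ : ℂ, ‖ζ‖ ≤ R → w + ζ • v ∈ U) (hM : ∀ ζ : ℂ, ‖ζ‖ ≤ R → ‖f (w + ζ • v)‖ ≤ M) :
    ‖fderiv ℂ f w v‖ ≤ M / R := by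
  have hg : ∀ ζ ∈ closedBall (0 : ℂ) R,
      HasDerivAt (fun ζ : ℂ => f (w + ζ • v)) (fderiv ℂ f (w + ζ • v) v) ζ := by
    intro ζ hζ
    have h1 : HasDerivAt (fun ζ : ℂ => w + ζ • v) v ζ := by
      simpa using ((hasDerivAt_id ζ).smul_const v).const_add w
    exact ((hf.differentiableAt (hU.mem_nhds
      (hmem ζ (by simpa using hζ)))).hasFDerivAt).comp_hasDerivAt ζ h1
  have h0 : deriv (fun ζ : ℂ => f (w + ζ • v)) 0 = fderiv ℂ f w v := by
    simpa using (hg 0 (mem_closedBall_self hR.le)).deriv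
  rw [← h0]
  refine Complex.norm_deriv_le_of_forall_mem_sphere_norm_le hR ?_ fun ζ hζ => hM ζ ?_
  · refine DifferentiableOn.diffContOnCl ?_
    rw [closure_ball _ hR.ne']
    exact fun ζ hζ => (hg ζ hζ).differentiableAt.differentiableWithinAt
  · simp at hζ; exact hζ.le

variable {n : ℕ}

/-- Duality of the Euclidean norm: the extremal test vector is the normalized conjugate of `u`.
Bounds on unit directional derivatives thus bound the whole gradient without any factor depending on
`n`. -/
theorem norm_toLp_le {u : Fin n → ℂ} {C : ℝ}
    (h : ∀ v : CVec n, ‖v‖ = 1 → ‖∑ i, v i * u i‖ ≤ C) (hC : 0 ≤ C) :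
    ‖(WithLp.toLp 2 u : CVec n)‖ ≤ C := by
  set U : CVec n := WithLp.toLp 2 u
  rcases eq_or_ne U 0 with h0 | h0
  · rw [h0, norm_zero]; exact hC
  have hU : 0 < ‖U‖ := norm_pos_iff.mpr h0
  let v : CVec n := ((‖U‖ : ℂ)⁻¹) • WithLp.toLp 2 fun i => (starRingEnd ℂ) (u i)
  have hconj : ‖(WithLp.toLp 2 fun i => (starRingEnd ℂ) (u i) : CVec n)‖ = ‖U‖ := by
    simp [U, EuclideanSpace.norm_eq]
  have hv : ‖v‖ = 1 := by
    simp only [v, norm_smul, hconj, norm_inv, Complex.norm_real, norm_norm]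
    field_simp
  have h1 := h v hv
  have h2 : ∑ i, v i * u i = (‖U‖ : ℂ) := by
    have h3 : ∑ i, (starRingEnd ℂ) (u i) * u i = ((‖U‖ ^ 2 : ℝ) : ℂ) := by
      rw [EuclideanSpace.norm_sq_eq]
      push_cast
      refine Finset.sum_congr rfl fun i _ => ?_
      rw [← Complex.normSq_eq_conj_mul_self, Complex.normSq_eq_norm_sq]; simp [U]
    have h4 : ∀ i, v i * u i = (‖U‖ : ℂ)⁻¹ * ((starRingEnd ℂ) (u i) * u i) := fun i => by
      simp [v, mul_assoc]
    simp only [h4, ← Finset.mul_sum, h3]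
    have : (‖U‖ : ℂ) ≠ 0 := by exact_mod_cast hU.ne'
    push_cast; field_simp
  rw [h2] at h1
  simpa using h1

theorem norm_hamVec_fst_le {ℓ : ExtPhase n →L[ℂ] ℂ} {C : ℝ} (hC : 0 ≤ C)
    (h : ∀ v : CVec n, ‖v‖ = 1 → ‖ℓ (vecPhi v)‖ ≤ C) : ‖(hamVec n ℓ).1‖ ≤ C := by
  refine norm_toLp_le (fun v hv => ?_) hC
  have := h v hv
  rw [apply_vecPhi] at this
  simpa [mul_neg, Finset.sum_neg_distrib] using this

theorem norm_hamVec_snd_le {ℓ : ExtPhase n →L[ℂ] ℂ} {C : ℝ} (hC : 0 ≤ C)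
    (h : ∀ v : CVec n, ‖v‖ = 1 → ‖ℓ (vecI v)‖ ≤ C) : ‖(hamVec n ℓ).2.1‖ ≤ C := by
  refine norm_toLp_le (fun v hv => ?_) hC
  have := h v hv
  rwa [apply_vecI] at this

end Cauchy

/-! ### Existence of integral curves in polydiscs and along segments in `x`. -/

section Boxes

variable {n : ℕ}

/-- Diagonal scaling of the extended phase space. -/
def scaleMap (n : ℕ) (r₁ r₂ r₃ r₄ r₅ : ℝ) : ExtPhase n →L[ℂ] ExtPhase n :=
  (((r₁ : ℂ) • ContinuousLinearMap.id ℂ (CVec n)).prodMap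
    (((r₂ : ℂ) • ContinuousLinearMap.id ℂ (CVec n)).prodMap
      (((r₃ : ℂ) • ContinuousLinearMap.id ℂ ℂ).prodMap
        ((r₄ : ℂ) • ContinuousLinearMap.id ℂ ℂ)))).prodMap ((r₅ : ℂ) • ContinuousLinearMap.id ℂ ℂ)

theorem scaleMap_apply (r₁ r₂ r₃ r₄ r₅ : ℝ) (w : ExtPhase n) : scaleMap n r₁ r₂ r₃ r₄ r₅ w =
    (((r₁ : ℂ) • w.1.1, (r₂ : ℂ) • w.1.2.1, (r₃ : ℂ) * w.1.2.2.1, (r₄ : ℂ) * w.1.2.2.2),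
      (r₅ : ℂ) * w.2) := rfl

/-- A closed polydisc of the extended phase space. -/
def polydisc (z : ExtPhase n) (r₁ r₂ r₃ r₄ r₅ : ℝ) : Set (ExtPhase n) :=
  {w | ‖w.1.1 - z.1.1‖ ≤ r₁ ∧ ‖w.1.2.1 - z.1.2.1‖ ≤ r₂ ∧ ‖w.1.2.2.1 - z.1.2.2.1‖ ≤ r₃ ∧
    ‖w.1.2.2.2 - z.1.2.2.2‖ ≤ r₄ ∧ ‖w.2 - z.2‖ ≤ r₅}

theorem extPhase_norm_le_iff {w : ExtPhase n} {C : ℝ} : ‖w‖ ≤ C ↔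
    ‖w.1.1‖ ≤ C ∧ ‖w.1.2.1‖ ≤ C ∧ ‖w.1.2.2.1‖ ≤ C ∧ ‖w.1.2.2.2‖ ≤ C ∧ ‖w.2‖ ≤ C := by
  simp only [Prod.norm_def, max_le_iff]; tauto

theorem norm_ofReal_smul_le {F : Type*} [NormedAddCommGroup F] [NormedSpace ℂ F] {r : ℝ}
    (hr : 0 ≤ r) {v : F} (hv : ‖v‖ ≤ 1) : ‖(r : ℂ) • v‖ ≤ r := by
  rw [norm_smul, Complex.norm_real, Real.norm_of_nonneg hr]
  exact mul_le_of_le_one_right hr hv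

theorem norm_inv_smul_le {F : Type*} [NormedAddCommGroup F] [NormedSpace ℂ F] {r L : ℝ}
    (hr : 0 < r) {v : F} (hv : ‖v‖ ≤ L * r) : ‖((r⁻¹ : ℝ) : ℂ) • v‖ ≤ L := by
  rw [norm_smul, Complex.norm_real, Real.norm_of_nonneg (by positivity), inv_mul_le_iff₀ hr]
  linarith

/-- Existence of integral curves in a polydisc. -/
theorem exists_isCurve_polydisc {V : ExtPhase n → ExtPhase n} {U : Set (ExtPhase n)}
    (hU : IsOpen U) (hV : DifferentiableOn ℂ V U) {z : ExtPhase n} {r₁ r₂ r₃ r₄ r₅ L : ℝ}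
    (h₁ : 0 < r₁) (h₂ : 0 < r₂) (h₃ : 0 < r₃) (h₄ : 0 < r₄) (h₅ : 0 < r₅) (hL : L < 1)
    (hmem : polydisc z r₁ r₂ r₃ r₄ r₅ ⊆ U)
    (hb : ∀ w ∈ polydisc z r₁ r₂ r₃ r₄ r₅, ‖(V w).1.1‖ ≤ L * r₁ ∧ ‖(V w).1.2.1‖ ≤ L * r₂ ∧
      ‖(V w).1.2.2.1‖ ≤ L * r₃ ∧ ‖(V w).1.2.2.2‖ ≤ L * r₄ ∧ ‖(V w).2‖ ≤ L * r₅) :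
    ∃ γ, IsCurve V U γ z ∧ ∀ t ∈ Icc (0 : ℝ) 1, γ t ∈ polydisc z r₁ r₂ r₃ r₄ r₅ := by
  have hpoly : ∀ w : ExtPhase n, ‖w‖ ≤ 1 →
      z + scaleMap n r₁ r₂ r₃ r₄ r₅ w ∈ polydisc z r₁ r₂ r₃ r₄ r₅ := by
    intro w hw
    rw [extPhase_norm_le_iff] at hw
    obtain ⟨a1, a2, a3, a4, a5⟩ := hw
    simp only [polydisc, scaleMap_apply, mem_ofPred_eq, Prod.fst_add, Prod.snd_add,
      add_sub_cancel_left]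
    exact ⟨norm_ofReal_smul_le h₁.le a1, norm_ofReal_smul_le h₂.le a2,
      norm_ofReal_smul_le h₃.le a3, norm_ofReal_smul_le h₄.le a4, norm_ofReal_smul_le h₅.le a5⟩
  obtain ⟨β, hβ0, hβ⟩ := exists_solution_affine hU hV (continuous_const (y := z))
    (scaleMap n r₁ r₂ r₃ r₄ r₅) (scaleMap n r₁⁻¹ r₂⁻¹ r₃⁻¹ r₄⁻¹ r₅⁻¹)
    (fun t _ w hw => hmem (hpoly w (by simpa using hw))) hL
    (fun t _ w hw => by
      obtain ⟨b1, b2, b3, b4, b5⟩ := hb _ (hpoly w (by simpa using hw))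
      rw [extPhase_norm_le_iff, scaleMap_apply]
      exact ⟨norm_inv_smul_le h₁ b1, norm_inv_smul_le h₂ b2, norm_inv_smul_le h₃ b3,
        norm_inv_smul_le h₄ b4, norm_inv_smul_le h₅ b5⟩)
  have hinv : ∀ w : ExtPhase n, scaleMap n r₁ r₂ r₃ r₄ r₅
      (scaleMap n r₁⁻¹ r₂⁻¹ r₃⁻¹ r₄⁻¹ r₅⁻¹ w) = w := by
    intro w
    have e : ∀ {r : ℝ}, 0 < r → (r : ℂ) ≠ 0 := fun h => by exact_mod_cast h.ne'
    simp only [scaleMap_apply, smul_smul, Complex.ofReal_inv, ← mul_assoc,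
      mul_inv_cancel₀ (e h₁), mul_inv_cancel₀ (e h₂), mul_inv_cancel₀ (e h₃),
      mul_inv_cancel₀ (e h₄), mul_inv_cancel₀ (e h₅), one_smul, one_mul]
  refine ⟨fun t => z + scaleMap n r₁ r₂ r₃ r₄ r₅ (β t), ⟨by simp [hβ0],
    fun t ht => hmem (hpoly _ (hβ t ht).1), fun t ht => ?_⟩, fun t ht => hpoly _ (hβ t ht).1⟩
  have h := ((scaleMap n r₁ r₂ r₃ r₄ r₅).restrictScalars ℝ).hasFDerivAt.comp_hasDerivWithinAt t
    (hβ t ht).2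
  have h' := h.const_add z
  refine h'.congr_deriv ?_
  rw [ContinuousLinearMap.coe_restrictScalars', hinv]

/-- The set swept by characteristics: `x` runs along a segment while the parameter is fixed. -/
def charBox (z : ExtPhase n) (x : ℂ) (r₁ r₂ r₃ : ℝ) : Set (ExtPhase n) :=
  {w | ‖w.1.1 - z.1.1‖ ≤ r₁ ∧ ‖w.1.2.1 - z.1.2.1‖ ≤ r₂ ∧ ‖w.1.2.2.1 - z.1.2.2.1‖ ≤ r₃ ∧
    (∃ t ∈ Icc (0 : ℝ) 1, w.1.2.2.2 = z.1.2.2.2 - t * x) ∧ w.2 = z.2}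

/-- Existence of characteristics of a field whose `x`-component is `1`. -/
theorem exists_isCurve_charBox {Y : ExtPhase n → ExtPhase n} {U : Set (ExtPhase n)}
    (hU : IsOpen U) (hY : DifferentiableOn ℂ Y U) (hYx : ∀ w ∈ U, (Y w).1.2.2.2 = 1)
    (hYτ : ∀ w ∈ U, (Y w).2 = 0) {z : ExtPhase n} {x : ℂ} {r₁ r₂ r₃ L : ℝ}
    (h₁ : 0 < r₁) (h₂ : 0 < r₂) (h₃ : 0 < r₃) (hL0 : 0 ≤ L) (hL : L < 1)
    (hmem : charBox z x r₁ r₂ r₃ ⊆ U)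
    (hb : ∀ w ∈ charBox z x r₁ r₂ r₃, ‖x‖ * ‖(Y w).1.1‖ ≤ L * r₁ ∧
      ‖x‖ * ‖(Y w).1.2.1‖ ≤ L * r₂ ∧ ‖x‖ * ‖(Y w).1.2.2.1‖ ≤ L * r₃) :
    ∃ γ, IsCurve (fun w => -(x • Y w)) U γ z ∧ ∀ t ∈ Icc (0 : ℝ) 1, γ t ∈ charBox z x r₁ r₂ r₃ := by
  -- The `x`-component of the solution is known in advance, namely the segment traced by `b`. The
  -- zero scalings in `x` and in the parameter leave only the other components to be solved for.
  let b : ℝ → ExtPhase n := fun t => z - ((t : ℂ) * x) • vecX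
  have hbox : ∀ t ∈ Icc (0 : ℝ) 1, ∀ w : ExtPhase n, ‖w‖ ≤ 1 →
      b t + scaleMap n r₁ r₂ r₃ 0 0 w ∈ charBox z x r₁ r₂ r₃ := by
    intro t ht w hw
    rw [extPhase_norm_le_iff] at hw
    obtain ⟨a1, a2, a3, a4, a5⟩ := hw
    simp only [charBox, scaleMap_apply, mem_ofPred_eq, Prod.fst_add, Prod.snd_add, b, vecX,
      Prod.fst_sub, Prod.snd_sub, Prod.smul_mk, smul_zero, mul_zero, sub_zero,
      add_sub_cancel_left, Complex.ofReal_zero, zero_mul, add_zero, smul_eq_mul, mul_one, and_true]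
    exact ⟨norm_ofReal_smul_le h₁.le a1, norm_ofReal_smul_le h₂.le a2,
      norm_ofReal_smul_le h₃.le a3, ⟨t, ht, rfl⟩⟩
  have hneg : ∀ {F : Type} [NormedAddCommGroup F] [NormedSpace ℂ F] {r : ℝ} (v : F), 0 < r →
      ‖x‖ * ‖v‖ ≤ L * r → ‖-(x • ((r⁻¹ : ℝ) : ℂ) • v)‖ ≤ L := by
    intro F _ _ r v hr hv
    rw [norm_neg, smul_comm]
    exact norm_inv_smul_le hr (by rwa [norm_smul])
  obtain ⟨β, hβ0, hβ⟩ := exists_solution_affine hU hY (b := b) (by fun_prop)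
    (scaleMap n r₁ r₂ r₃ 0 0) (-(x • scaleMap n r₁⁻¹ r₂⁻¹ r₃⁻¹ 0 0))
    (fun t ht w hw => hmem (hbox t ht w (by simpa using hw))) hL
    (fun t ht w hw => by
      obtain ⟨b1, b2, b3⟩ := hb _ (hbox t ht w (by simpa using hw))
      rw [extPhase_norm_le_iff, neg_apply, smul_apply,
        scaleMap_apply]
      refine ⟨hneg _ h₁ b1, hneg _ h₂ b2, hneg _ h₃ b3, ?_, ?_⟩ <;> simpa using hL0)
  refine ⟨fun t => b t + scaleMap n r₁ r₂ r₃ 0 0 (β t), ⟨by simp [hβ0, b],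
    fun t ht => hmem (hbox t ht _ (hβ t ht).1), fun t ht => ?_⟩,
    fun t ht => hbox t ht _ (hβ t ht).1⟩
  have h := ((scaleMap n r₁ r₂ r₃ 0 0).restrictScalars ℝ).hasFDerivAt.comp_hasDerivWithinAt t
    (hβ t ht).2
  have hbd : HasDerivWithinAt b (-(x • vecX)) (Icc 0 1) t := by
    have := ((Complex.ofRealCLM.hasDerivAt (x := t)).mul_const x).smul_const (vecX : ExtPhase n)
    simpa [b] using (this.const_sub z).hasDerivWithinAt
  refine (hbd.add h).congr_deriv ?_
  have hU' := hmem (hbox t ht _ (hβ t ht).1)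
  have e : ∀ {r : ℝ}, 0 < r → (r : ℂ) ≠ 0 := fun h => by exact_mod_cast h.ne'
  have hYw := hYx _ hU'
  have hYw' := hYτ _ hU'
  generalize Y (b t + scaleMap n r₁ r₂ r₃ 0 0 (β t)) = Yw at hYw hYw'
  rw [ContinuousLinearMap.coe_restrictScalars', neg_apply,
    smul_apply, map_neg, map_smul, ← neg_add, ← smul_add]
  congr 2
  obtain ⟨⟨Y1, Y2, Y3, Y4⟩, Y5⟩ := Yw
  simp only at hYw hYw'
  subst hYw hYw'
  simp [scaleMap_apply, smul_smul, ← mul_assoc, mul_inv_cancel₀ (e h₁), mul_inv_cancel₀ (e h₂),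
    mul_inv_cancel₀ (e h₃), vecX]

end Boxes

/-! ### Complex neighbourhoods and their nesting. -/

section Domains

variable {n : ℕ}

/-- The part of `hamDomain` over the open strip. -/
def phaseDomain (S : Set (EuclideanSpace ℝ (Fin n))) (r s R : ℝ) : Set (Phase n) :=
  {z | z.1 ∈ actionNhd S r ∧ (∀ i, |(z.2.1 i).im| < s) ∧ z.2.2 ∈ ballTwo R}

/-- The standard open sets of the extended phase space. -/
def extDomain (S : Set (EuclideanSpace ℝ (Fin n))) (δ Δ r σ d e T : ℝ) : Set (ExtPhase n) :=
  {w | w.1.1 ∈ actionNhd S r ∧ (∀ i, |(w.1.2.1 i).im| < σ) ∧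
    w.1.2.2.1 ∈ lineNhd (longSide δ Δ) d ∧ ‖w.1.2.2.2‖ < e ∧ ‖w.2‖ < T}

theorem isOpen_im_lt (σ : ℝ) : IsOpen {v : CVec n | ∀ i, |(v i).im| < σ} := by
  simp only [ofPred_forall]
  exact isOpen_iInter_of_finite fun i => isOpen_lt (by fun_prop) continuous_const

theorem isOpen_phaseDomain (S : Set (EuclideanSpace ℝ (Fin n))) (r s R : ℝ) :
    IsOpen (phaseDomain S r s R) := by
  refine (isOpen_thickening.preimage continuous_fst).inter
    (((isOpen_im_lt s).preimage (by fun_prop : Continuous fun z : Phase n => z.2.1)).inter ?_)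
  exact isOpen_lt (f := fun z : Phase n => ‖z.2.2.1‖ ^ 2 + ‖z.2.2.2‖ ^ 2) (by fun_prop)
    continuous_const

theorem isOpen_extDomain (S : Set (EuclideanSpace ℝ (Fin n))) (δ Δ r σ d e T : ℝ) :
    IsOpen (extDomain S δ Δ r σ d e T) := by
  refine (isOpen_thickening.preimage (by fun_prop : Continuous fun w : ExtPhase n => w.1.1)).inter
    (((isOpen_im_lt σ).preimage (by fun_prop : Continuous fun w : ExtPhase n => w.1.2.1)).inter
    ((isOpen_thickening.preimage
      (by fun_prop : Continuous fun w : ExtPhase n => w.1.2.2.1)).inter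
    ((isOpen_lt (f := fun w : ExtPhase n => ‖w.1.2.2.2‖) (by fun_prop) continuous_const).inter
    (isOpen_lt (f := fun w : ExtPhase n => ‖w.2‖) (by fun_prop) continuous_const))))

theorem mem_thickening_of_norm_sub_le {X : Type*} [SeminormedAddCommGroup X] {A : Set X}
    {x y : X} {r r' R : ℝ} (hx : x ∈ thickening r A) (hxy : ‖y - x‖ ≤ r') (hR : r + r' ≤ R) :
    y ∈ thickening R A := by
  rw [mem_thickening_iff] at *
  obtain ⟨z, hz, hxz⟩ := hx
  refine ⟨z, hz, ?_⟩
  have := dist_triangle y x z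
  rw [dist_eq_norm y x] at this
  linarith

theorem abs_im_apply_sub_le (v v' : CVec n) (i : Fin n) :
    |(v' i).im| ≤ |(v i).im| + ‖v' - v‖ := by
  have h1 : |((v' - v) i).im| ≤ ‖v' - v‖ :=
    (Complex.abs_im_le_norm _).trans (PiLp.norm_apply_le (v' - v) i)
  have h2 : (v' i).im = (v i).im + ((v' - v) i).im := by simp
  rw [h2]
  exact (abs_add_le _ _).trans (by linarith)

theorem mem_extDomain_of_sub_le {S : Set (EuclideanSpace ℝ (Fin n))}
    {δ Δ r σ d e T r' σ' d' e' T' r₁ r₂ r₃ r₄ r₅ : ℝ} {w w' : ExtPhase n}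
    (hw : w ∈ extDomain S δ Δ r σ d e T)
    (h1 : ‖w'.1.1 - w.1.1‖ ≤ r₁) (h2 : ‖w'.1.2.1 - w.1.2.1‖ ≤ r₂)
    (h3 : ‖w'.1.2.2.1 - w.1.2.2.1‖ ≤ r₃) (h4 : ‖w'.1.2.2.2 - w.1.2.2.2‖ ≤ r₄)
    (h5 : ‖w'.2 - w.2‖ ≤ r₅)
    (k1 : r + r₁ ≤ r') (k2 : σ + r₂ ≤ σ') (k3 : d + r₃ ≤ d') (k4 : e + r₄ ≤ e')
    (k5 : T + r₅ ≤ T') : w' ∈ extDomain S δ Δ r' σ' d' e' T' := by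
  obtain ⟨a1, a2, a3, a4, a5⟩ := hw
  refine ⟨mem_thickening_of_norm_sub_le a1 h1 k1, fun i => ?_,
    mem_thickening_of_norm_sub_le a3 h3 k3, ?_, ?_⟩
  · have := abs_im_apply_sub_le w.1.2.1 w'.1.2.1 i
    linarith [a2 i]
  · have := norm_le_norm_add_norm_sub w.1.2.2.2 w'.1.2.2.2
    rw [norm_sub_rev] at h4
    linarith [norm_sub_norm_le w'.1.2.2.2 w.1.2.2.2, norm_sub_rev w'.1.2.2.2 w.1.2.2.2]
  · linarith [norm_sub_norm_le w'.2 w.2]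

theorem norm_bounds_of_mem_lineNhd {δ Δ d : ℝ} {y : ℂ} (hy : y ∈ lineNhd (longSide δ Δ) d) :
    δ / 2 - d < ‖y‖ ∧ ‖y‖ < Δ + δ / 2 + d := by
  rw [lineNhd, mem_thickening_iff] at hy
  obtain ⟨_, ⟨t, ⟨ht1, ht2⟩, rfl⟩, hyt⟩ := hy
  rw [dist_eq_norm] at hyt
  have h1 := norm_sub_norm_le y (t : ℂ)
  have h2 := norm_sub_norm_le (t : ℂ) y
  rw [norm_sub_rev] at h2
  have h3 : ‖(t : ℂ)‖ = |t| := by simp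
  constructor <;> linarith

end Domains

/-! ### The deformation family, its derivatives, and the lower bound on `∂_y`. -/

section Core

variable {n : ℕ}

/-- The data of the deformation `h + ω₀ (x² + y²) / 2 + f₀ + τ f₁`, with the smallness conditions.
-/
structure DeformationData (S : Set (EuclideanSpace ℝ (Fin n)))
    (ρ s δ Δ c a M₀ M₁ E ν : ℝ) (h ω₀ : CVec n → ℂ) (f₀ f₁ : Phase n → ℂ) : Prop where
  ρ_pos : 0 < ρ
  s_pos : 0 < s
  δ_pos : 0 < δ
  δ_lt : δ < Δ
  c_pos : 0 < c
  a_pos : 0 < a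
  a_le : a ≤ M₀
  M₁_nonneg : 0 ≤ M₁
  E_nonneg : 0 ≤ E
  ν_pos : 0 < ν
  ν_le : ν ≤ 1 / 10 ^ 10
  diff_h : DifferentiableOn ℂ h (actionNhd S ρ)
  diff_ω : DifferentiableOn ℂ ω₀ (actionNhd S ρ)
  diff_f₀ : DifferentiableOn ℂ f₀ (phaseDomain S ρ s (Δ + δ))
  diff_f₁ : DifferentiableOn ℂ f₁ (phaseDomain S ρ s (Δ + δ))
  le_ω : ∀ I ∈ actionNhd S ρ, a ≤ ‖ω₀ I‖
  ω_le : ∀ I ∈ actionNhd S ρ, ‖ω₀ I‖ ≤ M₀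
  ω₁_le : ∀ I ∈ actionNhd S ρ, ∀ y : ℂ, ‖y‖ < Δ + δ → omegaOneNorm h ω₀ I y ≤ M₁
  f₀_le : ∀ z ∈ phaseDomain S ρ s (Δ + δ), ‖f₀ z‖ ≤ E
  f₁_le : ∀ z ∈ phaseDomain S ρ s (Δ + δ), ‖f₁ z‖ ≤ E
  real_h : ∀ I ∈ actionNhd S ρ, (∀ i, (I i).im = 0) → (h I).im = 0
  real_ω : ∀ I ∈ actionNhd S ρ, (∀ i, (I i).im = 0) → (ω₀ I).im = 0
  real_f₀ : ∀ z ∈ phaseDomain S ρ s (Δ + δ) ∩ realPoints n, (f₀ z).im = 0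
  real_f₁ : ∀ z ∈ phaseDomain S ρ s (Δ + δ) ∩ realPoints n, (f₁ z).im = 0
  periodic_f₀ : PeriodicOn f₀ (phaseDomain S ρ s (Δ + δ))
  periodic_f₁ : PeriodicOn f₁ (phaseDomain S ρ s (Δ + δ))
  small₁ : c ^ 3 * M₀ ≤ ν * (a * δ * ρ * s)
  small₂ : 2 * c * E ≤ ν * (a * δ * ρ * s)
  small₃ : 4 * c ^ 2 * M₀ ≤ ν * (a * δ ^ 2)
  small₄ : 8 * E ≤ ν * (a * δ ^ 2)
  small₅ : 8 * c * M₁ ≤ s * (a * δ)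

/-- The deformation part `f₀ + τ f₁` of the family. -/
def deformation (f₀ f₁ : Phase n → ℂ) (w : ExtPhase n) : ℂ := f₀ w.1 + w.2 * f₁ w.1

/-- The family of Hamiltonians `h + ω₀ (x² + y²) / 2 + f₀ + τ f₁`. -/
def hamFamily (h ω₀ : CVec n → ℂ) (f₀ f₁ : Phase n → ℂ) (w : ExtPhase n) : ℂ :=
  h w.1.1 + ω₀ w.1.1 / 2 * (w.1.2.2.2 ^ 2 + w.1.2.2.1 ^ 2) + deformation f₀ f₁ w

/-- The field whose integral curves are the characteristics: the Hamiltonian field of the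
family, normalized to have `x`-component `1`. -/
def charField (G : ExtPhase n → ℂ) (w : ExtPhase n) : ExtPhase n :=
  ((fderiv ℂ G w vecY)⁻¹ • hamVec n (fderiv ℂ G w), 0)

namespace DeformationData

variable {S : Set (EuclideanSpace ℝ (Fin n))} {ρ s δ Δ c a M₀ M₁ E ν : ℝ}
  {h ω₀ : CVec n → ℂ} {f₀ f₁ : Phase n → ℂ}

/-- Since `a ≤ M₀`, the condition on `c² M₀ / (a δ²)` forces the rectangle to be thin compared with
`δ`. -/
theorem c_sq_le (H : DeformationData S ρ s δ Δ c a M₀ M₁ E ν h ω₀ f₀ f₁) :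
    c ^ 2 ≤ 1 / (4 * 10 ^ 10) * δ ^ 2 := by
  have h1 : 4 * c ^ 2 * a ≤ 1 / 10 ^ 10 * (a * δ ^ 2) :=
    calc 4 * c ^ 2 * a ≤ 4 * c ^ 2 * M₀ := by gcongr; exact H.a_le
      _ ≤ ν * (a * δ ^ 2) := H.small₃
      _ ≤ 1 / 10 ^ 10 * (a * δ ^ 2) := by
          have := H.a_pos; gcongr; exact H.ν_le
  have h2 : a * (4 * c ^ 2) ≤ a * (1 / 10 ^ 10 * δ ^ 2) := by linarith
  have := le_of_mul_le_mul_left h2 H.a_pos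
  linarith

theorem c_le (H : DeformationData S ρ s δ Δ c a M₀ M₁ E ν h ω₀ f₀ f₁) :
    c ≤ 1 / 10 ^ 5 * δ := by
  have h1 := H.c_sq_le
  have := H.δ_pos
  refine le_of_sq_le_sq ?_ (by positivity)
  nlinarith [sq_nonneg δ]

theorem E_le (H : DeformationData S ρ s δ Δ c a M₀ M₁ E ν h ω₀ f₀ f₁) :
    E ≤ 1 / (8 * 10 ^ 10) * (a * δ ^ 2) := by
  have h1 : ν * (a * δ ^ 2) ≤ 1 / 10 ^ 10 * (a * δ ^ 2) := by
    have := H.a_pos; gcongr; exact H.ν_le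
  linarith [H.small₄]

theorem cE_le (H : DeformationData S ρ s δ Δ c a M₀ M₁ E ν h ω₀ f₀ f₁) :
    2 * c * E ≤ 1 / 10 ^ 10 * (a * δ * ρ * s) ∧ c ^ 3 * M₀ ≤ 1 / 10 ^ 10 * (a * δ * ρ * s) := by
  have := H.a_pos; have := H.δ_pos; have := H.ρ_pos; have := H.s_pos
  have h1 : ν * (a * δ * ρ * s) ≤ 1 / 10 ^ 10 * (a * δ * ρ * s) := by
    gcongr; exact H.ν_le
  exact ⟨H.small₂.trans h1, H.small₁.trans h1⟩

theorem mem_phaseDomain (H : DeformationData S ρ s δ Δ c a M₀ M₁ E ν h ω₀ f₀ f₁)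
    {w : ExtPhase n} {T : ℝ} (hw : w ∈ extDomain S δ Δ ρ s (2 / 5 * δ) (1 / 10 * δ) T) :
    w.1 ∈ phaseDomain S ρ s (Δ + δ) := by
  obtain ⟨a1, a2, a3, a4, -⟩ := hw
  refine ⟨a1, a2, ?_⟩
  have h1 := (norm_bounds_of_mem_lineNhd a3).2
  have := H.δ_pos; have := H.δ_lt
  change ‖w.1.2.2.1‖ ^ 2 + ‖w.1.2.2.2‖ ^ 2 < (Δ + δ) ^ 2
  have h2 : ‖w.1.2.2.1‖ ^ 2 ≤ (Δ + 9 / 10 * δ) ^ 2 := by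
    gcongr; linarith
  have h3 : ‖w.1.2.2.2‖ ^ 2 ≤ (1 / 10 * δ) ^ 2 := by gcongr
  nlinarith

theorem differentiableOn_deformation (H : DeformationData S ρ s δ Δ c a M₀ M₁ E ν h ω₀ f₀ f₁) :
    DifferentiableOn ℂ (deformation f₀ f₁) (Prod.fst ⁻¹' phaseDomain S ρ s (Δ + δ)) := by
  have h1 : DifferentiableOn ℂ (fun w : ExtPhase n => f₀ w.1)
      (Prod.fst ⁻¹' phaseDomain S ρ s (Δ + δ)) := H.diff_f₀.comp differentiableOn_fst fun _ h => h
  have h2 : DifferentiableOn ℂ (fun w : ExtPhase n => f₁ w.1)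
      (Prod.fst ⁻¹' phaseDomain S ρ s (Δ + δ)) := H.diff_f₁.comp differentiableOn_fst fun _ h => h
  exact h1.add (differentiableOn_snd.mul h2)

theorem isOpen_preimage_phaseDomain (S : Set (EuclideanSpace ℝ (Fin n))) (r s R : ℝ) :
    IsOpen (Prod.fst ⁻¹' phaseDomain S r s R : Set (ExtPhase n)) :=
  (isOpen_phaseDomain S r s R).preimage continuous_fst

theorem norm_deformation_le (H : DeformationData S ρ s δ Δ c a M₀ M₁ E ν h ω₀ f₀ f₁)
    {w : ExtPhase n} (hw : w.1 ∈ phaseDomain S ρ s (Δ + δ)) (hT : ‖w.2‖ ≤ 3) :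
    ‖deformation f₀ f₁ w‖ ≤ 4 * E := by
  refine (norm_add_le _ _).trans ?_
  rw [norm_mul]
  have h1 := H.f₀_le _ hw
  have h2 := H.f₁_le _ hw
  nlinarith [norm_nonneg (f₁ w.1), norm_nonneg w.2, H.E_nonneg]

theorem differentiableOn_hamFamily (H : DeformationData S ρ s δ Δ c a M₀ M₁ E ν h ω₀ f₀ f₁) :
    DifferentiableOn ℂ (hamFamily h ω₀ f₀ f₁) (Prod.fst ⁻¹' phaseDomain S ρ s (Δ + δ)) := by
  have hm : MapsTo (fun w : ExtPhase n => w.1.1) (Prod.fst ⁻¹' phaseDomain S ρ s (Δ + δ))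
      (actionNhd S ρ) := fun w hw => hw.1
  have h1 : DifferentiableOn ℂ (fun w : ExtPhase n => h w.1.1)
      (Prod.fst ⁻¹' phaseDomain S ρ s (Δ + δ)) := H.diff_h.comp (by fun_prop) hm
  have h2 : DifferentiableOn ℂ (fun w : ExtPhase n => ω₀ w.1.1)
      (Prod.fst ⁻¹' phaseDomain S ρ s (Δ + δ)) := H.diff_ω.comp (by fun_prop) hm
  have h3 : DifferentiableOn ℂ (fun w : ExtPhase n => w.1.2.2.2 ^ 2 + w.1.2.2.1 ^ 2)
      (Prod.fst ⁻¹' phaseDomain S ρ s (Δ + δ)) := by fun_prop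
  have h4 : DifferentiableOn ℂ (fun w : ExtPhase n => ω₀ w.1.1 / 2)
      (Prod.fst ⁻¹' phaseDomain S ρ s (Δ + δ)) := by
    simpa only [div_eq_mul_inv] using h2.mul_const (2 : ℂ)⁻¹
  exact (h1.add (h4.mul h3)).add H.differentiableOn_deformation

theorem fderiv_hamFamily_apply (H : DeformationData S ρ s δ Δ c a M₀ M₁ E ν h ω₀ f₀ f₁)
    {w : ExtPhase n} (hw : w.1 ∈ phaseDomain S ρ s (Δ + δ)) (v : ExtPhase n) :
    fderiv ℂ (hamFamily h ω₀ f₀ f₁) w v =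
      fderiv ℂ h w.1.1 v.1.1 + (w.1.2.2.2 ^ 2 + w.1.2.2.1 ^ 2) / 2 * fderiv ℂ ω₀ w.1.1 v.1.1 +
      ω₀ w.1.1 * (w.1.2.2.2 * v.1.2.2.2 + w.1.2.2.1 * v.1.2.2.1) +
      fderiv ℂ (deformation f₀ f₁) w v := by
  have hI : actionNhd S ρ ∈ nhds w.1.1 := isOpen_thickening.mem_nhds hw.1
  have hfst : HasFDerivAt (fun w : ExtPhase n => w.1.1)
      (ContinuousLinearMap.fst ℂ (CVec n) _ ∘L ContinuousLinearMap.fst ℂ (Phase n) ℂ) w :=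
    (ContinuousLinearMap.fst ℂ (CVec n) (CVec n × ℂ × ℂ) ∘L
      ContinuousLinearMap.fst ℂ (Phase n) ℂ).hasFDerivAt
  have h1 := (H.diff_h.differentiableAt hI).hasFDerivAt.comp w hfst
  have h2 := (H.diff_ω.differentiableAt hI).hasFDerivAt.comp w hfst
  have hx : HasFDerivAt (fun w : ExtPhase n => w.1.2.2.2)
      (ContinuousLinearMap.snd ℂ ℂ ℂ ∘L ContinuousLinearMap.snd ℂ (CVec n) (ℂ × ℂ) ∘L
        ContinuousLinearMap.snd ℂ (CVec n) _ ∘L ContinuousLinearMap.fst ℂ (Phase n) ℂ) w :=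
    (ContinuousLinearMap.snd ℂ ℂ ℂ ∘L ContinuousLinearMap.snd ℂ (CVec n) (ℂ × ℂ) ∘L
        ContinuousLinearMap.snd ℂ (CVec n) (CVec n × ℂ × ℂ) ∘L
        ContinuousLinearMap.fst ℂ (Phase n) ℂ).hasFDerivAt
  have hy : HasFDerivAt (fun w : ExtPhase n => w.1.2.2.1)
      (ContinuousLinearMap.fst ℂ ℂ ℂ ∘L ContinuousLinearMap.snd ℂ (CVec n) (ℂ × ℂ) ∘L
        ContinuousLinearMap.snd ℂ (CVec n) _ ∘L ContinuousLinearMap.fst ℂ (Phase n) ℂ) w :=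
    (ContinuousLinearMap.fst ℂ ℂ ℂ ∘L ContinuousLinearMap.snd ℂ (CVec n) (ℂ × ℂ) ∘L
        ContinuousLinearMap.snd ℂ (CVec n) (CVec n × ℂ × ℂ) ∘L
        ContinuousLinearMap.fst ℂ (Phase n) ℂ).hasFDerivAt
  have h4 := (H.differentiableOn_deformation.differentiableAt
    ((isOpen_preimage_phaseDomain S ρ s (Δ + δ)).mem_nhds hw)).hasFDerivAt
  have h5 := (h1.add ((h2.mul_const (1 / 2 : ℂ)).mul ((hx.pow 2).add (hy.pow 2)))).add h4
  have h6 : HasFDerivAt (hamFamily h ω₀ f₀ f₁) _ w :=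
    h5.congr_of_eventuallyEq (.of_forall fun w => by
      simp only [hamFamily, Pi.add_apply, Pi.mul_apply, Function.comp_apply]; ring)
  rw [h6.fderiv]
  simp only [add_apply, smul_apply, ContinuousLinearMap.comp_apply,
    ContinuousLinearMap.coe_fst', ContinuousLinearMap.coe_snd', smul_eq_mul, Pi.add_apply,
    Function.comp_apply, nsmul_eq_mul]
  push_cast
  ring

theorem fderiv_hamFamily_param (H : DeformationData S ρ s δ Δ c a M₀ M₁ E ν h ω₀ f₀ f₁)
    {w : ExtPhase n} (hw : w.1 ∈ phaseDomain S ρ s (Δ + δ)) :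
    fderiv ℂ (hamFamily h ω₀ f₀ f₁) w (0, 1) = f₁ w.1 := by
  have hd := H.differentiableOn_hamFamily.differentiableAt
    ((isOpen_preimage_phaseDomain S ρ s (Δ + δ)).mem_nhds hw)
  have h1 : HasDerivAt (fun t : ℂ => w + t • ((0, 1) : ExtPhase n)) (0, 1) 0 := by
    simpa using ((hasDerivAt_id (0 : ℂ)).smul_const ((0, 1) : ExtPhase n)).const_add w
  have h2 := HasFDerivAt.comp_hasDerivAt (x := (0 : ℂ))
    (f := fun t : ℂ => w + t • ((0, 1) : ExtPhase n)) (by simpa using hd.hasFDerivAt) h1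
  have h3 : HasDerivAt (fun t : ℂ => hamFamily h ω₀ f₀ f₁ w + t * f₁ w.1) (f₁ w.1) 0 := by
    simpa using ((hasDerivAt_id (0 : ℂ)).mul_const (f₁ w.1)).const_add (hamFamily h ω₀ f₀ f₁ w)
  refine h2.unique (h3.congr_of_eventuallyEq (.of_forall fun t => ?_))
  simp [hamFamily, deformation]
  ring

/-- The domain on which the characteristic field is estimated. -/
abbrev fieldDomain (S : Set (EuclideanSpace ℝ (Fin n))) (ρ s δ Δ c : ℝ) : Set (ExtPhase n) :=
  extDomain S δ Δ (999 / 1000 * ρ) (999 / 1000 * s) (19 / 50 * δ) (19 / 20 * c) 3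

theorem fieldDomain_subset (H : DeformationData S ρ s δ Δ c a M₀ M₁ E ν h ω₀ f₀ f₁) :
    fieldDomain S ρ s δ Δ c ⊆ Prod.fst ⁻¹' phaseDomain S ρ s (Δ + δ) := fun w hw => by
  have := H.ρ_pos; have := H.s_pos; have := H.δ_pos; have := H.c_le; have := H.c_pos
  refine H.mem_phaseDomain (T := 3) (mem_extDomain_of_sub_le hw
    (w' := w) (r₁ := 0) (r₂ := 0) (r₃ := 0) (r₄ := 0) (r₅ := 0) ?_ ?_ ?_ ?_ ?_ ?_ ?_ ?_ ?_ ?_)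
  all_goals first | simp; done | linarith

/-- One Cauchy estimate for all directions: the margins `r₁, …, r₄` say how far the disc of radius
`R` in direction `v` may reach. On `‖τ‖ ≤ 3` the deformation is bounded by `4 E`. -/
theorem norm_fderiv_deformation_le (H : DeformationData S ρ s δ Δ c a M₀ M₁ E ν h ω₀ f₀ f₁)
    {w : ExtPhase n} (hw : w ∈ fieldDomain S ρ s δ Δ c) {R : ℝ} (hR : 0 < R) {v : ExtPhase n}
    {r₁ r₂ r₃ r₄ : ℝ}
    (h1 : R * ‖v.1.1‖ ≤ r₁) (h2 : R * ‖v.1.2.1‖ ≤ r₂) (h3 : R * ‖v.1.2.2.1‖ ≤ r₃)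
    (h4 : R * ‖v.1.2.2.2‖ ≤ r₄) (h5 : v.2 = 0)
    (k1 : 999 / 1000 * ρ + r₁ ≤ ρ) (k2 : 999 / 1000 * s + r₂ ≤ s)
    (k3 : 19 / 50 * δ + r₃ ≤ 2 / 5 * δ) (k4 : 19 / 20 * c + r₄ ≤ 1 / 10 * δ) :
    ‖fderiv ℂ (deformation f₀ f₁) w v‖ ≤ 4 * E / R := by
  have hmem : ∀ ζ : ℂ, ‖ζ‖ ≤ R →
      w + ζ • v ∈ extDomain S δ Δ ρ s (2 / 5 * δ) (1 / 10 * δ) 3 := by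
    intro ζ hζ
    have key : ∀ {F : Type} [NormedAddCommGroup F] [NormedSpace ℂ F] (x u : F) {r : ℝ},
        R * ‖u‖ ≤ r → ‖x + ζ • u - x‖ ≤ r := by
      intro F _ _ x u r hr
      rw [add_sub_cancel_left, norm_smul]
      exact (mul_le_mul_of_nonneg_right hζ (norm_nonneg _)).trans hr
    refine mem_extDomain_of_sub_le hw (key _ _ h1) (key _ _ h2) (key _ _ h3) (key _ _ h4)
      (r₅ := 0) ?_ k1 k2 k3 k4 (by norm_num)
    simp [h5]
  refine norm_fderiv_apply_le (isOpen_preimage_phaseDomain S ρ s (Δ + δ))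
    H.differentiableOn_deformation hR (fun ζ hζ => H.mem_phaseDomain (hmem ζ hζ)) fun ζ hζ =>
    H.norm_deformation_le (H.mem_phaseDomain (hmem ζ hζ)) (hmem ζ hζ).2.2.2.2.le

theorem norm_fderiv_deformation_vecY_le
    (H : DeformationData S ρ s δ Δ c a M₀ M₁ E ν h ω₀ f₀ f₁)
    {w : ExtPhase n} (hw : w ∈ fieldDomain S ρ s δ Δ c) :
    ‖fderiv ℂ (deformation f₀ f₁) w vecY‖ ≤ 4 * E / (δ / 100) ∧
    ‖fderiv ℂ (deformation f₀ f₁) w vecX‖ ≤ 4 * E / (δ / 100) := by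
  have := H.ρ_pos; have := H.s_pos; have := H.δ_pos; have := H.c_le; have := H.c_pos
  constructor
  · refine H.norm_fderiv_deformation_le hw (r₁ := 0) (r₂ := 0) (r₃ := δ / 100) (r₄ := 0)
      (by positivity) ?_ ?_ ?_ ?_ ?_ ?_ ?_ ?_ ?_
    all_goals first | simp [vecY]; done | linarith
  · refine H.norm_fderiv_deformation_le hw (r₁ := 0) (r₂ := 0) (r₃ := 0) (r₄ := δ / 100)
      (by positivity) ?_ ?_ ?_ ?_ ?_ ?_ ?_ ?_ ?_
    all_goals first | simp [vecX]; done | linarith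

theorem norm_fderiv_deformation_vecPhi_le
    (H : DeformationData S ρ s δ Δ c a M₀ M₁ E ν h ω₀ f₀ f₁)
    {w : ExtPhase n} (hw : w ∈ fieldDomain S ρ s δ Δ c) {v : CVec n} (hv : ‖v‖ = 1) :
    ‖fderiv ℂ (deformation f₀ f₁) w (vecPhi v)‖ ≤ 4 * E / (s / 1000) := by
  have := H.ρ_pos; have := H.s_pos; have := H.δ_pos; have := H.c_le; have := H.c_pos
  refine H.norm_fderiv_deformation_le hw (r₁ := 0) (r₂ := s / 1000) (r₃ := 0) (r₄ := 0)
    (by positivity) ?_ ?_ ?_ ?_ ?_ ?_ ?_ ?_ ?_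
  all_goals first | simp [vecPhi, hv]; done | linarith

theorem norm_fderiv_deformation_vecI_le
    (H : DeformationData S ρ s δ Δ c a M₀ M₁ E ν h ω₀ f₀ f₁)
    {w : ExtPhase n} (hw : w ∈ fieldDomain S ρ s δ Δ c) {v : CVec n} (hv : ‖v‖ = 1) :
    ‖fderiv ℂ (deformation f₀ f₁) w (vecI v)‖ ≤ 4 * E / (ρ / 1000) := by
  have := H.ρ_pos; have := H.s_pos; have := H.δ_pos; have := H.c_le; have := H.c_pos
  refine H.norm_fderiv_deformation_le hw (r₁ := ρ / 1000) (r₂ := 0) (r₃ := 0) (r₄ := 0)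
    (by positivity) ?_ ?_ ?_ ?_ ?_ ?_ ?_ ?_ ?_
  all_goals first | simp [vecI, hv]; done | linarith

theorem norm_fderiv_ω_le (H : DeformationData S ρ s δ Δ c a M₀ M₁ E ν h ω₀ f₀ f₁)
    {I : CVec n} (hI : I ∈ actionNhd S (999 / 1000 * ρ)) {v : CVec n} (hv : ‖v‖ = 1) :
    ‖fderiv ℂ ω₀ I v‖ ≤ M₀ / (ρ / 1000) := by
  have := H.ρ_pos
  have hmem : ∀ ζ : ℂ, ‖ζ‖ ≤ ρ / 1000 → I + ζ • v ∈ actionNhd S ρ := fun ζ hζ =>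
    mem_thickening_of_norm_sub_le hI (r' := ρ / 1000) (by simpa [norm_smul, hv] using hζ)
      (by linarith)
  exact norm_fderiv_apply_le isOpen_thickening H.diff_ω (by positivity) hmem
    fun ζ hζ => H.ω_le _ (hmem ζ hζ)

/-- The lower bound on `∂_y` of the family. -/
theorem le_norm_fderiv_vecY (H : DeformationData S ρ s δ Δ c a M₀ M₁ E ν h ω₀ f₀ f₁)
    {w : ExtPhase n} (hw : w ∈ fieldDomain S ρ s δ Δ c) :
    9999 / 10000 * (‖ω₀ w.1.1‖ * ‖w.1.2.2.1‖) ≤ ‖fderiv ℂ (hamFamily h ω₀ f₀ f₁) w vecY‖ := by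
  have hδ := H.δ_pos; have ha := H.a_pos
  have hw' := H.fieldDomain_subset hw
  have h1 := (H.norm_fderiv_deformation_vecY_le hw).1
  have h2 := H.fderiv_hamFamily_apply hw' vecY
  simp only [vecY, map_zero, mul_zero, mul_one, zero_add, add_zero] at h2
  rw [show (((0, 0, 1, 0), 0) : ExtPhase n) = vecY from rfl] at h2
  have h3 : ‖ω₀ w.1.1‖ * ‖w.1.2.2.1‖ ≤ ‖fderiv ℂ (hamFamily h ω₀ f₀ f₁) w vecY‖ +
      ‖fderiv ℂ (deformation f₀ f₁) w vecY‖ := by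
    rw [← norm_mul, h2]
    have := norm_sub_le (ω₀ w.1.1 * w.1.2.2.1 + fderiv ℂ (deformation f₀ f₁) w vecY)
      (fderiv ℂ (deformation f₀ f₁) w vecY)
    rwa [add_sub_cancel_right] at this
  have h4 : 4 * E / (δ / 100) ≤ 1 / 10 ^ 8 * (a * δ) := by
    rw [div_le_iff₀ (by positivity)]
    have := H.E_le
    nlinarith [mul_pos ha (pow_pos hδ 2)]
  -- In `fieldDomain` one has `‖y‖ > δ / 2 - 19 / 50 δ = 12 / 100 δ`, so the main term `ω₀ y`
  -- dominates `∂_y` of the deformation, which is at most `10⁻⁸ a δ`.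
  have h5 : a * (12 / 100 * δ) ≤ ‖ω₀ w.1.1‖ * ‖w.1.2.2.1‖ := by
    have h6 := (norm_bounds_of_mem_lineNhd hw.2.2.1).1
    have h7 := H.le_ω _ hw'.1
    gcongr
    linarith
  have h6 := mul_pos ha hδ
  linarith

end DeformationData
end Core

/-! ### Bounds on the drift of the characteristics. -/

section CharacteristicBounds

variable {n : ℕ} {S : Set (EuclideanSpace ℝ (Fin n))} {ρ s δ Δ c a M₀ M₁ E ν : ℝ}
  {h ω₀ : CVec n → ℂ} {f₀ f₁ : Phase n → ℂ}

namespace DeformationData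

theorem norm_fderiv_vecY_pos (H : DeformationData S ρ s δ Δ c a M₀ M₁ E ν h ω₀ f₀ f₁)
    {w : ExtPhase n} (hw : w ∈ fieldDomain S ρ s δ Δ c) :
    9999 / 10000 * (a * ‖w.1.2.2.1‖) ≤ ‖fderiv ℂ (hamFamily h ω₀ f₀ f₁) w vecY‖ ∧
    119 / 1000 * (a * δ) ≤ ‖fderiv ℂ (hamFamily h ω₀ f₀ f₁) w vecY‖ := by
  have h1 := H.le_norm_fderiv_vecY hw
  have h2 := H.le_ω _ (H.fieldDomain_subset hw).1
  have h3 := (norm_bounds_of_mem_lineNhd hw.2.2.1).1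
  have hδ := H.δ_pos; have ha := H.a_pos
  have h4 : a * ‖w.1.2.2.1‖ ≤ ‖ω₀ w.1.1‖ * ‖w.1.2.2.1‖ := by gcongr
  have h5 : a * (12 / 100 * δ) ≤ a * ‖w.1.2.2.1‖ := by gcongr; linarith
  have := mul_pos ha hδ
  constructor <;> linarith

theorem fderiv_vecY_ne_zero (H : DeformationData S ρ s δ Δ c a M₀ M₁ E ν h ω₀ f₀ f₁)
    {w : ExtPhase n} (hw : w ∈ fieldDomain S ρ s δ Δ c) :
    fderiv ℂ (hamFamily h ω₀ f₀ f₁) w vecY ≠ 0 := by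
  have h1 := (H.norm_fderiv_vecY_pos hw).2
  have := mul_pos H.a_pos H.δ_pos
  rw [← norm_pos_iff]
  linarith

/-- Displacement over a length `X` in `x` is `X` times a component of the Hamiltonian field divided
by `∂_y G`; this clears the denominator. -/
theorem norm_inv_smul_le_of_le (H : DeformationData S ρ s δ Δ c a M₀ M₁ E ν h ω₀ f₀ f₁)
    {w : ExtPhase n} (hw : w ∈ fieldDomain S ρ s δ Δ c) {F : Type*} [NormedAddCommGroup F]
    [NormedSpace ℂ F] {v : F} {X B C : ℝ} (hX : 0 ≤ X) (hv : ‖v‖ ≤ B)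
    (hB : X * B ≤ C * ‖fderiv ℂ (hamFamily h ω₀ f₀ f₁) w vecY‖) :
    X * ‖(fderiv ℂ (hamFamily h ω₀ f₀ f₁) w vecY)⁻¹ • v‖ ≤ C := by
  have h0 := norm_pos_iff.mpr (H.fderiv_vecY_ne_zero hw)
  rw [norm_smul, norm_inv, inv_mul_eq_div, mul_div_assoc', div_le_iff₀ h0]
  exact (mul_le_mul_of_nonneg_left hv hX).trans hB

/-- The actions move only through `∂_φ` of the deformation, of order `E / s`; the smallness of `2 c
E / (a δ ρ s)` makes the drift a small part of `ρ`. -/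
theorem charField_fst_le (H : DeformationData S ρ s δ Δ c a M₀ M₁ E ν h ω₀ f₀ f₁)
    {w : ExtPhase n} (hw : w ∈ fieldDomain S ρ s δ Δ c) {X : ℝ} (hX0 : 0 ≤ X) (hX : X ≤ c) :
    X * ‖(charField (hamFamily h ω₀ f₀ f₁) w).1.1‖ ≤ 1 / 2 * (1 / 1000 * ρ) := by
  have := H.ρ_pos; have := H.s_pos; have := H.δ_pos; have := H.a_pos; have := H.c_pos
  have hE := H.E_nonneg
  have hb : ‖(hamVec n (fderiv ℂ (hamFamily h ω₀ f₀ f₁) w)).1‖ ≤ 4 * E / (s / 1000) := by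
    refine norm_hamVec_fst_le (by positivity) fun v hv => ?_
    rw [H.fderiv_hamFamily_apply (H.fieldDomain_subset hw)]
    simpa [vecPhi] using H.norm_fderiv_deformation_vecPhi_le hw hv
  refine H.norm_inv_smul_le_of_le hw hX0 hb ?_
  have h1 := (H.norm_fderiv_vecY_pos hw).2
  have h2 : X * (4 * E / (s / 1000)) ≤ 1 / 10 ^ 6 * (a * δ * ρ) :=
    calc X * (4 * E / (s / 1000)) ≤ c * (4 * E / (s / 1000)) := by gcongr
      _ = 2000 * (2 * c * E) / s := by field_simp; ring
      _ ≤ 2000 * (1 / 10 ^ 10 * (a * δ * ρ * s)) / s := by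
          gcongr 2000 * ?_ / s; exact H.cE_le.1
      _ = 2 / 10 ^ 7 * (a * δ * ρ) := by field_simp; ring
      _ ≤ _ := by have : 0 < a * δ * ρ := by positivity
                  linarith
  have h3 : ρ * (119 / 1000 * (a * δ)) ≤
    ρ * ‖fderiv ℂ (hamFamily h ω₀ f₀ f₁) w vecY‖ := by gcongr
  have : 0 < a * δ * ρ := by positivity
  linarith

/-- Here `ẏ = -∂_x G` consists of `ω₀ x`, of size `‖ω₀‖ c`, and a term of order `E / δ`. The first
is compared with `ω₀ y` in the denominator, so the ratio `M₀ / a` does not enter. -/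
theorem charField_y_le (H : DeformationData S ρ s δ Δ c a M₀ M₁ E ν h ω₀ f₀ f₁)
    {w : ExtPhase n} (hw : w ∈ fieldDomain S ρ s δ Δ c) {X : ℝ} (hX0 : 0 ≤ X) (hX : X ≤ c) :
    X * ‖(charField (hamFamily h ω₀ f₀ f₁) w).1.2.2.1‖ ≤ 1 / 2 * (1 / 10 ^ 4 * δ) := by
  have hδ := H.δ_pos; have ha := H.a_pos; have hc := H.c_pos
  have hE := H.E_nonneg
  have hw' := H.fieldDomain_subset hw
  have hb : ‖(hamVec n (fderiv ℂ (hamFamily h ω₀ f₀ f₁) w)).2.2.1‖ ≤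
      ‖ω₀ w.1.1‖ * c + 4 * E / (δ / 100) := by
    rw [hamVec_apply, norm_neg, H.fderiv_hamFamily_apply hw']
    refine (norm_add_le _ _).trans (add_le_add ?_ (H.norm_fderiv_deformation_vecY_le hw).2)
    have : ‖w.1.2.2.2‖ ≤ c := by have := hw.2.2.2.1; linarith
    simp only [vecX, map_zero, mul_zero, add_zero, zero_add, mul_one, norm_mul]
    gcongr
  refine H.norm_inv_smul_le_of_le hw hX0 hb ?_
  have h1 := (H.norm_fderiv_vecY_pos hw).2
  have h1' := H.le_norm_fderiv_vecY hw
  have h3 := (norm_bounds_of_mem_lineNhd hw.2.2.1).1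
  have h4 : ‖ω₀ w.1.1‖ * (12 / 100 * δ) ≤ ‖ω₀ w.1.1‖ * ‖w.1.2.2.1‖ := by gcongr; linarith
  have h5 : X * (‖ω₀ w.1.1‖ * c + 4 * E / (δ / 100)) ≤
      ‖ω₀ w.1.1‖ * c ^ 2 + 400 * (E / δ * c) :=
    calc X * (‖ω₀ w.1.1‖ * c + 4 * E / (δ / 100)) ≤
        c * (‖ω₀ w.1.1‖ * c + 4 * E / (δ / 100)) := by gcongr
      _ = _ := by field_simp; ring
  have h6 : ‖ω₀ w.1.1‖ * c ^ 2 ≤ ‖ω₀ w.1.1‖ * (1 / (4 * 10 ^ 10) * δ ^ 2) := by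
    gcongr; exact H.c_sq_le
  have h7 : E / δ * c ≤ 1 / (8 * 10 ^ 10) * (a * δ ^ 2) / δ * (1 / 10 ^ 5 * δ) := by
    gcongr
    · exact H.E_le
    · exact H.c_le
  have h8 : 1 / (8 * 10 ^ 10) * (a * δ ^ 2) / δ * (1 / 10 ^ 5 * δ) =
      1 / (8 * 10 ^ 15) * (a * δ ^ 2) := by field_simp
  have h9 : a * δ ^ 2 ≤ ‖ω₀ w.1.1‖ * δ ^ 2 := by gcongr; exact H.le_ω _ hw'.1
  have h10 : δ * (9999 / 10000 * (‖ω₀ w.1.1‖ * (12 / 100 * δ))) ≤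
      δ * ‖fderiv ℂ (hamFamily h ω₀ f₀ f₁) w vecY‖ := by gcongr; linarith
  have : 0 ≤ ‖ω₀ w.1.1‖ * δ ^ 2 := by positivity
  nlinarith

/-- The angles give the delicate estimate. The main part of `∂_I G` is bounded by `M₁`, and over a
length `e' c` at height `y' δ` it contributes about `e' s / (8 y')`, by `8 c M₁ ≤ s a δ`. Condition
`hnum` says that this fits into `r' s`, with `s / 2000` reserved for the derivatives of `ω₀` and of
the deformation. -/
theorem charField_phi_le (H : DeformationData S ρ s δ Δ c a M₀ M₁ E ν h ω₀ f₀ f₁)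
    {w : ExtPhase n} (hw : w ∈ fieldDomain S ρ s δ Δ c) {X e' r' y' : ℝ} (hX0 : 0 ≤ X)
    (he : e' ≤ 1) (hX : X ≤ e' * c) (hy0 : 0 < y') (hy : y' * δ ≤ ‖w.1.2.2.1‖)
    (hr : r' ≤ 1) (hnum : e' ≤ 799 / 100 * (r' - 1 / 2000) * y') :
    X * ‖(charField (hamFamily h ω₀ f₀ f₁) w).1.2.1‖ ≤ 9999 / 10000 * (r' * s) := by
  have hδ := H.δ_pos; have ha := H.a_pos; have hc := H.c_pos; have hρ := H.ρ_pos
  have hs := H.s_pos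
  have hE := H.E_nonneg; have hM₁ := H.M₁_nonneg
  have hw' := H.fieldDomain_subset hw
  have hM₀ : 0 < M₀ := H.a_pos.trans_le H.a_le
  have hyΔ : ‖w.1.2.2.1‖ < Δ + δ := by
    have := (norm_bounds_of_mem_lineNhd hw.2.2.1).2; linarith
  have hxc : ‖w.1.2.2.2‖ ≤ c := by have := hw.2.2.2.1; linarith
  have hb : ‖(hamVec n (fderiv ℂ (hamFamily h ω₀ f₀ f₁) w)).2.1‖ ≤
      M₁ + c ^ 2 / 2 * (M₀ / (ρ / 1000)) + 4 * E / (ρ / 1000) := by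
    refine norm_hamVec_snd_le (by positivity) fun v hv => ?_
    rw [H.fderiv_hamFamily_apply hw']
    refine (norm_add_le _ _).trans (add_le_add ?_ (H.norm_fderiv_deformation_vecI_le hw hv))
    have hI : actionNhd S ρ ∈ nhds w.1.1 := isOpen_thickening.mem_nhds hw'.1
    have hh := H.diff_h.differentiableAt hI
    have hω := H.diff_ω.differentiableAt hI
    have h1 : fderiv ℂ (fun J => h J + ω₀ J / 2 * w.1.2.2.1 ^ 2) w.1.1 v =
        fderiv ℂ h w.1.1 v + w.1.2.2.1 ^ 2 / 2 * fderiv ℂ ω₀ w.1.1 v := by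
      have h2 := hh.hasFDerivAt.add (hω.hasFDerivAt.mul_const (w.1.2.2.1 ^ 2 / 2))
      have h3 : HasFDerivAt (fun J => h J + ω₀ J / 2 * w.1.2.2.1 ^ 2) _ w.1.1 :=
        h2.congr_of_eventuallyEq (.of_forall fun J => by simp only [Pi.add_apply]; ring)
      rw [h3.fderiv]
      simp
    have h2 : ‖fderiv ℂ (fun J => h J + ω₀ J / 2 * w.1.2.2.1 ^ 2) w.1.1 v‖ ≤ M₁ := by
      refine (ContinuousLinearMap.le_opNorm _ _).trans ?_
      rw [hv, mul_one]
      exact H.ω₁_le _ hw'.1 _ hyΔ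
    have h3 : ‖w.1.2.2.2 ^ 2 / 2 * fderiv ℂ ω₀ w.1.1 v‖ ≤ c ^ 2 / 2 * (M₀ / (ρ / 1000)) := by
      rw [norm_mul, norm_div, norm_pow, Complex.norm_ofNat]
      gcongr
      exact H.norm_fderiv_ω_le hw.1 hv
    refine le_trans (le_of_eq ?_) ((norm_add_le _ _).trans (add_le_add h2 h3))
    rw [h1]
    congr 1
    simp only [vecI, mul_zero, add_zero]
    ring
  refine H.norm_inv_smul_le_of_le hw hX0 hb ?_
  set m := ‖fderiv ℂ (hamFamily h ω₀ f₀ f₁) w vecY‖ with hm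
  have h1 := (H.norm_fderiv_vecY_pos hw).2
  have h1' := (H.norm_fderiv_vecY_pos hw).1
  have hy' : a * (y' * δ) ≤ a * ‖w.1.2.2.1‖ := by gcongr
  have he0 : 0 ≤ e' := by
    by_contra! hneg
    have := mul_neg_of_neg_of_pos hneg hc
    linarith
  have hXc : X ≤ c := hX.trans (by nlinarith)
  have hrest : X * (c ^ 2 / 2 * (M₀ / (ρ / 1000)) + 4 * E / (ρ / 1000)) ≤
      1 / 10 ^ 6 * (a * δ * s) :=
    calc X * (c ^ 2 / 2 * (M₀ / (ρ / 1000)) + 4 * E / (ρ / 1000))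
        ≤ c * (c ^ 2 / 2 * (M₀ / (ρ / 1000)) + 4 * E / (ρ / 1000)) := by gcongr
      _ = (500 * (c ^ 3 * M₀) + 2000 * (2 * c * E)) / ρ := by field_simp; ring
      _ ≤ (500 * (1 / 10 ^ 10 * (a * δ * ρ * s)) + 2000 * (1 / 10 ^ 10 * (a * δ * ρ * s))) / ρ := by
          gcongr (500 * ?_ + 2000 * ?_) / ρ
          · exact H.cE_le.2
          · exact H.cE_le.1
      _ = 25 / 10 ^ 8 * (a * δ * s) := by field_simp; norm_num
      _ ≤ _ := by have : 0 < a * δ * s := by positivity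
                  linarith
  -- The factor `799 / 100` of `hnum`, slightly less than `8`, leaves the slack that absorbs the
  -- loss `9999 / 10000` in the lower bound of `∂_y G`.
  have hmain : X * M₁ ≤ 9999 / 10000 * (r' - 1 / 2000) * s * (a * (y' * δ)) :=
    calc X * M₁ ≤ e' * c * M₁ := by gcongr
      _ = e' * (8 * c * M₁) / 8 := by ring
      _ ≤ e' * (s * (a * δ)) / 8 := by gcongr e' * ?_ / 8; exact H.small₅
      _ ≤ (799 / 100 * (r' - 1 / 2000) * y') * (s * (a * δ)) / 8 := by gcongr
      _ = 799 / 800 * ((r' - 1 / 2000) * y') * (s * (a * δ)) := by ring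
      _ ≤ 9999 / 10000 * ((r' - 1 / 2000) * y') * (s * (a * δ)) := by
          have h0 : 0 ≤ (r' - 1 / 2000) * y' := by linarith
          have := mul_nonneg h0 (by positivity : 0 ≤ s * (a * δ))
          linarith
      _ = _ := by ring
  have hr1 : 0 ≤ r' - 1 / 2000 := by
    by_contra! hneg
    have := mul_neg_of_neg_of_pos hneg hy0
    linarith
  have h2 : 9999 / 10000 * (r' - 1 / 2000) * s * (a * (y' * δ)) ≤
      (r' - 1 / 2000) * s * m := by
    have : 0 ≤ (r' - 1 / 2000) * s := by positivity
    nlinarith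
  have h3 : s * (119 / 1000 * (a * δ)) ≤ s * m := by gcongr
  have h4 : 0 ≤ (1 - r') * (s * m) := mul_nonneg (by linarith) (by positivity)
  have h5 : 0 < a * δ * s := by positivity
  nlinarith

end DeformationData
end CharacteristicBounds

/-! ### Reality and periodicity of fields and curves. -/

section Symmetries

variable {n : ℕ}

/-- Componentwise imaginary part, times `i`. -/
def imProj (n : ℕ) : ExtPhase n →L[ℝ] ExtPhase n :=
  LinearMap.toContinuousLinearMap
    { toFun := fun w => ((WithLp.toLp 2 fun i => ((w.1.1 i).im : ℂ) * Complex.I,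
        WithLp.toLp 2 fun i => ((w.1.2.1 i).im : ℂ) * Complex.I,
        (w.1.2.2.1.im : ℂ) * Complex.I, (w.1.2.2.2.im : ℂ) * Complex.I),
        (w.2.im : ℂ) * Complex.I)
      map_add' := fun v w => by ext <;> simp <;> ring
      map_smul' := fun r w => by ext <;> simp <;> ring }

theorem imProj_apply (w : ExtPhase n) : imProj n w =
    ((WithLp.toLp 2 fun i => ((w.1.1 i).im : ℂ) * Complex.I,
        WithLp.toLp 2 fun i => ((w.1.2.1 i).im : ℂ) * Complex.I,
        (w.1.2.2.1.im : ℂ) * Complex.I, (w.1.2.2.2.im : ℂ) * Complex.I),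
        (w.2.im : ℂ) * Complex.I) := rfl

theorem imProj_imProj (w : ExtPhase n) : imProj n (imProj n w) = imProj n w := by
  simp [imProj_apply]

theorem imProj_eq_zero_iff {w : ExtPhase n} : imProj n w = 0 ↔
    (∀ i, (w.1.1 i).im = 0) ∧ (∀ i, (w.1.2.1 i).im = 0) ∧ w.1.2.2.1.im = 0 ∧ w.1.2.2.2.im = 0 ∧
      w.2.im = 0 := by
  rw [imProj_apply]
  simp only [Prod.ext_iff, PiLp.ext_iff]
  simp [and_assoc]

theorem eq_ofRealVec_of_im_eq_zero {v : CVec n} (hv : ∀ i, (v i).im = 0) :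
    v = ofRealVec fun i => (v i).re := by
  ext i
  simp [ofRealVec, Complex.ext_iff, hv i]

theorem mem_realPoints_iff {z : Phase n} : z ∈ realPoints n ↔
    (∀ i, (z.1 i).im = 0) ∧ (∀ i, (z.2.1 i).im = 0) ∧ z.2.2.1.im = 0 ∧ z.2.2.2.im = 0 := by
  constructor
  · rintro ⟨I, φ, y, x, rfl⟩
    simp [realPoint, ofRealVec]
  · rintro ⟨h1, h2, h3, h4⟩
    refine ⟨WithLp.toLp 2 fun i => (z.1 i).re, WithLp.toLp 2 fun i => (z.2.1 i).re,
      z.2.2.1.re, z.2.2.2.re, ?_⟩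
    refine Prod.ext (eq_ofRealVec_of_im_eq_zero h1) (Prod.ext (eq_ofRealVec_of_im_eq_zero h2)
      (Prod.ext ?_ ?_))
    · simp [realPoint, Complex.ext_iff, h3]
    · simp [realPoint, Complex.ext_iff, h4]

theorem imProj_eq_zero_iff_mem {w : ExtPhase n} :
    imProj n w = 0 ↔ w.1 ∈ realPoints n ∧ w.2.im = 0 := by
  rw [imProj_eq_zero_iff, mem_realPoints_iff]; tauto

/-- A function real on real points has real derivatives in real directions. -/
theorem im_fderiv_apply_eq_zero {f : ExtPhase n → ℂ} {U : Set (ExtPhase n)} (hU : IsOpen U)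
    (hf : DifferentiableOn ℂ f U) (hr : ∀ w ∈ U, imProj n w = 0 → (f w).im = 0)
    {w v : ExtPhase n} (hw : w ∈ U) (hw0 : imProj n w = 0) (hv0 : imProj n v = 0) :
    (fderiv ℂ f w v).im = 0 := by
  have h1 : HasDerivAt (fun t : ℝ => w + t • v) v 0 := by
    simpa using ((hasDerivAt_id (0 : ℝ)).smul_const v).const_add w
  have h2 := ((hf.differentiableAt (hU.mem_nhds hw)).hasFDerivAt.restrictScalars ℝ)
  have h3 : HasDerivAt (fun t : ℝ => f (w + t • v)) (fderiv ℂ f w v) 0 :=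
    HasFDerivAt.comp_hasDerivAt (x := (0 : ℝ)) (l := f) (f := fun t : ℝ => w + t • v)
      (l' := (fderiv ℂ f w).restrictScalars ℝ) (by simpa using h2) h1
  have h4 : HasDerivAt (fun t : ℝ => (f (w + t • v)).im) (fderiv ℂ f w v).im 0 :=
    (Complex.imCLM.hasFDerivAt.comp_hasDerivAt (0 : ℝ) h3)
  have h5 : (fun t : ℝ => (f (w + t • v)).im) =ᶠ[nhds 0] fun _ => 0 := by
    have hc : ContinuousAt (fun t : ℝ => w + t • v) 0 := h1.continuousAt
    filter_upwards [hc.preimage_mem_nhds (by simpa using hU.mem_nhds hw)] with t ht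
    exact hr _ ht (by rw [map_add, map_smul, hw0, hv0]; simp)
  exact h4.unique ((hasDerivAt_const (0 : ℝ) (0 : ℝ)).congr_of_eventuallyEq h5)

theorem imProj_basis (i : Fin n) : imProj n (vecI (EuclideanSpace.single i 1)) = 0 ∧
    imProj n (vecPhi (EuclideanSpace.single i 1)) = 0 := by
  simp only [imProj_eq_zero_iff, vecI, vecPhi]
  simp [apply_ite Complex.im]

theorem imProj_vecYX : imProj n (vecY : ExtPhase n) = 0 ∧ imProj n (vecX : ExtPhase n) = 0 := by
  simp only [imProj_eq_zero_iff, vecY, vecX]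
  simp

theorem imProj_hamVec {ℓ : ExtPhase n →L[ℂ] ℂ}
    (h : ∀ v, imProj n v = 0 → (ℓ v).im = 0) (t : ℝ) :
    imProj n (hamVec n ℓ, (t : ℂ)) = 0 := by
  rw [imProj_eq_zero_iff, hamVec_apply]
  refine ⟨fun i => ?_, fun i => ?_, ?_, ?_, ?_⟩
  · simpa using h _ (imProj_basis i).2
  · simpa using h _ (imProj_basis i).1
  · simpa using h _ imProj_vecYX.2
  · simpa using h _ imProj_vecYX.1
  · simp

/-- The translation vector of the angles by `2π m`. -/
def shiftVec (m : Fin n → ℤ) : ExtPhase n := vecPhi (ofRealVec fun i => 2 * Real.pi * (m i : ℝ))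

theorem fst_add_shiftVec (w : ExtPhase n) (m : Fin n → ℤ) :
    (w + shiftVec m).1 = shift m w.1 := by
  simp [shiftVec, vecPhi, shift, Prod.ext_iff]

theorem snd_add_shiftVec (w : ExtPhase n) (m : Fin n → ℤ) : (w + shiftVec m).2 = w.2 := by
  simp [shiftVec, vecPhi]

theorem im_shift (z : Phase n) (m : Fin n → ℤ) (i : Fin n) :
    ((shift m z).2.1 i).im = (z.2.1 i).im := by
  simp [shift, ofRealVec]

theorem add_shiftVec_mem_extDomain {S : Set (EuclideanSpace ℝ (Fin n))} {δ Δ r σ d e T : ℝ}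
    {w : ExtPhase n} (hw : w ∈ extDomain S δ Δ r σ d e T) (m : Fin n → ℤ) :
    w + shiftVec m ∈ extDomain S δ Δ r σ d e T := by
  obtain ⟨h1, h2, h3, h4, h5⟩ := hw
  refine ⟨?_, fun i => ?_, ?_, ?_, ?_⟩
  · rw [fst_add_shiftVec]; exact h1
  · rw [fst_add_shiftVec, im_shift]; exact h2 i
  · rw [fst_add_shiftVec]; exact h3
  · rw [fst_add_shiftVec]; exact h4
  · rwa [snd_add_shiftVec]

theorem fderiv_add_of_eventuallyEq {Z : Type*} [NormedAddCommGroup Z] [NormedSpace ℂ Z]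
    {f : Z → ℂ} {U : Set Z} (hU : IsOpen U) {v : Z} (h : ∀ w ∈ U, f (w + v) = f w) {w : Z}
    (hw : w ∈ U) : fderiv ℂ f (w + v) = fderiv ℂ f w := by
  rw [← fderiv_comp_add_right]
  exact Filter.EventuallyEq.fderiv_eq (Filter.eventuallyEq_of_mem (hU.mem_nhds hw) h)

theorem IsCurve.add_const {Z : Type*} [NormedAddCommGroup Z] [NormedSpace ℂ Z] {V : Z → Z}
    {U : Set Z} {γ : ℝ → Z} {z v : Z} (hγ : IsCurve V U γ z) (hU : ∀ w ∈ U, w + v ∈ U)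
    (hV : ∀ w ∈ U, V (w + v) = V w) : IsCurve V U (fun t => γ t + v) (z + v) := by
  refine ⟨by simp [hγ.start], fun t ht => hU _ (hγ.mem t ht), fun t ht => ?_⟩
  rw [hV _ (hγ.mem t ht)]
  exact (hγ.deriv t ht).add_const v

end Symmetries

/-! ### The generator of the conjugation, solved by characteristics. -/

section Generator

variable {n : ℕ} {S : Set (EuclideanSpace ℝ (Fin n))} {ρ s δ Δ c a M₀ M₁ E ν : ℝ}
  {h ω₀ : CVec n → ℂ} {f₀ f₁ : Phase n → ℂ}

theorem charField_vecX {G : ExtPhase n → ℂ} {w : ExtPhase n} (hw : fderiv ℂ G w vecY ≠ 0) :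
    (charField G w).1.2.2.2 = 1 := by
  change (fderiv ℂ G w vecY)⁻¹ * fderiv ℂ G w vecY = 1
  exact inv_mul_cancel₀ hw

theorem differentiableOn_charField {G : ExtPhase n → ℂ} {U : Set (ExtPhase n)} (hU : IsOpen U)
    (hG : DifferentiableOn ℂ G U) (h0 : ∀ w ∈ U, fderiv ℂ G w vecY ≠ 0) :
    DifferentiableOn ℂ (charField G) U := by
  have h1 := differentiableOn_fderiv hU hG
  have h2 : DifferentiableOn ℂ (fun w => fderiv ℂ G w vecY) U :=
    h1.clm_apply (differentiableOn_const _)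
  exact ((h2.inv h0).smul ((hamVec n).differentiable.comp_differentiableOn h1)).prodMk
    (differentiableOn_const _)

theorem imProj_charField {G : ExtPhase n → ℂ} {w : ExtPhase n}
    (h : ∀ v, imProj n v = 0 → (fderiv ℂ G w v).im = 0) : imProj n (charField G w) = 0 := by
  obtain ⟨r, hr⟩ : ∃ r : ℝ, (fderiv ℂ G w vecY)⁻¹ = (r : ℂ) :=
    ⟨((fderiv ℂ G w vecY)⁻¹).re, by
      apply Complex.ext <;> simp [Complex.inv_im, h _ imProj_vecYX.1]⟩
  have h1 : charField G w = r • ((hamVec n (fderiv ℂ G w), ((0 : ℝ) : ℂ)) : ExtPhase n) := by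
    simp only [charField, hr]
    ext <;> simp
  rw [h1, map_smul, imProj_hamVec h, smul_zero]

namespace DeformationData

theorem imProj_real (H : DeformationData S ρ s δ Δ c a M₀ M₁ E ν h ω₀ f₀ f₁) {w : ExtPhase n}
    (hw : w ∈ (Prod.fst ⁻¹' phaseDomain S ρ s (Δ + δ) : Set (ExtPhase n)))
    (hw0 : imProj n w = 0) : (hamFamily h ω₀ f₀ f₁ w).im = 0 := by
  rw [imProj_eq_zero_iff_mem] at hw0
  obtain ⟨hr, ht⟩ := hw0
  have h0 := H.real_f₀ _ ⟨hw, hr⟩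
  have h1 := H.real_f₁ _ ⟨hw, hr⟩
  rw [mem_realPoints_iff] at hr
  obtain ⟨k1, k2, k3, k4⟩ := hr
  have h2 := H.real_h _ hw.1 k1
  have h3 := H.real_ω _ hw.1 k1
  simp [hamFamily, deformation, pow_two, h0, h1, h2, h3, k3, k4, ht]

theorem hamFamily_add_shiftVec (H : DeformationData S ρ s δ Δ c a M₀ M₁ E ν h ω₀ f₀ f₁)
    (m : Fin n → ℤ) {w : ExtPhase n}
    (hw : w ∈ (Prod.fst ⁻¹' phaseDomain S ρ s (Δ + δ) : Set (ExtPhase n))) :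
    hamFamily h ω₀ f₀ f₁ (w + shiftVec m) = hamFamily h ω₀ f₀ f₁ w := by
  simp only [hamFamily, deformation, fst_add_shiftVec, snd_add_shiftVec]
  rw [H.periodic_f₀ _ hw, H.periodic_f₁ _ hw]
  rfl

theorem fderiv_hamFamily_add_shiftVec
    (H : DeformationData S ρ s δ Δ c a M₀ M₁ E ν h ω₀ f₀ f₁) (m : Fin n → ℤ) {w : ExtPhase n}
    (hw : w ∈ (Prod.fst ⁻¹' phaseDomain S ρ s (Δ + δ) : Set (ExtPhase n))) :
    fderiv ℂ (hamFamily h ω₀ f₀ f₁) (w + shiftVec m) = fderiv ℂ (hamFamily h ω₀ f₀ f₁) w :=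
  fderiv_add_of_eventuallyEq (isOpen_preimage_phaseDomain S ρ s (Δ + δ))
    (fun _ hw => H.hamFamily_add_shiftVec m hw) hw

theorem differentiableOn_charField_hamFamily
    (H : DeformationData S ρ s δ Δ c a M₀ M₁ E ν h ω₀ f₀ f₁) :
    DifferentiableOn ℂ (charField (hamFamily h ω₀ f₀ f₁)) (fieldDomain S ρ s δ Δ c) :=
  differentiableOn_charField (isOpen_extDomain ..)
    (H.differentiableOn_hamFamily.mono H.fieldDomain_subset) fun _ hw => H.fderiv_vecY_ne_zero hw

/-- The estimates of the three drifts keep the characteristic in a box inside `fieldDomain`. The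
speed `x` may differ from the coordinate of `z` by `10⁻⁴ c`, as the differentiability of the
solution requires. The parameters express a trade-off: a wide domain in `y` comes nearer to `y = 0`,
where angles drift faster, and leaves a thinner strip and a smaller range of `x`. -/
theorem exists_characteristic (H : DeformationData S ρ s δ Δ c a M₀ M₁ E ν h ω₀ f₀ f₁)
    {σ' d' e' r' : ℝ} (hr0 : 0 < r') (hr1 : r' ≤ 1) (hσ : σ' + r' ≤ 999 / 1000)
    (hd : d' ≤ 3799 / 10000) (he : e' ≤ 9 / 10)
    (hnum : e' + 1 / 10 ^ 4 ≤ 799 / 100 * (r' - 1 / 2000) * (4999 / 10000 - d'))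
    {z : ExtPhase n}
    (hz : z ∈ extDomain S δ Δ (998 / 1000 * ρ) (σ' * s) (d' * δ) (e' * c) (14 / 5))
    {x : ℂ} (hx : ‖x - z.1.2.2.2‖ < 1 / 10 ^ 4 * c) :
    ∃ γ, IsCurve (fun w => -(x • charField (hamFamily h ω₀ f₀ f₁) w))
      (fieldDomain S ρ s δ Δ c) γ z ∧
      ∀ t ∈ Icc (0 : ℝ) 1, ‖(γ t).1.2.2.1 - z.1.2.2.1‖ ≤ 1 / 10 ^ 4 * δ := by
  have hρ := H.ρ_pos; have hs := H.s_pos; have hδ := H.δ_pos; have hc := H.c_pos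
  have hxc : ‖x‖ ≤ (e' + 1 / 10 ^ 4) * c := by
    have h1 := norm_sub_norm_le x z.1.2.2.2
    have h2 := hz.2.2.2.1
    linarith
  have hxc' : ‖x‖ ≤ c := hxc.trans (by nlinarith)
  have hmem : charBox z x (1 / 1000 * ρ) (r' * s) (1 / 10 ^ 4 * δ) ⊆
      fieldDomain S ρ s δ Δ c := by
    rintro w ⟨k1, k2, k3, ⟨t, ht, k4⟩, k5⟩
    -- The `x`-coordinate on the curve is a contraction of that of `z` plus an error of size at most
    -- `10⁻⁴ c`.
    have hw : w.1.2.2.2 - (1 - (t : ℂ)) * z.1.2.2.2 = -(t * (x - z.1.2.2.2)) := by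
      rw [k4]; ring
    refine ⟨mem_thickening_of_norm_sub_le hz.1 k1 (by linarith), fun i => ?_,
      mem_thickening_of_norm_sub_le hz.2.2.1 k3 (by nlinarith), ?_, ?_⟩
    · have := abs_im_apply_sub_le z.1.2.1 w.1.2.1 i
      have := hz.2.1 i
      nlinarith
    · have h1 : w.1.2.2.2 = (1 - (t : ℂ)) * z.1.2.2.2 + -(t * (x - z.1.2.2.2)) := by
        rw [← hw]; ring
      have ht1 : ‖(1 - (t : ℂ))‖ ≤ 1 := by
        rw [← Complex.ofReal_one, ← Complex.ofReal_sub, Complex.norm_real, Real.norm_eq_abs,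
          abs_le]
        constructor <;> linarith [ht.1, ht.2]
      have ht2 : ‖(t : ℂ)‖ ≤ 1 := by
        rw [Complex.norm_real, Real.norm_eq_abs, abs_le]
        constructor <;> linarith [ht.1, ht.2]
      rw [h1]
      refine (norm_add_le _ _).trans_lt ?_
      rw [norm_neg, norm_mul, norm_mul]
      have h2 : ‖(1 - (t : ℂ))‖ * ‖z.1.2.2.2‖ ≤ 1 * ‖z.1.2.2.2‖ := by gcongr
      have h3 : ‖(t : ℂ)‖ * ‖x - z.1.2.2.2‖ ≤ 1 * ‖x - z.1.2.2.2‖ := by gcongr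
      have := hz.2.2.2.1
      nlinarith
    · rw [k5]; have := hz.2.2.2.2; linarith
  obtain ⟨γ, hγ, hγb⟩ := exists_isCurve_charBox (isOpen_extDomain ..)
    H.differentiableOn_charField_hamFamily
    (fun w hw => charField_vecX (H.fderiv_vecY_ne_zero hw)) (fun _ _ => rfl)
    (z := z) (x := x) (r₁ := 1 / 1000 * ρ) (r₂ := r' * s) (r₃ := 1 / 10 ^ 4 * δ)
    (L := 9999 / 10000) (by positivity) (by positivity) (by positivity) (by norm_num)
    (by norm_num) hmem (fun w hw => by
      have hwf := hmem hw
      refine ⟨?_, ?_, ?_⟩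
      · have := H.charField_fst_le hwf (norm_nonneg x) hxc'
        linarith
      · refine H.charField_phi_le hwf (norm_nonneg x) (by linarith) hxc
          -- At `z` one has `‖y‖ > (1 / 2 - d') δ`, and the drift in `y` costs at most a further
          -- `10⁻⁴ δ`.
          (y' := 4999 / 10000 - d') (by linarith) ?_ hr1 hnum
        have h1 := (norm_bounds_of_mem_lineNhd hz.2.2.1).1
        have h2 := norm_sub_norm_le z.1.2.2.1 w.1.2.2.1
        rw [norm_sub_rev] at h2
        have h3 := hw.2.2.1
        linarith
      · have := H.charField_y_le hwf (norm_nonneg x) hxc'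
        linarith)
  exact ⟨γ, hγ, fun t ht => (hγb t ht).2.2.1⟩

/-- The first domain of the generator, wide in the actions, angles and `x`. -/
abbrev genDomain₁ (S : Set (EuclideanSpace ℝ (Fin n))) (ρ s δ Δ c : ℝ) : Set (ExtPhase n) :=
  extDomain S δ Δ (998 / 1000 * ρ) (65 / 100 * s) (167 / 1000 * δ) (9 / 10 * c) (14 / 5)

/-- The second domain of the generator, wide in the `y`-direction. -/
abbrev genDomain₂ (S : Set (EuclideanSpace ℝ (Fin n))) (ρ s δ Δ c : ℝ) : Set (ExtPhase n) :=
  extDomain S δ Δ (998 / 1000 * ρ) (3335 / 10000 * s) (374 / 1000 * δ) (667 / 1000 * c) (14 / 5)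

/-- The domain of the generator. -/
abbrev genDomain (S : Set (EuclideanSpace ℝ (Fin n))) (ρ s δ Δ c : ℝ) : Set (ExtPhase n) :=
  genDomain₁ S ρ s δ Δ c ∪ genDomain₂ S ρ s δ Δ c

theorem exists_characteristic_genDomain
    (H : DeformationData S ρ s δ Δ c a M₀ M₁ E ν h ω₀ f₀ f₁) {z : ExtPhase n}
    (hz : z ∈ genDomain S ρ s δ Δ c) {x : ℂ} (hx : ‖x - z.1.2.2.2‖ < 1 / 10 ^ 4 * c) :
    ∃ γ, IsCurve (fun w => -(x • charField (hamFamily h ω₀ f₀ f₁) w))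
      (fieldDomain S ρ s δ Δ c) γ z ∧
      ∀ t ∈ Icc (0 : ℝ) 1, ‖(γ t).1.2.2.1 - z.1.2.2.1‖ ≤ 1 / 10 ^ 4 * δ := by
  rcases hz with hz | hz
  -- The room `r' s` for the angles is bounded by what the strip leaves: `65 / 100 + 34 / 100` here
  -- and `3335 / 10000 + 664 / 1000` below, both under `999 / 1000`. Both choices satisfy `hnum`
  -- only narrowly.
  · exact H.exists_characteristic (r' := 34 / 100) (by norm_num) (by norm_num) (by norm_num)
      (by norm_num) (by norm_num) (by norm_num) hz hx
  · exact H.exists_characteristic (r' := 664 / 1000) (by norm_num) (by norm_num) (by norm_num)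
      (by norm_num) (by norm_num) (by norm_num) hz hx

theorem isOpen_genDomain (S : Set (EuclideanSpace ℝ (Fin n))) (ρ s δ Δ c : ℝ) :
    IsOpen (genDomain S ρ s δ Δ c) := (isOpen_extDomain ..).union (isOpen_extDomain ..)

theorem genDomain_subset (H : DeformationData S ρ s δ Δ c a M₀ M₁ E ν h ω₀ f₀ f₁) :
    genDomain S ρ s δ Δ c ⊆ fieldDomain S ρ s δ Δ c := by
  intro z hz
  -- The inclusion is read off from the starting point of a characteristic.
  obtain ⟨γ, hγ, -⟩ := H.exists_characteristic_genDomain hz (x := z.1.2.2.2)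
    (by rw [sub_self, norm_zero]; have := H.c_pos; positivity)
  have := hγ.mem 0 (by simp)
  rwa [hγ.start] at this

theorem genDomain_y (H : DeformationData S ρ s δ Δ c a M₀ M₁ E ν h ω₀ f₀ f₁) {z : ExtPhase n}
    (hz : z ∈ genDomain S ρ s δ Δ c) : 126 / 1000 * δ ≤ ‖z.1.2.2.1‖ := by
  have := H.δ_pos
  rcases hz with hz | hz <;>
  · have := (norm_bounds_of_mem_lineNhd hz.2.2.1).1
    linarith

theorem add_shiftVec_mem_genDomain {z : ExtPhase n}
    (hz : z ∈ genDomain S ρ s δ Δ c) (m : Fin n → ℤ) :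
    z + shiftVec m ∈ genDomain S ρ s δ Δ c :=
  hz.imp (fun h => add_shiftVec_mem_extDomain h m) fun h => add_shiftVec_mem_extDomain h m

/-- The generator of the conjugation. -/
theorem exists_generator (H : DeformationData S ρ s δ Δ c a M₀ M₁ E ν h ω₀ f₀ f₁) :
    ∃ F : ExtPhase n → ℂ, DifferentiableOn ℂ F (genDomain S ρ s δ Δ c) ∧
      (∀ z ∈ genDomain S ρ s δ Δ c,
        fderiv ℂ F z (hamVec n (fderiv ℂ (hamFamily h ω₀ f₀ f₁) z), 0) = f₁ z.1) ∧
      (∀ z ∈ genDomain S ρ s δ Δ c, ‖F z‖ * (999 / 1000 * (a * ‖z.1.2.2.1‖)) ≤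
        ‖z.1.2.2.2‖ * E) ∧
      (∀ z ∈ genDomain S ρ s δ Δ c, imProj n z = 0 → (F z).im = 0) ∧
      (∀ z ∈ genDomain S ρ s δ Δ c, ∀ m : Fin n → ℤ, F (z + shiftVec m) = F z) := by
  have hc := H.c_pos; have hδ := H.δ_pos; have ha := H.a_pos; have hE := H.E_nonneg
  set G := hamFamily h ω₀ f₀ f₁ with hG
  set Ω := fieldDomain S ρ s δ Δ c with hΩ
  set D := genDomain S ρ s δ Δ c with hD
  have hΩo : IsOpen Ω := isOpen_extDomain ..
  have hDo : IsOpen D := isOpen_genDomain ..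
  have hGd : DifferentiableOn ℂ G Ω := H.differentiableOn_hamFamily.mono H.fieldDomain_subset
  have hY := H.differentiableOn_charField_hamFamily
  have hex : ∀ (z : ExtPhase n) (x : ℂ), ∃ γ, z ∈ D → ‖x - z.1.2.2.2‖ < 1 / 10 ^ 4 * c →
      IsCurve (fun w => -(x • charField G w)) Ω γ z ∧
      ∀ t ∈ Icc (0 : ℝ) 1, ‖(γ t).1.2.2.1 - z.1.2.2.1‖ ≤ 1 / 10 ^ 4 * δ := by
    intro z x
    by_cases hz : z ∈ D ∧ ‖x - z.1.2.2.2‖ < 1 / 10 ^ 4 * c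
    · obtain ⟨γ, hγ⟩ := H.exists_characteristic_genDomain hz.1 hz.2
      exact ⟨γ, fun _ _ => hγ⟩
    -- Outside the domain the curve is an irrelevant default, needed only to make the choice total.
    · exact ⟨fun _ => 0, fun h1 h2 => absurd ⟨h1, h2⟩ hz⟩
  choose ζ hζ using hex
  let ξ : ExtPhase n →L[ℂ] ℂ :=
    ContinuousLinearMap.snd ℂ ℂ ℂ ∘L ContinuousLinearMap.snd ℂ (CVec n) (ℂ × ℂ) ∘L
        ContinuousLinearMap.snd ℂ (CVec n) (CVec n × ℂ × ℂ) ∘L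
        ContinuousLinearMap.fst ℂ (Phase n) ℂ
  have hξ : ∀ w : ExtPhase n, ξ w = w.1.2.2.2 := fun _ => rfl
  let q : ExtPhase n → ℂ := fun w => f₁ w.1 / fderiv ℂ G w vecY
  have hq : DifferentiableOn ℂ q Ω := by
    have h1 : DifferentiableOn ℂ (fun w : ExtPhase n => f₁ w.1) Ω :=
      H.diff_f₁.comp differentiableOn_fst fun w hw => H.fieldDomain_subset hw
    have h2 : DifferentiableOn ℂ (fun w => fderiv ℂ G w vecY) Ω :=
      (differentiableOn_fderiv hΩo hGd).clm_apply (differentiableOn_const _)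
    refine (h1.mul (h2.inv fun w hw => H.fderiv_vecY_ne_zero hw)).congr fun w _ => ?_
    simp [q, div_eq_mul_inv]
  have hκ : 0 < 1 / 10 ^ 4 * c := by positivity
  have hζ' : ∀ z ∈ D, ∀ x : ℂ, ‖x - ξ z‖ < 1 / 10 ^ 4 * c →
      IsCurve (fun w => -(x • charField G w)) Ω (ζ z x) z :=
    fun z hz x hx => (hζ z x hz hx).1
  have hself : ∀ z : ExtPhase n, ‖ξ z - ξ z‖ < 1 / 10 ^ 4 * c := fun z => by simpa using hκ
  have hYd : ∀ x : ℂ, DifferentiableOn ℂ (fun w => -(x • charField G w)) Ω := fun x =>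
    (hY.const_smul x).neg
  refine ⟨transportSolution ξ q ζ, differentiableOn_transportSolution hΩo hDo hY hq hκ hζ',
    fun z hz => ?_, fun z hz => ?_, fun z hz hz0 => ?_, fun z hz m => ?_⟩
  · have h1 := fderiv_transportSolution hΩo hDo H.genDomain_subset hY hq hκ
      (fun w hw => charField_vecX (H.fderiv_vecY_ne_zero hw)) hζ' hz
    have h2 := H.fderiv_vecY_ne_zero (H.genDomain_subset hz)
    have h3 : charField G z = (fderiv ℂ G z vecY)⁻¹ •
        ((hamVec n (fderiv ℂ G z), 0) : ExtPhase n) := by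
      simp [charField]
    rw [h3, map_smul, smul_eq_mul] at h1
    refine (div_left_inj' h2).mp ?_
    rw [div_eq_inv_mul]
    exact h1
  · have hy := H.genDomain_y hz
    have hy0 : 0 < ‖z.1.2.2.1‖ := lt_of_lt_of_le (by positivity) hy
    have h1 : ∀ t ∈ Icc (0 : ℝ) 1, ‖q (ζ z (ξ z) t)‖ ≤ E / (999 / 1000 * (a * ‖z.1.2.2.1‖)) := by
      intro t ht
      obtain ⟨k1, k2⟩ := hζ z (ξ z) hz (hself z)
      have k3 := k1.mem t ht
      have k4 := (H.norm_fderiv_vecY_pos k3).1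
      have k5 := H.f₁_le _ (H.fieldDomain_subset k3)
      have k6 := norm_sub_norm_le z.1.2.2.1 (ζ z (ξ z) t).1.2.2.1
      rw [norm_sub_rev] at k6
      -- A drift of `10⁻⁴ δ` is less than `8 · 10⁻⁴ ‖y‖` because `‖y‖ ≥ 126 / 1000 δ`. Combined with
      -- the factor `9999 / 10000` this leaves more than `999 / 1000`.
      have k7 : a * (9992 / 10000 * ‖z.1.2.2.1‖) ≤ a * ‖(ζ z (ξ z) t).1.2.2.1‖ := by
        gcongr; linarith [k2 t ht]
      rw [norm_div]
      gcongr
      have := mul_pos ha hy0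
      linarith
    have h2 := norm_transportSolution_le h1
    rw [hξ, mul_div_assoc', le_div_iff₀ (by positivity)] at h2
    exact h2
  · have hx0 : imProj n z = 0 := hz0
    have hG0 : ∀ w ∈ Ω, imProj n w = 0 → ∀ v, imProj n v = 0 → (fderiv ℂ G w v).im = 0 :=
      fun w hw hw0 v hv => im_fderiv_apply_eq_zero (isOpen_preimage_phaseDomain S ρ s (Δ + δ))
        H.differentiableOn_hamFamily (fun w hw => H.imProj_real hw) (H.fieldDomain_subset hw)
        hw0 hv
    have hxr : (ξ z).im = 0 := (imProj_eq_zero_iff.mp hz0).2.2.2.1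
    -- The projection `imProj` is only real-linear; the speed of the characteristic is real at a
    -- real point, so it commutes with the projection and the curve stays real.
    obtain ⟨r, hr⟩ : ∃ r : ℝ, ξ z = r := ⟨(ξ z).re, by apply Complex.ext <;> simp [hxr]⟩
    have hcurve := hζ' z hz (ξ z) (hself z)
    have h1 := hcurve.apply_eq_zero hΩo (hYd _) (imProj n) imProj_imProj (fun w hw hw0 => by
      have h2 : -(ξ z • charField G w) = -(r • charField G w) := by
        rw [hr]; rfl
      rw [h2, map_neg, map_smul, imProj_charField (hG0 w hw hw0), smul_zero, neg_zero]) hz0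
    have hval : ∀ t ∈ Icc (0 : ℝ) 1, ξ z * q (ζ z (ξ z) t) =
        ((ξ z * q (ζ z (ξ z) t)).re : ℂ) := by
      intro t ht
      have k1 := hG0 _ (hcurve.mem t ht) (h1 t ht) _ imProj_vecYX.1
      have k2 := H.real_f₁ _ ⟨H.fieldDomain_subset (hcurve.mem t ht),
        (imProj_eq_zero_iff_mem.mp (h1 t ht)).1⟩
      have k3 : (q (ζ z (ξ z) t)).im = 0 := by
        simp only [q]
        rw [Complex.div_im, k1, k2]; simp
      apply Complex.ext
      · simp
      · simp [hxr, k3]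
    rw [transportSolution, intervalIntegral.integral_congr (g := fun t =>
      (((ξ z * q (ζ z (ξ z) t)).re : ℝ) : ℂ)) (fun t ht => hval t (by
        rwa [uIcc_of_le zero_le_one] at ht)), intervalIntegral.integral_ofReal, Complex.ofReal_im]
  · have hz' := add_shiftVec_mem_genDomain hz m
    have hξs : ξ (z + shiftVec m) = ξ z := by
      rw [hξ, hξ, fst_add_shiftVec]; rfl
    have hGs : ∀ w ∈ Ω, fderiv ℂ G (w + shiftVec m) = fderiv ℂ G w := fun w hw =>
      H.fderiv_hamFamily_add_shiftVec m (H.fieldDomain_subset hw)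
    have h1 := (hζ' z hz (ξ z) (hself z)).add_const (v := shiftVec m)
      (fun w hw => add_shiftVec_mem_extDomain hw m)
      (fun w hw => by simp only [charField, hGs w hw])
    have h2 := hζ' _ hz' (ξ z) (by rw [hξs]; exact hself z)
    -- The translated characteristic and the chosen one at the translated point coincide by
    -- uniqueness; no compatibility was built into the choice.
    have h3 := h1.unique hΩo (hYd _) h2
    simp only [transportSolution, hξs]
    refine intervalIntegral.integral_congr fun t ht => ?_
    rw [uIcc_of_le zero_le_one] at ht
    have hmem := (hζ' z hz (ξ z) (hself z)).mem t ht
    simp only [q]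
    rw [h3 t ht, hGs _ hmem, fst_add_shiftVec, H.periodic_f₁ _ (H.fieldDomain_subset hmem)]

end DeformationData
end Generator

/-! ### Cauchy estimates for the field of the generator. -/

section GeneratorBounds

variable {n : ℕ} {S : Set (EuclideanSpace ℝ (Fin n))} {ρ s δ Δ c a M₀ M₁ E ν : ℝ}
  {h ω₀ : CVec n → ℂ} {f₀ f₁ : Phase n → ℂ}

theorem extDomain_add_smul_mem {S : Set (EuclideanSpace ℝ (Fin n))}
    {δ Δ r σ d e T r' σ' d' e' R : ℝ} {w v : ExtPhase n}
    (hw : w ∈ extDomain S δ Δ r σ d e T) {r₁ r₂ r₃ r₄ : ℝ}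
    (h1 : R * ‖v.1.1‖ ≤ r₁) (h2 : R * ‖v.1.2.1‖ ≤ r₂) (h3 : R * ‖v.1.2.2.1‖ ≤ r₃)
    (h4 : R * ‖v.1.2.2.2‖ ≤ r₄) (h5 : v.2 = 0)
    (k1 : r + r₁ ≤ r') (k2 : σ + r₂ ≤ σ') (k3 : d + r₃ ≤ d') (k4 : e + r₄ ≤ e')
    {ζ : ℂ} (hζ : ‖ζ‖ ≤ R) : w + ζ • v ∈ extDomain S δ Δ r' σ' d' e' T := by
  have key : ∀ {F : Type} [NormedAddCommGroup F] [NormedSpace ℂ F] (x u : F) {r : ℝ},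
      R * ‖u‖ ≤ r → ‖x + ζ • u - x‖ ≤ r := by
    intro F _ _ x u r hr
    rw [add_sub_cancel_left, norm_smul]
    exact (mul_le_mul_of_nonneg_right hζ (norm_nonneg _)).trans hr
  refine mem_extDomain_of_sub_le hw (key _ _ h1) (key _ _ h2) (key _ _ h3) (key _ _ h4)
    (r₅ := 0) ?_ k1 k2 k3 k4 (by norm_num)
  simp [h5]

/-- The domain of the flow of the generator. -/
abbrev flowDomain (S : Set (EuclideanSpace ℝ (Fin n))) (ρ s δ Δ c : ℝ) : Set (ExtPhase n) :=
  extDomain S δ Δ (334 / 1000 * ρ) (3335 / 10000 * s) (167 / 1000 * δ) (667 / 1000 * c) (14 / 5)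

namespace DeformationData

theorem flowDomain_subset (H : DeformationData S ρ s δ Δ c a M₀ M₁ E ν h ω₀ f₀ f₁) :
    flowDomain S ρ s δ Δ c ⊆ genDomain₁ S ρ s δ Δ c := fun w hw => by
  have := H.ρ_pos; have := H.s_pos; have := H.δ_pos; have := H.c_pos
  refine mem_extDomain_of_sub_le hw
    (w' := w) (r₁ := 0) (r₂ := 0) (r₃ := 0) (r₄ := 0) (r₅ := 0) ?_ ?_ ?_ ?_ ?_ ?_ ?_ ?_ ?_ ?_
  all_goals first | simp; done | linarith

/-- On the domains of `y`-width `167 / 1000 δ` one has `‖y‖ > 333 / 1000 δ`, and `999 / 1000 · 333 /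
1000 > 332 / 1000`. -/
theorem generator_le (H : DeformationData S ρ s δ Δ c a M₀ M₁ E ν h ω₀ f₀ f₁) {C x y a : ℝ}
    (ha : 0 < a) (hC : 0 ≤ C)
    (hb : C * (999 / 1000 * (a * y)) ≤ x * E) {e' : ℝ} (hx : x ≤ e' * c)
    (hy : 333 / 1000 * δ ≤ y) : C ≤ (e' * (c * E)) / (332 / 1000 * (a * δ)) := by
  have hδ := H.δ_pos
  rw [le_div_iff₀ (by positivity)]
  have h1 : C * (332 / 1000 * (a * δ)) ≤ C * (999 / 1000 * (a * y)) := by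
    gcongr C * ?_
    have : a * (333 / 1000 * δ) ≤ a * y := by gcongr
    have := mul_pos ha hδ
    linarith
  have h2 : x * E ≤ e' * c * E := mul_le_mul_of_nonneg_right hx H.E_nonneg
  linarith

/-- The radii of the Cauchy discs are the gaps between `flowDomain` and the two parts of
`genDomain`. Derivatives in `φ`, `I` and `x` use `genDomain₁`, the derivative in `y` uses
`genDomain₂`. The factor `99 / 100` is the margin that lets the flow exist up to time `1`. -/
theorem hamVec_generator_le (H : DeformationData S ρ s δ Δ c a M₀ M₁ E ν h ω₀ f₀ f₁)
    {F : ExtPhase n → ℂ} (hF : DifferentiableOn ℂ F (genDomain S ρ s δ Δ c))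
    (hb : ∀ z ∈ genDomain S ρ s δ Δ c, ‖F z‖ * (999 / 1000 * (a * ‖z.1.2.2.1‖)) ≤
        ‖z.1.2.2.2‖ * E) {w : ExtPhase n} (hw : w ∈ flowDomain S ρ s δ Δ c) :
    ‖(hamVec n (fderiv ℂ F w)).1‖ ≤ 99 / 100 * (4 * ν * ρ) ∧
    ‖(hamVec n (fderiv ℂ F w)).2.1‖ ≤ 99 / 100 * (4 * ν * s) ∧
    ‖(hamVec n (fderiv ℂ F w)).2.2.1‖ ≤ 99 / 100 * (2 * ν * δ) ∧
    ‖(hamVec n (fderiv ℂ F w)).2.2.2‖ ≤ 99 / 100 * (2 * ν * c) := by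
  have hρ := H.ρ_pos; have hs := H.s_pos; have hδ := H.δ_pos; have hc := H.c_pos
  have ha := H.a_pos; have hE := H.E_nonneg; have hν := H.ν_pos
  have hb1 : ∀ {e' : ℝ} {z : ExtPhase n} {r σ : ℝ}, z ∈ extDomain S δ Δ r σ (167 / 1000 * δ)
      (e' * c) (14 / 5) → z ∈ genDomain S ρ s δ Δ c →
      ‖F z‖ ≤ (e' * (c * E)) / (332 / 1000 * (a * δ)) := fun hz hz' =>
    H.generator_le ha (norm_nonneg _) (hb _ hz') hz.2.2.2.1.le (by
      have := (norm_bounds_of_mem_lineNhd hz.2.2.1).1; linarith)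
  have hF1 := hF.mono (subset_union_left (s := genDomain₁ S ρ s δ Δ c))
  have hw1 := H.flowDomain_subset hw
  have hEd : E / (a * δ) ≤ 1 / 8 * (ν * δ) := by
    rw [div_le_iff₀ (by positivity)]
    linarith [H.small₄]
  have hcE : c * E / (a * δ) ≤ 1 / 2 * (ν * ρ * s) := by
    rw [div_le_iff₀ (by positivity)]
    linarith [H.small₂]
  refine ⟨norm_hamVec_fst_le (by positivity) fun v hv => ?_,
    norm_hamVec_snd_le (by positivity) fun v hv => ?_, ?_, ?_⟩
  · have hmem : ∀ ζ : ℂ, ‖ζ‖ ≤ 3165 / 10000 * s → w + ζ • vecPhi v ∈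
        extDomain S δ Δ (998 / 1000 * ρ) (65 / 100 * s) (167 / 1000 * δ) (667 / 1000 * c) (14 / 5) :=
      fun ζ hζ => by
        refine extDomain_add_smul_mem hw (r₁ := 0) (r₂ := 3165 / 10000 * s) (r₃ := 0) (r₄ := 0)
          ?_ ?_ ?_ ?_ ?_ ?_ ?_ ?_ ?_ hζ
        all_goals first | simp [vecPhi, hv]; done | linarith
    have hsub : ∀ ζ : ℂ, ‖ζ‖ ≤ 3165 / 10000 * s → w + ζ • vecPhi v ∈ genDomain₁ S ρ s δ Δ c :=
      fun ζ hζ => by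
        refine extDomain_add_smul_mem hw (r₁ := 0) (r₂ := 3165 / 10000 * s) (r₃ := 0) (r₄ := 0)
          ?_ ?_ ?_ ?_ ?_ ?_ ?_ ?_ ?_ hζ
        all_goals first | simp [vecPhi, hv]; done | linarith
    refine (norm_fderiv_apply_le (isOpen_extDomain ..) hF1 (by positivity) hsub
      fun ζ hζ => hb1 (hmem ζ hζ) (Or.inl (hsub ζ hζ))).trans ?_
    have h1 : 667 / 1000 * (c * E) / (332 / 1000 * (a * δ)) / (3165 / 10000 * s) =
        (667 / 332 * 10000 / 3165) * (c * E / (a * δ)) / s := by field_simp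
    rw [h1, div_le_iff₀ hs]
    have : 0 < ν * ρ * s := by positivity
    nlinarith
  · have hmem : ∀ ζ : ℂ, ‖ζ‖ ≤ 664 / 1000 * ρ → w + ζ • vecI v ∈
        extDomain S δ Δ (998 / 1000 * ρ) (65 / 100 * s) (167 / 1000 * δ) (667 / 1000 * c) (14 / 5) :=
      fun ζ hζ => by
        refine extDomain_add_smul_mem hw (r₁ := 664 / 1000 * ρ) (r₂ := 0) (r₃ := 0) (r₄ := 0)
          ?_ ?_ ?_ ?_ ?_ ?_ ?_ ?_ ?_ hζ
        all_goals first | simp [vecI, hv]; done | linarith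
    have hsub : ∀ ζ : ℂ, ‖ζ‖ ≤ 664 / 1000 * ρ → w + ζ • vecI v ∈ genDomain₁ S ρ s δ Δ c :=
      fun ζ hζ => by
        refine extDomain_add_smul_mem hw (r₁ := 664 / 1000 * ρ) (r₂ := 0) (r₃ := 0) (r₄ := 0)
          ?_ ?_ ?_ ?_ ?_ ?_ ?_ ?_ ?_ hζ
        all_goals first | simp [vecI, hv]; done | linarith
    refine (norm_fderiv_apply_le (isOpen_extDomain ..) hF1 (by positivity) hsub
      fun ζ hζ => hb1 (hmem ζ hζ) (Or.inl (hsub ζ hζ))).trans ?_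
    have h1 : 667 / 1000 * (c * E) / (332 / 1000 * (a * δ)) / (664 / 1000 * ρ) =
        (667 / 332 * 1000 / 664) * (c * E / (a * δ)) / ρ := by field_simp
    rw [h1, div_le_iff₀ hρ]
    have : 0 < ν * ρ * s := by positivity
    nlinarith
  · have hsub : ∀ ζ : ℂ, ‖ζ‖ ≤ 233 / 1000 * c → w + ζ • vecX ∈ genDomain₁ S ρ s δ Δ c :=
      fun ζ hζ => by
        refine extDomain_add_smul_mem hw (r₁ := 0) (r₂ := 0) (r₃ := 0) (r₄ := 233 / 1000 * c)
          ?_ ?_ ?_ ?_ ?_ ?_ ?_ ?_ ?_ hζ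
        all_goals first | simp [vecX]; done | linarith
    rw [hamVec_apply, norm_neg]
    refine (norm_fderiv_apply_le (isOpen_extDomain ..) hF1 (by positivity) hsub
      fun ζ hζ => hb1 (hsub ζ hζ) (Or.inl (hsub ζ hζ))).trans ?_
    have h1 : 9 / 10 * (c * E) / (332 / 1000 * (a * δ)) / (233 / 1000 * c) =
        (900 / 332 * 1000 / 233) * (E / (a * δ)) := by field_simp; ring
    rw [h1]
    have : 0 < ν * δ := by positivity
    linarith
  · have hsub : ∀ ζ : ℂ, ‖ζ‖ ≤ 207 / 1000 * δ → w + ζ • vecY ∈ genDomain₂ S ρ s δ Δ c :=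
      fun ζ hζ => by
        refine extDomain_add_smul_mem hw (r₁ := 0) (r₂ := 0) (r₃ := 207 / 1000 * δ) (r₄ := 0)
          ?_ ?_ ?_ ?_ ?_ ?_ ?_ ?_ ?_ hζ
        all_goals first | simp [vecY]; done | linarith
    have hF2 := hF.mono (subset_union_right (t := genDomain₂ S ρ s δ Δ c))
    have hw2 : w ∈ genDomain₂ S ρ s δ Δ c := by simpa using hsub 0 (by simp; positivity)
    let ℓ : ExtPhase n →L[ℂ] ℂ := ContinuousLinearMap.fst ℂ ℂ ℂ ∘L
      ContinuousLinearMap.snd ℂ (CVec n) (ℂ × ℂ) ∘L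
      ContinuousLinearMap.snd ℂ (CVec n) (CVec n × ℂ × ℂ) ∘L ContinuousLinearMap.fst ℂ (Phase n) ℂ
    -- The bound on `F` deteriorates as `1 / ‖y‖`, whereas `y F` is bounded uniformly. Cauchy's
    -- estimate is therefore applied to `y F`, and `∂_y F` is recovered from `∂_y (y F) = y ∂_y F +
    -- F`.
    have hℓF : DifferentiableOn ℂ (fun z => ℓ z * F z) (genDomain₂ S ρ s δ Δ c) :=
      ℓ.differentiable.differentiableOn.mul hF2
    have hFw := (hF2.differentiableAt ((isOpen_extDomain ..).mem_nhds hw2)).hasFDerivAt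
    have hd : fderiv ℂ (fun z => ℓ z * F z) w vecY = w.1.2.2.1 * fderiv ℂ F w vecY + F w := by
      have h2 : HasFDerivAt (fun z => ℓ z * F z) _ w := ℓ.hasFDerivAt.mul hFw
      rw [h2.fderiv]
      have h3 : ℓ vecY = 1 := rfl
      simp only [add_apply, smul_apply, smul_eq_mul, h3, mul_one]
      rfl
    have hA := norm_fderiv_apply_le (isOpen_extDomain ..) hℓF (R := 207 / 1000 * δ)
      (M := 667 / 999 * (c * E) / a) (by positivity) hsub (fun ζ hζ => by
        have h1 := hb _ (Or.inr (hsub ζ hζ))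
        have h2 := mul_le_mul_of_nonneg_right (hsub ζ hζ).2.2.2.1.le hE
        rw [norm_mul, le_div_iff₀ ha]
        change ‖(w + ζ • vecY).1.2.2.1‖ * _ * _ ≤ _
        linarith)
    rw [hd] at hA
    have hFle := hb1 hw (Or.inl hw1)
    have hy := (norm_bounds_of_mem_lineNhd hw.2.2.1).1
    change ‖fderiv ℂ F w vecY‖ ≤ _
    set X := fderiv ℂ F w vecY
    have h4 : ‖w.1.2.2.1‖ * ‖X‖ ≤ 667 / 999 * (c * E) / a / (207 / 1000 * δ) +
        667 / 1000 * (c * E) / (332 / 1000 * (a * δ)) := by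
      rw [← norm_mul]
      have := norm_sub_le (w.1.2.2.1 * X + F w) (F w)
      rw [add_sub_cancel_right] at this
      linarith
    have h5 : 667 / 999 * (c * E) / a / (207 / 1000 * δ) +
        667 / 1000 * (c * E) / (332 / 1000 * (a * δ)) =
        (667 / 999 * 1000 / 207 + 667 / 332) * (c * (E / (a * δ))) := by field_simp
    have h6 : c * (E / (a * δ)) ≤ c * (1 / 8 * (ν * δ)) := by gcongr
    have h7 : 333 / 1000 * δ * ‖X‖ ≤ ‖w.1.2.2.1‖ * ‖X‖ := by gcongr; linarith
    have h8 : δ * ‖X‖ ≤ δ * (99 / 100 * (2 * ν * c)) := by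
      have : 0 < c * (ν * δ) := by positivity
      linarith
    exact le_of_mul_le_mul_left h8 hδ

end DeformationData
end GeneratorBounds

/-! ### The time-one flow of the generator and its inverse. -/

section Conjugation

variable {n : ℕ} {S : Set (EuclideanSpace ℝ (Fin n))} {ρ s δ Δ c a M₀ M₁ E ν : ℝ}
  {h ω₀ : CVec n → ℂ} {f₀ f₁ : Phase n → ℂ}

/-- The set of initial points of the flow of the generator. -/
def startDomain (S : Set (EuclideanSpace ℝ (Fin n))) (ρ s δ Δ c : ℝ) : Set (Phase n) :=
  {z | z.1 ∈ actionNhd S (3335 / 10000 * ρ) ∧ (∀ i, |(z.2.1 i).im| < 3334 / 10000 * s) ∧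
    z.2.2.1 ∈ lineNhd (longSide δ Δ) (1669 / 10000 * δ) ∧ ‖z.2.2.2‖ < 6668 / 10000 * c}

/-- The set of initial points of the flow of the generator in the extended phase space. -/
abbrev startExt (S : Set (EuclideanSpace ℝ (Fin n))) (ρ s δ Δ c : ℝ) : Set (ExtPhase n) :=
  extDomain S δ Δ (3335 / 10000 * ρ) (3334 / 10000 * s) (1669 / 10000 * δ) (6668 / 10000 * c)
    (3 / 2)

theorem mem_startExt {z : Phase n} (hz : z ∈ startDomain S ρ s δ Δ c) {t : ℂ}
    (ht : ‖t‖ ≤ 1) : (z, t) ∈ startExt S ρ s δ Δ c :=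
  ⟨hz.1, hz.2.1, hz.2.2.1, hz.2.2.2, by change ‖t‖ < _; linarith⟩

theorem mem_startDomain {w : ExtPhase n} (hw : w ∈ startExt S ρ s δ Δ c) :
    w.1 ∈ startDomain S ρ s δ Δ c :=
  ⟨hw.1, hw.2.1, hw.2.2.1, hw.2.2.2.1⟩

theorem isOpen_startDomain (S : Set (EuclideanSpace ℝ (Fin n))) (ρ s δ Δ c : ℝ) :
    IsOpen (startDomain S ρ s δ Δ c) := by
  have h1 : startDomain S ρ s δ Δ c =
      (fun z : Phase n => ((z, 0) : ExtPhase n)) ⁻¹' startExt S ρ s δ Δ c :=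
    Set.ext fun z => ⟨fun hz => mem_startExt hz (by simp),
      fun hz => mem_startDomain (w := (z, 0)) hz⟩
  rw [h1]
  exact (isOpen_extDomain ..).preimage (continuous_id.prodMk continuous_const)

theorem shift_mem_startDomain {z : Phase n} (hz : z ∈ startDomain S ρ s δ Δ c)
    (m : Fin n → ℤ) : shift m z ∈ startDomain S ρ s δ Δ c :=
  ⟨hz.1, fun i => by rw [im_shift]; exact hz.2.1 i, hz.2.2⟩

/-- Closeness of two points of phase space in the scales of the problem. -/
def IsNear (ν ρ s δ c : ℝ) (z z' : Phase n) : Prop :=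
  ‖z'.1 - z.1‖ ≤ 4 * ν * ρ ∧ ‖z'.2.1 - z.2.1‖ ≤ 4 * ν * s ∧ ‖z'.2.2.1 - z.2.2.1‖ ≤ 2 * ν * δ ∧
    ‖z'.2.2.2 - z.2.2.2‖ ≤ 2 * ν * c

theorem IsCurve.snd_eq {V : ExtPhase n → ExtPhase n} {U : Set (ExtPhase n)} {γ : ℝ → ExtPhase n}
    {z : ExtPhase n} (hγ : IsCurve V U γ z) {κ : ℂ} (hV : ∀ w ∈ U, (V w).2 = κ) :
    (γ 1).2 = z.2 + κ := by
  have hd : ∀ t ∈ Icc (0 : ℝ) 1,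
      HasDerivWithinAt (fun t => (γ t).2 - t • κ) 0 (Icc 0 1) t := by
    intro t ht
    have h1 : HasDerivWithinAt (fun t => (γ t).2) (V (γ t)).2 (Icc 0 1) t :=
      (ContinuousLinearMap.snd ℝ (Phase n) ℂ).hasFDerivAt.comp_hasDerivWithinAt t (hγ.deriv t ht)
    have h2 : HasDerivWithinAt (fun t : ℝ => t • κ) ((1 : ℝ) • κ) (Icc 0 1) t :=
      ((hasDerivAt_id t).smul_const κ).hasDerivWithinAt
    refine (h1.sub h2).congr_deriv ?_
    rw [hV _ (hγ.mem t ht), one_smul, sub_self]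
  have := constant_of_has_deriv_right_zero (fun t ht => (hd t ht).continuousWithinAt)
    (fun t ht => hasDerivWithinAt_Ici_of_Icc (hd t (Ico_subset_Icc_self ht)) ht) 1 (by simp)
  simp only [one_smul, hγ.start, zero_smul, sub_zero] at this
  rw [← this]; ring

namespace DeformationData

/-- The bounds are symmetric under a change of sign, so the lemma serves both the flow and its
reversal. Since `ν ≤ 10⁻¹⁰`, the displacements fit into the gap between `startExt` and `flowDomain`;
for the parameter, `3 / 2 + 6 / 5 ≤ 14 / 5`. -/
theorem exists_flow_curve (H : DeformationData S ρ s δ Δ c a M₀ M₁ E ν h ω₀ f₀ f₁)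
    {V : ExtPhase n → ExtPhase n} (hV : DifferentiableOn ℂ V (flowDomain S ρ s δ Δ c))
    (hb : ∀ w ∈ flowDomain S ρ s δ Δ c, ‖(V w).1.1‖ ≤ 99 / 100 * (4 * ν * ρ) ∧
      ‖(V w).1.2.1‖ ≤ 99 / 100 * (4 * ν * s) ∧ ‖(V w).1.2.2.1‖ ≤ 99 / 100 * (2 * ν * δ) ∧
      ‖(V w).1.2.2.2‖ ≤ 99 / 100 * (2 * ν * c) ∧ ‖(V w).2‖ ≤ 1)
    {z : ExtPhase n} (hz : z ∈ startExt S ρ s δ Δ c) :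
    ∃ γ, IsCurve V (flowDomain S ρ s δ Δ c) γ z ∧ IsNear ν ρ s δ c z.1 (γ 1).1 := by
  have hρ := H.ρ_pos; have hs := H.s_pos; have hδ := H.δ_pos; have hc := H.c_pos
  have hν := H.ν_pos; have hν1 := H.ν_le
  have key : ∀ {x : ℝ}, 0 < x → ν * x ≤ 1 / 10 ^ 10 * x := fun hx => by gcongr
  have hsub : polydisc z (4 * ν * ρ) (4 * ν * s) (2 * ν * δ) (2 * ν * c) (6 / 5) ⊆
      flowDomain S ρ s δ Δ c := by
    rintro w ⟨k1, k2, k3, k4, k5⟩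
    refine mem_extDomain_of_sub_le hz k1 k2 k3 k4 k5 ?_ ?_ ?_ ?_ (by norm_num)
    · linarith [key hρ]
    · linarith [key hs]
    · linarith [key hδ]
    · linarith [key hc]
  obtain ⟨γ, hγ, hγb⟩ := exists_isCurve_polydisc (isOpen_extDomain ..) hV (L := 99 / 100)
    (by positivity) (by positivity) (by positivity) (by positivity) (by positivity)
    (by norm_num) hsub (fun w hw => by
      obtain ⟨k1, k2, k3, k4, k5⟩ := hb w (hsub hw)
      exact ⟨k1, k2, k3, k4, k5.trans (by norm_num)⟩)
  obtain ⟨k1, k2, k3, k4, -⟩ := hγb 1 (by simp)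
  exact ⟨γ, hγ, k1, k2, k3, k4⟩

/-- The conjugation of the averaged Hamiltonian to the full one, and its inverse. -/
theorem exists_conjugation (H : DeformationData S ρ s δ Δ c a M₀ M₁ E ν h ω₀ f₀ f₁) :
    ∃ φ ψ : Phase n → Phase n,
      (DifferentiableOn ℂ φ (startDomain S ρ s δ Δ c) ∧
        DifferentiableOn ℂ ψ (startDomain S ρ s δ Δ c)) ∧
      (∀ z ∈ startDomain S ρ s δ Δ c, ∀ u v,
        sympl (fderiv ℂ φ z u) (fderiv ℂ φ z v) = sympl u v) ∧
      (∀ z ∈ startDomain S ρ s δ Δ c, z ∈ realPoints n →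
        φ z ∈ realPoints n ∧ ψ z ∈ realPoints n) ∧
      (∀ z ∈ startDomain S ρ s δ Δ c, ∀ m, φ (shift m z) = shift m (φ z)) ∧
      InjOn φ (startDomain S ρ s δ Δ c) ∧
      (∀ z ∈ startDomain S ρ s δ Δ c,
        hamFamily h ω₀ f₀ f₁ (φ z, 1) = hamFamily h ω₀ f₀ f₁ (z, 0)) ∧
      (∀ z ∈ startDomain S ρ s δ Δ c, IsNear ν ρ s δ c z (φ z) ∧ IsNear ν ρ s δ c z (ψ z)) ∧
      (∀ z ∈ startDomain S ρ s δ Δ c, ψ z ∈ startDomain S ρ s δ Δ c → φ (ψ z) = z) ∧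
      (∀ z ∈ startDomain S ρ s δ Δ c, φ z ∈ startDomain S ρ s δ Δ c → ψ (φ z) = z) := by
  obtain ⟨F, hF, hPDE, hFb, hFr, hFp⟩ := H.exists_generator
  set G := hamFamily h ω₀ f₀ f₁ with hG
  set D := flowDomain S ρ s δ Δ c with hD
  have hDo : IsOpen D := isOpen_extDomain ..
  have hDg : D ⊆ genDomain S ρ s δ Δ c := fun w hw => Or.inl (H.flowDomain_subset hw)
  have hDp : D ⊆ Prod.fst ⁻¹' phaseDomain S ρ s (Δ + δ) := fun w hw =>
    H.fieldDomain_subset (H.genDomain_subset (hDg hw))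
  have hFD := hF.mono hDg
  have hGD : DifferentiableOn ℂ G D := H.differentiableOn_hamFamily.mono hDp
  set V := hamField F with hVdef
  have hV : DifferentiableOn ℂ V D := differentiableOn_hamField hDo hFD
  have hVn : DifferentiableOn ℂ (fun w => -V w) D := hV.neg
  have hb := fun w hw => H.hamVec_generator_le hF hFb (w := w) hw
  have hex : ∀ w : ExtPhase n, ∃ γ, w ∈ startExt S ρ s δ Δ c →
      IsCurve V D γ w ∧ IsNear ν ρ s δ c w.1 (γ 1).1 := by
    intro w
    by_cases hw : w ∈ startExt S ρ s δ Δ c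
    · obtain ⟨γ, hγ⟩ := H.exists_flow_curve hV (fun w hw => by
        obtain ⟨k1, k2, k3, k4⟩ := hb w hw
        exact ⟨k1, k2, k3, k4, by simp [V, hamField]⟩) hw
      exact ⟨γ, fun _ => hγ⟩
    · exact ⟨fun _ => 0, fun h => absurd h hw⟩
  have hexn : ∀ w : ExtPhase n, ∃ γ, w ∈ startExt S ρ s δ Δ c →
      IsCurve (fun w => -V w) D γ w ∧ IsNear ν ρ s δ c w.1 (γ 1).1 := by
    intro w
    by_cases hw : w ∈ startExt S ρ s δ Δ c
    · obtain ⟨γ, hγ⟩ := H.exists_flow_curve hVn (fun w hw => by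
        obtain ⟨k1, k2, k3, k4⟩ := hb w hw
        refine ⟨?_, ?_, ?_, ?_, ?_⟩
        · exact (norm_neg _).trans_le k1
        · exact (norm_neg _).trans_le k2
        · exact (norm_neg _).trans_le k3
        · exact (norm_neg _).trans_le k4
        · simp [V, hamField]) hw
      exact ⟨γ, fun _ => hγ⟩
    · exact ⟨fun _ => 0, fun h => absurd h hw⟩
  choose Γ hΓ using hex
  choose Λ hΛ using hexn
  have h0 : ∀ {z : Phase n}, z ∈ startDomain S ρ s δ Δ c → (z, (0 : ℂ)) ∈ startExt S ρ s δ Δ c :=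
    fun hz => mem_startExt hz (by simp)
  have h1 : ∀ {z : Phase n}, z ∈ startDomain S ρ s δ Δ c → (z, (1 : ℂ)) ∈ startExt S ρ s δ Δ c :=
    fun hz => mem_startExt hz (by simp)
  -- The parameter has speed `1`, so the flow joins `τ = 0` to `τ = 1`; the reversed flow goes from
  -- `1` back to `0`.
  have hΓ1 : ∀ z ∈ startDomain S ρ s δ Δ c, Γ (z, 0) 1 = ((Γ (z, 0) 1).1, 1) := fun z hz =>
    Prod.ext rfl (by simpa using (hΓ _ (h0 hz)).1.snd_eq (κ := 1) fun _ _ => rfl)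
  have hΛ1 : ∀ z ∈ startDomain S ρ s δ Δ c, Λ (z, 1) 1 = ((Λ (z, 1) 1).1, 0) := fun z hz =>
    Prod.ext rfl (by simpa using (hΛ _ (h1 hz)).1.snd_eq (κ := -1) fun _ _ => rfl)
  have hflow : ∀ z ∈ startDomain S ρ s δ Δ c, ∃ M : ℝ → ExtPhase n →L[ℂ] ExtPhase n, M 0 = 1 ∧
      (∀ t ∈ Icc (0 : ℝ) 1, HasDerivWithinAt M (fderiv ℂ V (Γ (z, 0) t) * M t) (Icc 0 1) t) ∧
      HasFDerivAt (fun z => (Γ (z, 0) 1).1) (ContinuousLinearMap.fst ℂ (Phase n) ℂ ∘L (M 1) ∘L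
        ContinuousLinearMap.inl ℂ (Phase n) ℂ) z := by
    intro z hz
    obtain ⟨M, hM0, hM, hMd⟩ := exists_hasFDerivAt_flow hDo hV (isOpen_extDomain ..)
      (fun w hw => (hΓ w hw).1) (h0 hz)
    exact ⟨M, hM0, hM, (ContinuousLinearMap.fst ℂ (Phase n) ℂ).hasFDerivAt.comp z
      (HasFDerivAt.comp z (g := fun w => Γ w 1) (hMd 1 (by simp))
        (ContinuousLinearMap.inl ℂ (Phase n) ℂ).hasFDerivAt)⟩
  have hVr : ∀ w ∈ D, imProj n w = 0 → imProj n (V w) = 0 := fun w hw hw0 => by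
    have := imProj_hamVec (fun v hv => im_fderiv_apply_eq_zero (isOpen_genDomain ..) hF hFr
      (hDg hw) hw0 hv) 1
    rwa [Complex.ofReal_one] at this
  have hVs : ∀ m : Fin n → ℤ, ∀ w ∈ D, V (w + shiftVec m) = V w := fun m w hw => by
    simp only [V, hamField]
    rw [fderiv_add_of_eventuallyEq (isOpen_genDomain ..) (fun w hw => hFp w hw m) (hDg hw)]
  refine ⟨fun z => (Γ (z, 0) 1).1, fun z => (Λ (z, 1) 1).1,
    ⟨fun z hz => ?_, fun z hz => ?_⟩, fun z hz u v => ?_,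
    fun z hz hr => ⟨?_, ?_⟩, fun z hz m => ?_, fun z hz z' hz' hzz => ?_, fun z hz => ?_,
    fun z hz => ⟨(hΓ _ (h0 hz)).2, (hΛ _ (h1 hz)).2⟩, fun z hz hz' => ?_, fun z hz hz' => ?_⟩
  · obtain ⟨M, -, -, hM⟩ := hflow z hz
    exact hM.differentiableAt.differentiableWithinAt
  · obtain ⟨M, -, -, hMd⟩ := exists_hasFDerivAt_flow hDo hVn (isOpen_extDomain ..)
      (fun w hw => (hΛ w hw).1) (h1 hz)
    have k1 : HasFDerivAt (fun z : Phase n => ((z, 1) : ExtPhase n))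
        (ContinuousLinearMap.inl ℂ (Phase n) ℂ) z :=
      (hasFDerivAt_id z).prodMk (hasFDerivAt_const (1 : ℂ) z)
    exact ((ContinuousLinearMap.fst ℂ (Phase n) ℂ).hasFDerivAt.comp z
      (HasFDerivAt.comp z (g := fun w => Λ w 1) (hMd 1 (by simp)) k1)).differentiableAt
        |>.differentiableWithinAt
  · obtain ⟨M, hM0, hM, hMd⟩ := hflow z hz
    rw [hMd.fderiv]
    exact sympl_linearized_flow hDo hFD (hΓ _ (h0 hz)).1 hM0 hM u v 1 (by simp)
  · have := (hΓ _ (h0 hz)).1.apply_eq_zero hDo hV (imProj n) imProj_imProj hVr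
      (imProj_eq_zero_iff_mem.mpr ⟨hr, by simp⟩) 1 (by simp)
    exact (imProj_eq_zero_iff_mem.mp this).1
  · have := (hΛ _ (h1 hz)).1.apply_eq_zero hDo hVn (imProj n) imProj_imProj
      (fun w hw hw0 => by rw [map_neg, hVr w hw hw0, neg_zero])
      (imProj_eq_zero_iff_mem.mpr ⟨hr, by simp⟩) 1 (by simp)
    exact (imProj_eq_zero_iff_mem.mp this).1
  · have k1 := (hΓ _ (h0 hz)).1.add_const (v := shiftVec m)
      (fun w hw => add_shiftVec_mem_extDomain hw m) (hVs m)
    have k2 : ((z, 0) : ExtPhase n) + shiftVec m = (shift m z, 0) :=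
      Prod.ext (fst_add_shiftVec _ m) (snd_add_shiftVec _ m)
    rw [k2] at k1
    have k3 := (hΓ _ (h0 (shift_mem_startDomain hz m))).1.unique hDo hV k1 1 (by simp)
    change (Γ (shift m z, 0) 1).1 = shift m (Γ (z, 0) 1).1
    rw [← k3, fst_add_shiftVec]
  -- Injectivity: two curves with the same endpoint agree after time reversal, by uniqueness for
  -- `-V`.
  · have k1 := (hΓ _ (h0 hz)).1.reverse
    have k2 := (hΓ _ (h0 hz')).1.reverse
    have k3 : Γ (z, 0) 1 = Γ (z', 0) 1 := by
      rw [hΓ1 z hz, hΓ1 z' hz']; exact congrArg (fun z => (z, (1 : ℂ))) hzz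
    rw [← k3] at k2
    have k4 := k1.unique hDo hVn k2 1 (by simp)
    simp only [sub_self] at k4
    rw [(hΓ _ (h0 hz)).1.start, (hΓ _ (h0 hz')).1.start] at k4
    exact (congrArg Prod.fst k4).symm
  · have k1 := energy_const hDo hGD (fun w hw => by
      rw [hPDE w (hDg hw), H.fderiv_hamFamily_param (hDp hw)]) (hΓ _ (h0 hz)).1
    rw [hΓ1 z hz] at k1
    exact k1
  · have k1 := (hΛ _ (h1 hz)).1.reverse
    simp only [neg_neg] at k1
    rw [hΛ1 z hz] at k1
    have k2 := (hΓ _ (h0 hz')).1.unique hDo hV k1 1 (by simp)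
    simp only [sub_self] at k2
    rw [(hΛ _ (h1 hz)).1.start] at k2
    exact (congrArg Prod.fst k2).symm
  · have k1 := (hΓ _ (h0 hz)).1.reverse
    rw [hΓ1 z hz] at k1
    have k2 := (hΛ _ (h1 hz')).1.unique hDo hVn k1 1 (by simp)
    simp only [sub_self] at k2
    rw [(hΓ _ (h0 hz)).1.start] at k2
    exact (congrArg Prod.fst k2).symm

end DeformationData
end Conjugation

/-! ### Convergence of multiple Fourier series on the real torus. -/

section FourierSeries

open scoped Pointwise

variable {n : ℕ}

theorem ae_eq_Icc_pi : ({x : Fin n → ℝ | ∀ i, x i ∈ Ioc (0 : ℝ) (0 + 1)} : Set (Fin n → ℝ))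
    =ᵐ[volume] Icc (0 : Fin n → ℝ) 1 := by
  have h1 : {x : Fin n → ℝ | ∀ i, x i ∈ Ioc (0 : ℝ) (0 + 1)} =
      univ.pi fun i => Ioc ((0 : Fin n → ℝ) i) ((1 : Fin n → ℝ) i) := by
    ext x; simp
  rw [h1]
  exact Measure.univ_pi_Ioc_ae_eq_Icc

theorem smul_Icc_pi {R : ℝ} (hR : 0 < R) :
    R • Icc (0 : Fin n → ℝ) 1 = Icc (0 : Fin n → ℝ) fun _ => R := by
  ext x
  rw [mem_smul_set_iff_inv_smul_mem₀ hR.ne', mem_Icc, mem_Icc, Pi.le_def, Pi.le_def, Pi.le_def,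
    Pi.le_def]
  simp only [Pi.smul_apply, smul_eq_mul, Pi.zero_apply, Pi.one_apply]
  refine and_congr (forall_congr' fun i => ?_) (forall_congr' fun i => ?_)
  · exact mul_nonneg_iff_of_pos_left (by positivity)
  · rw [inv_mul_le_iff₀ hR, mul_one]

theorem mFourier_coe_apply (k : Fin n → ℤ) (t : Fin n → ℝ) :
    UnitAddTorus.mFourier k (fun i => (t i : UnitAddCircle)) =
      Complex.exp (Complex.I * ∑ i, (k i : ℂ) * ((2 * Real.pi * t i : ℝ) : ℂ)) := by
  simp only [UnitAddTorus.mFourier, ContinuousMap.coe_mk, fourier_coe_apply]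
  rw [← Complex.exp_sum, Finset.mul_sum]
  congr 1
  refine Finset.sum_congr rfl fun i _ => ?_
  push_cast
  ring

/-- Pointwise convergence of Fourier series with summable coefficients. -/
theorem hasSum_fourier_of_summable {g : (Fin n → ℝ) → ℂ} (hg : Continuous g)
    (hper : ∀ (θ : Fin n → ℝ) (m : Fin n → ℤ), g (fun i => θ i + 2 * Real.pi * m i) = g θ)
    {C : (Fin n → ℤ) → ℂ}
    (hC : ∀ k, C k = ((2 * Real.pi : ℝ) : ℂ)⁻¹ ^ n *
      ∫ θ in Icc (0 : Fin n → ℝ) (fun _ => 2 * Real.pi),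
        g θ * Complex.exp (-Complex.I * ∑ i, (k i : ℂ) * (θ i : ℂ)))
    (hs : Summable C) (θ : Fin n → ℝ) :
    HasSum (fun k => C k * Complex.exp (Complex.I * ∑ i, (k i : ℂ) * (θ i : ℂ))) (g θ) := by
  have hπ : 0 < 2 * Real.pi := Real.two_pi_pos
  have hsurj : Function.Surjective ((↑) : ℝ → UnitAddCircle) := QuotientAddGroup.mk_surjective
  -- An arbitrary set-theoretic lift to `ℝ` suffices: periodicity makes the descended function
  -- independent of it, and continuity is tested on the quotient map.
  let r : UnitAddCircle → ℝ := Function.surjInv hsurj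
  have hr : ∀ x, ((r x : ℝ) : UnitAddCircle) = x := Function.surjInv_eq hsurj
  let G : UnitAddTorus (Fin n) → ℂ := fun x => g fun i => 2 * Real.pi * r (x i)
  have hG : ∀ t : Fin n → ℝ, G (fun i => (t i : UnitAddCircle)) = g fun i => 2 * Real.pi * t i := by
    intro t
    have h1 : ∀ i, ∃ m : ℤ, r (t i : UnitAddCircle) = t i + m := by
      intro i
      have h2 : ((r (t i : UnitAddCircle) - t i : ℝ) : UnitAddCircle) = 0 := by
        rw [AddCircle.coe_sub, hr, sub_self]
      obtain ⟨m, hm⟩ := (AddCircle.coe_eq_zero_iff (1 : ℝ)).mp h2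
      refine ⟨m, ?_⟩
      simp at hm
      linarith
    choose m hm using h1
    refine (congrArg g (funext fun i => ?_)).trans (hper (fun i => 2 * Real.pi * t i) m)
    simp only [hm i]
    ring
  have hGc : Continuous G := by
    have hq : IsOpenQuotientMap (Pi.map fun (_ : Fin n) (t : ℝ) => (t : UnitAddCircle)) :=
      IsOpenQuotientMap.piMap fun _ => QuotientAddGroup.isOpenQuotientMap_mk
    rw [← hq.continuous_comp_iff]
    have h1 : G ∘ (Pi.map fun (_ : Fin n) (t : ℝ) => (t : UnitAddCircle)) =
        fun t => g fun i => 2 * Real.pi * t i := funext hG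
    rw [h1]
    exact hg.comp (by fun_prop)
  have hcoef : ∀ k, UnitAddTorus.mFourierCoeff G k = C k := by
    intro k
    rw [UnitAddTorus.mFourierCoeff_eq_integral G k 0, hC]
    simp only [Pi.zero_apply]
    rw [setIntegral_congr_set ae_eq_Icc_pi]
    let u : (Fin n → ℝ) → ℂ := fun θ =>
      g θ * Complex.exp (-Complex.I * ∑ i, (k i : ℂ) * (θ i : ℂ))
    have h1 : ∀ t : Fin n → ℝ, UnitAddTorus.mFourier (-k) (fun i => (t i : UnitAddCircle)) •
        G (fun i => (t i : UnitAddCircle)) = u ((2 * Real.pi) • t) := by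
      intro t
      simp only [u]
      rw [hG, mFourier_coe_apply, smul_eq_mul, mul_comm]
      congr 2
      simp only [Pi.neg_apply, Int.cast_neg, neg_mul, Finset.sum_neg_distrib, mul_neg,
        Pi.smul_apply, smul_eq_mul]
    refine (integral_congr_ae (.of_forall h1)).trans ?_
    rw [Measure.setIntegral_comp_smul_of_pos volume u _ hπ, smul_Icc_pi hπ, Module.finrank_pi,
      Fintype.card_fin, Complex.real_smul]
    push_cast
    rw [inv_pow]
  let Gc : C(UnitAddTorus (Fin n), ℂ) := ⟨G, hGc⟩
  have hs' : Summable (UnitAddTorus.mFourierCoeff Gc) := by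
    have : UnitAddTorus.mFourierCoeff Gc = C := funext hcoef
    rwa [this]
  have h2 := UnitAddTorus.hasSum_mFourier_series_apply_of_summable hs'
    (fun i => ((θ i / (2 * Real.pi) : ℝ) : UnitAddCircle))
  have h3 : ∀ i, 2 * Real.pi * (θ i / (2 * Real.pi)) = θ i := fun i => by field_simp
  have h4 : Gc (fun i => ((θ i / (2 * Real.pi) : ℝ) : UnitAddCircle)) = g θ := by
    change G _ = _
    rw [hG]
    simp only [h3]
  rw [h4] at h2
  have h5 : ∀ k, UnitAddTorus.mFourierCoeff Gc k •
      UnitAddTorus.mFourier k (fun i => ((θ i / (2 * Real.pi) : ℝ) : UnitAddCircle)) =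
      C k * Complex.exp (Complex.I * ∑ i, (k i : ℂ) * (θ i : ℂ)) := fun k => by
    rw [mFourier_coe_apply, smul_eq_mul]
    simp only [h3]
    congr 1
    exact hcoef k
  simpa only [h5] using h2

end FourierSeries

/-! ### Sup bounds from the weighted Fourier norm, and holomorphy of the average. -/

section Average

variable {n : ℕ} {S : Set (EuclideanSpace ℝ (Fin n))} {r s R E : ℝ} {f : Phase n → ℂ}

theorem continuous_ofRealVec : Continuous (ofRealVec : (Fin n → ℝ) → CVec n) := by
  unfold ofRealVec
  refine (PiLp.continuous_toLp 2 _).comp ?_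
  fun_prop

theorem im_ofRealVec (θ : Fin n → ℝ) (i : Fin n) : (ofRealVec θ i).im = 0 := by
  simp [ofRealVec]

theorem mem_hamDomain_real (hs : 0 < s) {I : CVec n} (hI : I ∈ actionNhd S r) {q : ℂ × ℂ}
    (hq : q ∈ ballTwo R) (θ : Fin n → ℝ) : (I, ofRealVec θ, q) ∈ hamDomain S r s R :=
  ⟨hI, fun i => by change |(ofRealVec θ i).im| ≤ s; rw [im_ofRealVec, abs_zero]; exact hs.le, hq⟩

theorem phaseDomain_subset_hamDomain : phaseDomain S r s R ⊆ hamDomain S r s R :=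
  fun _ hz => ⟨hz.1, fun i => (hz.2.1 i).le, hz.2.2⟩

theorem norm_exp_le (k : Fin n → ℤ) {φ : CVec n} (hφ : ∀ i, |(φ i).im| < s) :
    ‖Complex.exp (Complex.I * ∑ i, (k i : ℂ) * φ i)‖ ≤ Real.exp (s * ∑ i, |(k i : ℝ)|) := by
  rw [Complex.norm_exp, Real.exp_le_exp]
  have h1 : (Complex.I * ∑ i, (k i : ℂ) * φ i).re = -∑ i, (k i : ℝ) * (φ i).im := by
    simp [Complex.im_sum]
  rw [h1, Finset.mul_sum, ← Finset.sum_neg_distrib]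
  refine Finset.sum_le_sum fun i _ => ?_
  have h2 : |(k i : ℝ) * (φ i).im| ≤ s * |(k i : ℝ)| := by
    rw [abs_mul, mul_comm]; gcongr; exact (hφ i).le
  exact (neg_le_abs _).trans h2

/-- The Fourier series converges in the complex strip. -/
theorem hasSum_fourier_strip (hs : 0 < s) (hf : AnalyticOnNhd ℂ f (hamDomain S r s R))
    (hper : PeriodicOn f (hamDomain S r s R)) {I : CVec n} (hI : I ∈ actionNhd S r) {q : ℂ × ℂ}
    (hq : q ∈ ballTwo R)
    (hsum : Summable fun k : Fin n → ℤ =>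
      ‖fourierCoef f k I q‖ * Real.exp (s * ∑ i, |(k i : ℝ)|))
    {φ : CVec n} (hφ : ∀ i, |(φ i).im| < s) :
    HasSum (fun k => fourierCoef f k I q * Complex.exp (Complex.I * ∑ i, (k i : ℂ) * φ i))
      (f (I, φ, q)) := by
  set C : (Fin n → ℤ) → ℂ := fun k => fourierCoef f k I q with hC
  have hCs : Summable C := by
    refine .of_norm (.of_nonneg_of_le (fun _ => norm_nonneg _) (fun k => ?_) hsum)
    refine le_mul_of_one_le_right (norm_nonneg _) (Real.one_le_exp ?_)
    exact mul_nonneg hs.le (Finset.sum_nonneg fun _ _ => abs_nonneg _)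
  have hterm : ∀ (φ : CVec n), (∀ i, |(φ i).im| < s) → ∀ k,
      ‖C k * Complex.exp (Complex.I * ∑ i, (k i : ℂ) * φ i)‖ ≤
        ‖C k‖ * Real.exp (s * ∑ i, |(k i : ℝ)|) := fun φ hφ k => by
    rw [norm_mul]; gcongr; exact norm_exp_le k hφ
  have hreal : ∀ θ : Fin n → ℝ, HasSum
      (fun k => C k * Complex.exp (Complex.I * ∑ i, (k i : ℂ) * (θ i : ℂ)))
      (f (I, ofRealVec θ, q)) := by
    refine hasSum_fourier_of_summable (g := fun θ => f (I, ofRealVec θ, q)) ?_ ?_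
      (fun _ => rfl) hCs
    · rw [continuous_iff_continuousAt]
      intro θ
      have h1 := (hf _ (mem_hamDomain_real hs hI hq θ)).continuousAt
      have h2 : Continuous fun θ : Fin n → ℝ => ((I, ofRealVec θ, q) : Phase n) :=
        continuous_const.prodMk (continuous_ofRealVec.prodMk continuous_const)
      exact ContinuousAt.comp (f := fun θ : Fin n → ℝ => ((I, ofRealVec θ, q) : Phase n)) h1
        h2.continuousAt
    · intro θ m
      have h1 := hper _ (mem_hamDomain_real hs hI hq θ) m
      rw [← h1]
      congr 1
      simp only [shift, Prod.mk.injEq, and_true, true_and]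
      ext i
      simp [ofRealVec]
  let θ : Fin n → ℝ := fun i => (φ i).re
  let η : Fin n → ℝ := fun i => (φ i).im
  -- The point `φ = θ + i η` is reached along the complex line `ζ ↦ θ + ζ η`, at `ζ = i`. The part
  -- of this line inside the strip is convex, and both `f` and its Fourier series are holomorphic in
  -- `ζ` there. They agree for real `ζ`, hence everywhere.
  let U : Set ℂ := {ζ | ∀ i, |ζ.im * η i| < s}
  have hU : IsOpen U := by
    simp only [U, ofPred_forall]
    exact isOpen_iInter_of_finite fun i => isOpen_lt (by fun_prop) continuous_const
  have hUc : Convex ℝ U := by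
    intro x hx y hy a b ha hb hab i
    have h1 : (a • x + b • y).im * η i = a * (x.im * η i) + b * (y.im * η i) := by
      simp; ring
    rw [h1]
    refine (abs_add_le _ _).trans_lt ?_
    rw [abs_mul a, abs_mul b, abs_of_nonneg ha, abs_of_nonneg hb]
    have h2 := hx i
    have h3 := hy i
    rcases eq_or_lt_of_le ha with h0 | h0
    · rw [← h0] at hab ⊢
      have : b = 1 := by linarith
      rw [this]; linarith
    · nlinarith
  let Φ : ℂ → CVec n := fun ζ => ofRealVec θ + ζ • ofRealVec η
  have hΦi : ∀ ζ i, Φ ζ i = θ i + ζ * η i := fun ζ i => by simp [Φ, ofRealVec]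
  have hΦ : ∀ ζ ∈ U, ∀ i, |(Φ ζ i).im| < s := fun ζ hζ i => by
    rw [hΦi]; simpa using hζ i
  have hu : DifferentiableOn ℂ (fun ζ => f (I, Φ ζ, q)) U := by
    intro ζ hζ
    have h1 := (hf (I, Φ ζ, q) ⟨hI, fun i => (hΦ ζ hζ i).le, hq⟩).differentiableAt
    have h2 : Differentiable ℂ fun ζ : ℂ => ((I, Φ ζ, q) : Phase n) :=
      (differentiable_const _).prodMk (((differentiable_const _).add
        (differentiable_id.smul_const _)).prodMk (differentiable_const _))
    exact (DifferentiableAt.comp ζ (f := fun ζ : ℂ => ((I, Φ ζ, q) : Phase n)) h1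
      (h2 ζ)).differentiableWithinAt
  have hv : DifferentiableOn ℂ (fun ζ => ∑' k : Fin n → ℤ,
      C k * Complex.exp (Complex.I * ∑ i, (k i : ℂ) * Φ ζ i)) U := by
    refine Complex.differentiableOn_tsum_of_summable_norm hsum (fun k => ?_) hU
      fun k ζ hζ => hterm _ (hΦ ζ hζ) k
    simp only [hΦi]
    fun_prop
  have hEq := (hu.analyticOnNhd hU).eqOn_of_preconnected_of_frequently_eq
    (hv.analyticOnNhd hU) hUc.isPreconnected (z₀ := 0) (fun i => by simpa using hs) (by
      have h1 : Filter.Tendsto (fun t : ℝ => (t : ℂ)) (nhdsWithin 0 {0}ᶜ)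
          (nhdsWithin 0 {0}ᶜ) := by
        refine tendsto_nhdsWithin_iff.mpr ⟨?_, ?_⟩
        · exact (Complex.continuous_ofReal.tendsto' 0 0 (by simp)).mono_left nhdsWithin_le_nhds
        · filter_upwards [self_mem_nhdsWithin] with t ht
          simpa using ht
      refine h1.frequently (Filter.Eventually.of_forall fun t => ?_).frequently
      have h2 : Φ (t : ℂ) = ofRealVec fun i => θ i + t * η i := by
        ext i; rw [hΦi]; simp [ofRealVec]
      have h3 := (hreal fun i => θ i + t * η i).tsum_eq
      simp only [h2]
      rw [← h3]
      rfl)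
  have hIU : Complex.I ∈ U := fun i => by simpa using hφ i
  have hΦI : Φ Complex.I = φ := by
    ext i
    rw [hΦi, mul_comm]
    exact Complex.re_add_im _
  have h4 := hEq hIU
  simp only [hΦI] at h4
  rw [h4]
  exact (Summable.of_norm (.of_nonneg_of_le (fun _ => norm_nonneg _) (hterm φ hφ) hsum)).hasSum

theorem sum_norm_fourierCoef_le (hE : 0 ≤ E)
    (hn : wnorm (actionNhd S r) s (ballTwo R) f = ENNReal.ofReal E) {I : CVec n}
    (hI : I ∈ actionNhd S r) {q : ℂ × ℂ} (hq : q ∈ ballTwo R) (F : Finset (Fin n → ℤ)) :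
    ∑ k ∈ F, ‖fourierCoef f k I q‖ * Real.exp (s * ∑ i, |(k i : ℝ)|) ≤ E := by
  rw [← ENNReal.ofReal_le_ofReal_iff hE, ENNReal.ofReal_sum_of_nonneg (fun k _ => by positivity),
    ← hn]
  refine le_trans (Finset.sum_le_sum fun k _ => ?_) (ENNReal.sum_le_tsum F)
  rw [ENNReal.ofReal_mul (norm_nonneg _), ofReal_norm]
  gcongr
  exact le_iSup₂_of_le I hI (le_iSup₂_of_le q hq le_rfl)

theorem norm_average_le (hE : 0 ≤ E)
    (hn : wnorm (actionNhd S r) s (ballTwo R) f = ENNReal.ofReal E) {I : CVec n}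
    (hI : I ∈ actionNhd S r) {q : ℂ × ℂ} (hq : q ∈ ballTwo R) : ‖average f I q‖ ≤ E := by
  simpa [average] using sum_norm_fourierCoef_le hE hn hI hq {0}

/-- In the strip the modes grow by at most `e^{s|k|}`, which is the weight in the norm. Deleting the
zeroth term of the series leaves a sum still bounded by `E`, with no factor `2`. -/
theorem norm_sub_average_le (hs : 0 < s) (hf : AnalyticOnNhd ℂ f (hamDomain S r s R))
    (hper : PeriodicOn f (hamDomain S r s R)) (hE : 0 ≤ E)
    (hn : wnorm (actionNhd S r) s (ballTwo R) f = ENNReal.ofReal E) {z : Phase n}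
    (hz : z ∈ phaseDomain S r s R) : ‖f z - average f z.1 z.2.2‖ ≤ E := by
  obtain ⟨hI, hφ, hq⟩ := hz
  have hb := sum_norm_fourierCoef_le hE hn hI hq
  have hsum := summable_of_sum_le (fun k => by positivity) hb
  have h1 := hasSum_ite_sub_hasSum (hasSum_fourier_strip hs hf hper hI hq hsum hφ) 0
  have h2 : fourierCoef f 0 z.1 z.2.2 *
      Complex.exp (Complex.I * ∑ i, (((0 : Fin n → ℤ) i : ℤ) : ℂ) * z.2.1 i) =
      average f z.1 z.2.2 := by simp [average]
  rw [h2] at h1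
  change ‖f (z.1, z.2.1, z.2.2) - _‖ ≤ E
  rw [← h1.tsum_eq]
  refine (tsum_of_norm_bounded hsum.hasSum fun k => ?_).trans (hsum.tsum_le_of_sum_le hb)
  split_ifs
  · rw [norm_zero]; positivity
  · rw [norm_mul]; gcongr; exact norm_exp_le k hφ

theorem isOpen_ballTwo (R : ℝ) : IsOpen (ballTwo R) :=
  isOpen_lt (f := fun q : ℂ × ℂ => ‖q.1‖ ^ 2 + ‖q.2‖ ^ 2) (by fun_prop) continuous_const

/-- The average is holomorphic. -/
theorem differentiableOn_average (hs : 0 < s) (hf : AnalyticOnNhd ℂ f (hamDomain S r s R)) :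
    DifferentiableOn ℂ (fun w : CVec n × ℂ × ℂ => average f w.1 w.2)
      (actionNhd S r ×ˢ ballTwo R) := by
  have hW : IsOpen (actionNhd S r ×ˢ ballTwo R) := isOpen_thickening.prod (isOpen_ballTwo R)
  intro w₀ hw₀
  let P : CVec n × ℂ × ℂ → (Fin n → ℝ) → Phase n := fun w θ => (w.1, ofRealVec θ, w.2)
  let L : (CVec n × ℂ × ℂ) →L[ℂ] Phase n :=
    (ContinuousLinearMap.fst ℂ (CVec n) (ℂ × ℂ)).prod
      ((0 : (CVec n × ℂ × ℂ) →L[ℂ] CVec n).prod (ContinuousLinearMap.snd ℂ (CVec n) (ℂ × ℂ)))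
  have hP : ∀ w ∈ actionNhd S r ×ˢ ballTwo R, ∀ θ, P w θ ∈ hamDomain S r s R :=
    fun w hw θ => mem_hamDomain_real hs hw.1 hw.2 θ
  have hPc : Continuous fun p : (CVec n × ℂ × ℂ) × (Fin n → ℝ) => P p.1 p.2 :=
    (continuous_fst.comp continuous_fst).prodMk ((continuous_ofRealVec.comp continuous_snd).prodMk
      (continuous_snd.comp continuous_fst))
  have hPd : ∀ w θ, HasFDerivAt (fun w => P w θ) L w := fun w θ =>
    hasFDerivAt_fst.prodMk ((hasFDerivAt_const _ _).prodMk hasFDerivAt_snd)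
  obtain ⟨ε, hε, hball⟩ := nhds_basis_closedBall.mem_iff.mp (hW.mem_nhds hw₀)
  let K : Set (Fin n → ℝ) := Icc 0 fun _ => 2 * Real.pi
  have hK : IsCompact K := isCompact_Icc
  have hKm : MeasurableSet K := measurableSet_Icc
  have hcomp : IsCompact (closedBall w₀ ε ×ˢ K) := (isCompact_closedBall _ _).prod hK
  have hfc : ∀ w ∈ actionNhd S r ×ˢ ballTwo R, Continuous fun θ => f (P w θ) := by
    intro w hw
    rw [continuous_iff_continuousAt]
    intro θ
    exact ContinuousAt.comp (f := fun θ => P w θ) (hf _ (hP w hw θ)).continuousAt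
      (hPc.comp (Continuous.prodMk_right w)).continuousAt
  have hF'c : ContinuousOn (fun p : (CVec n × ℂ × ℂ) × (Fin n → ℝ) =>
      fderiv ℂ f (P p.1 p.2) ∘L L) (closedBall w₀ ε ×ˢ K) := by
    intro p hp
    have h1 : ContinuousAt (fderiv ℂ f) (P p.1 p.2) :=
      (hf _ (hP _ (hball hp.1) _)).fderiv.continuousAt
    have h2 : ContinuousAt (fun p : (CVec n × ℂ × ℂ) × (Fin n → ℝ) => fderiv ℂ f (P p.1 p.2)) p :=
      ContinuousAt.comp (f := fun p : (CVec n × ℂ × ℂ) × (Fin n → ℝ) => P p.1 p.2) h1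
        hPc.continuousAt
    exact (h2.clm_comp continuousAt_const).continuousWithinAt
  obtain ⟨M, hM⟩ := hcomp.exists_bound_of_continuousOn hF'c
  have hmul : ∀ w θ, f (P w θ) * Complex.exp (-Complex.I * ∑ i, (((0 : Fin n → ℤ) i : ℤ) : ℂ) *
      (θ i : ℂ)) = f (P w θ) := fun w θ => by simp
  have hint : HasFDerivAt (fun w => ∫ θ in K, f (P w θ))
      (∫ θ in K, fderiv ℂ f (P w₀ θ) ∘L L) w₀ := by
    refine hasFDerivAt_integral_of_dominated_of_fderiv_le (μ := volume.restrict K)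
      (F' := fun w θ => fderiv ℂ f (P w θ) ∘L L) (bound := fun _ => M)
      (closedBall_mem_nhds w₀ hε) ?_ ?_ ?_ ?_ ?_ ?_
    · filter_upwards [hW.mem_nhds hw₀] with w hw
      exact (hfc w hw).aestronglyMeasurable
    · exact (hfc w₀ hw₀).continuousOn.integrableOn_compact hK
    · refine ContinuousOn.aestronglyMeasurable ?_ hKm
      exact hF'c.comp (Continuous.prodMk_right w₀).continuousOn
        fun θ hθ => ⟨mem_closedBall_self hε.le, hθ⟩
    · exact (ae_restrict_iff' hKm).mpr (.of_forall fun θ hθ w hw => hM (w, θ) ⟨hw, hθ⟩)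
    · exact integrableOn_const (hK.measure_lt_top.ne)
    · refine .of_forall fun θ w hw => ?_
      exact HasFDerivAt.comp (f := fun w => P w θ) w
        (hf _ (hP w (hball hw) θ)).differentiableAt.hasFDerivAt (hPd w θ)
  have h1 : (fun w : CVec n × ℂ × ℂ => average f w.1 w.2) =
      fun w => ((2 * Real.pi : ℝ) : ℂ)⁻¹ ^ n * ∫ θ in K, f (P w θ) := by
    funext w
    simp only [average, fourierCoef]
    congr 1
    exact integral_congr_ae (.of_forall fun θ => hmul w θ)
  rw [h1]
  exact (hint.differentiableAt.const_mul _).differentiableWithinAt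

theorem im_average_eq_zero (hs : 0 < s)
    (hr : ∀ z ∈ hamDomain S r s R ∩ realPoints n, (f z).im = 0) {I : CVec n}
    (hI : I ∈ actionNhd S r) {q : ℂ × ℂ} (hq : q ∈ ballTwo R) (hI0 : ∀ i, (I i).im = 0)
    (hq0 : q.1.im = 0 ∧ q.2.im = 0) : (average f I q).im = 0 := by
  have h1 : ∀ θ : Fin n → ℝ, f (I, ofRealVec θ, q) * Complex.exp (-Complex.I * ∑ i,
      (((0 : Fin n → ℤ) i : ℤ) : ℂ) * (θ i : ℂ)) = ((f (I, ofRealVec θ, q)).re : ℂ) := by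
    intro θ
    have h2 := hr (I, ofRealVec θ, q) ⟨mem_hamDomain_real hs hI hq θ,
      mem_realPoints_iff.mpr ⟨hI0, im_ofRealVec θ, hq0⟩⟩
    have h3 : f (I, ofRealVec θ, q) = ((f (I, ofRealVec θ, q)).re : ℂ) := by
      apply Complex.ext <;> simp [h2]
    simpa using h3
  have h2 : ∫ θ in Icc (0 : Fin n → ℝ) (fun _ => 2 * Real.pi),
      ((f (I, ofRealVec θ, q)).re : ℂ) =
      ((∫ θ in Icc (0 : Fin n → ℝ) (fun _ => 2 * Real.pi), (f (I, ofRealVec θ, q)).re : ℝ) : ℂ) :=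
    integral_ofReal
  simp only [average, fourierCoef, h1]
  rw [h2, ← Complex.ofReal_inv, ← Complex.ofReal_pow, ← Complex.ofReal_mul,
    Complex.ofReal_im]

end Average

/-! ### Rotations of the `(y, x)`-plane and their invariants. -/

section Rotation

variable {n : ℕ}

/-- The rotation of the `(y, x)`-plane acting on phase space. -/
def rotPhase (n : ℕ) (θ : ℝ) : Phase n →L[ℂ] Phase n :=
  (ContinuousLinearMap.id ℂ (CVec n)).prodMap ((ContinuousLinearMap.id ℂ (CVec n)).prodMap
    (((Real.cos θ : ℂ) • ContinuousLinearMap.fst ℂ ℂ ℂ -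
      (Real.sin θ : ℂ) • ContinuousLinearMap.snd ℂ ℂ ℂ).prod
      ((Real.sin θ : ℂ) • ContinuousLinearMap.fst ℂ ℂ ℂ +
      (Real.cos θ : ℂ) • ContinuousLinearMap.snd ℂ ℂ ℂ)))

theorem rotPhase_apply (θ : ℝ) (z : Phase n) :
    rotPhase n θ z = (z.1, z.2.1, rot θ z.2.2) := rfl

theorem cos_sq_add_sin_sq (θ : ℝ) : (Real.cos θ : ℂ) ^ 2 + (Real.sin θ : ℂ) ^ 2 = 1 := by
  exact_mod_cast Real.cos_sq_add_sin_sq θ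

theorem rot_neg_rot (θ : ℝ) (q : ℂ × ℂ) : rot (-θ) (rot θ q) = q := by
  have h := cos_sq_add_sin_sq θ
  refine Prod.ext ?_ ?_
  · simp only [rot, Real.cos_neg, Real.sin_neg, Complex.ofReal_neg]
    linear_combination q.1 * h
  · simp only [rot, Real.cos_neg, Real.sin_neg, Complex.ofReal_neg]
    linear_combination q.2 * h

theorem rot_rot_neg (θ : ℝ) (q : ℂ × ℂ) : rot θ (rot (-θ) q) = q := by
  simpa using rot_neg_rot (-θ) q

theorem rotPhase_neg_rotPhase (θ : ℝ) (z : Phase n) :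
    rotPhase n (-θ) (rotPhase n θ z) = z := by
  simp only [rotPhase_apply, rot_neg_rot]

theorem rotPhase_rotPhase_neg (θ : ℝ) (z : Phase n) :
    rotPhase n θ (rotPhase n (-θ) z) = z := by
  simp only [rotPhase_apply, rot_rot_neg]

theorem rot_sub (θ : ℝ) (q q' : ℂ × ℂ) : rot θ (q - q') = rot θ q - rot θ q' := by
  refine Prod.ext ?_ ?_ <;> simp only [rot, Prod.fst_sub, Prod.snd_sub] <;> ring

theorem rot_sq (θ : ℝ) (q : ℂ × ℂ) :
    (rot θ q).2 ^ 2 + (rot θ q).1 ^ 2 = q.2 ^ 2 + q.1 ^ 2 := by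
  simp only [rot]
  linear_combination (q.1 ^ 2 + q.2 ^ 2) * cos_sq_add_sin_sq θ

theorem rot_norm_sq (θ : ℝ) (q : ℂ × ℂ) :
    ‖(rot θ q).1‖ ^ 2 + ‖(rot θ q).2‖ ^ 2 = ‖q.1‖ ^ 2 + ‖q.2‖ ^ 2 := by
  have h := Real.cos_sq_add_sin_sq θ
  simp only [← Complex.normSq_eq_norm_sq, Complex.normSq_apply, rot, Complex.add_re,
    Complex.sub_re, Complex.add_im, Complex.sub_im, Complex.re_ofReal_mul, Complex.im_ofReal_mul]
  linear_combination (q.1.re ^ 2 + q.1.im ^ 2 + q.2.re ^ 2 + q.2.im ^ 2) * h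

theorem rot_mem_ballTwo {R : ℝ} (θ : ℝ) {q : ℂ × ℂ} (hq : q ∈ ballTwo R) :
    rot θ q ∈ ballTwo R := by
  change ‖(rot θ q).1‖ ^ 2 + ‖(rot θ q).2‖ ^ 2 < R ^ 2
  rw [rot_norm_sq]
  exact hq

theorem rotPhase_mem_realPoints (θ : ℝ) {z : Phase n} (hz : z ∈ realPoints n) :
    rotPhase n θ z ∈ realPoints n := by
  rw [mem_realPoints_iff] at *
  obtain ⟨h1, h2, h3, h4⟩ := hz
  refine ⟨h1, h2, ?_, ?_⟩ <;> simp only [rotPhase_apply, rot, Complex.add_im, Complex.sub_im,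
    Complex.im_ofReal_mul, h3, h4] <;> ring

theorem rotPhase_shift (θ : ℝ) (m : Fin n → ℤ) (z : Phase n) :
    rotPhase n θ (shift m z) = shift m (rotPhase n θ z) := rfl

theorem sympl_rotPhase (θ : ℝ) (u v : Phase n) :
    sympl (rotPhase n θ u) (rotPhase n θ v) = sympl u v := by
  simp only [sympl, rotPhase_apply, rot]
  congr 1
  linear_combination (u.2.2.1 * v.2.2.2 - v.2.2.1 * u.2.2.2) * cos_sq_add_sin_sq θ

theorem rotPhase_mem_phaseDomain {S : Set (EuclideanSpace ℝ (Fin n))} {r s R : ℝ} (θ : ℝ)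
    {z : Phase n} (hz : z ∈ phaseDomain S r s R) : rotPhase n θ z ∈ phaseDomain S r s R :=
  ⟨hz.1, hz.2.1, rot_mem_ballTwo θ hz.2.2⟩

theorem rotPhase_mem_boxNhd {S : Set (EuclideanSpace ℝ (Fin n))} {δ Δ c θ r s d e : ℝ}
    {z : Phase n} (h1 : z.1 ∈ actionNhd S r) (h2 : z.2.1 ∈ strip n s)
    (h3 : z.2.2.1 ∈ lineNhd (longSide δ Δ) d) (h4 : z.2.2.2 ∈ lineNhd (shortSide c) e) :
    rotPhase n θ z ∈ boxNhd S δ Δ c θ r s d e :=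
  ⟨h1, h2, z.2.2, ⟨h3, h4⟩, rfl⟩

theorem rotPhase_neg_of_mem_boxNhd {S : Set (EuclideanSpace ℝ (Fin n))} {δ Δ c θ r s d e : ℝ}
    {z : Phase n} (hz : z ∈ boxNhd S δ Δ c θ r s d e) :
    (rotPhase n (-θ) z).1 ∈ actionNhd S r ∧ (rotPhase n (-θ) z).2.1 ∈ strip n s ∧
    (rotPhase n (-θ) z).2.2.1 ∈ lineNhd (longSide δ Δ) d ∧
    (rotPhase n (-θ) z).2.2.2 ∈ lineNhd (shortSide c) e := by
  obtain ⟨h1, h2, q, ⟨h3, h4⟩, h5⟩ := hz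
  refine ⟨h1, h2, ?_⟩
  simp only [rotPhase_apply, ← h5, rot_neg_rot]
  exact ⟨h3, h4⟩

theorem norm_lt_of_mem_lineNhd_shortSide {c e : ℝ} {x : ℂ} (hx : x ∈ lineNhd (shortSide c) e) :
    ‖x‖ < c / 2 + e := by
  rw [lineNhd, mem_thickening_iff] at hx
  obtain ⟨_, ⟨t, ht, rfl⟩, hxt⟩ := hx
  have ht : |t| < c / 2 := ht
  rw [dist_eq_norm] at hxt
  have h1 := norm_sub_norm_le x (t : ℂ)
  have h3 : ‖(t : ℂ)‖ = |t| := by simp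
  linarith

theorem fourierCoef_zero (k : Fin n → ℤ) (I : CVec n) (q : ℂ × ℂ) :
    fourierCoef (fun _ : Phase n => 0) k I q = 0 := by
  simp [fourierCoef]

theorem wnorm_zero (A : Set (CVec n)) (s : ℝ) (Q : Set (ℂ × ℂ)) :
    wnorm A s Q (fun _ : Phase n => 0) = 0 := by
  simp [wnorm, fourierCoef_zero]

end Rotation

/-! ### The canonical chart over one rotated rectangle. -/

section Chart

variable {n : ℕ} {S : Set (EuclideanSpace ℝ (Fin n))} {ρ s δ Δ c a M₀ M₁ E ν : ℝ}
  {h ω₀ : CVec n → ℂ} {f₀ f₁ : Phase n → ℂ}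

namespace DeformationData

/-- The constants of `startDomain` slightly exceed `1 / 3`, `1 / 3`, `1 / 6` and `1 / 2 + 1 / 6 = 2
/ 3`; in particular the closed strip enters an open one. -/
theorem mem_startDomain_of_mem_boxNhd
    (H : DeformationData S ρ s δ Δ c a M₀ M₁ E ν h ω₀ f₀ f₁) {θ : ℝ} {z : Phase n}
    (hz : z ∈ boxNhd S δ Δ c θ (ρ / 3) (s / 3) (δ / 6) (c / 6)) :
    rotPhase n (-θ) z ∈ startDomain S ρ s δ Δ c := by
  have hρ := H.ρ_pos; have hs := H.s_pos; have hδ := H.δ_pos; have hc := H.c_pos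
  obtain ⟨h1, h2, h3, h4⟩ := rotPhase_neg_of_mem_boxNhd hz
  refine ⟨thickening_mono (by linarith) _ h1, fun i => (h2 i).trans_lt (by linarith),
    thickening_mono (by linarith) _ h3, (norm_lt_of_mem_lineNhd_shortSide h4).trans (by linarith)⟩

theorem rotPhase_neg_of_mem_realBox {θ : ℝ} {z : Phase n} (hz : z ∈ realBox S δ Δ c θ) :
    ∃ I ∈ S, ∃ φ, ∃ y ∈ longSide δ Δ, ∃ x ∈ shortSide c,
      rotPhase n (-θ) z = realPoint I φ y x := by
  obtain ⟨I, hI, φ, y, hy, x, hx, rfl⟩ := hz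
  refine ⟨I, hI, φ, y, hy, x, hx, ?_⟩
  have h1 : realPoint I φ (Real.cos θ * y - Real.sin θ * x) (Real.sin θ * y + Real.cos θ * x) =
      rotPhase n θ (realPoint I φ y x) := by
    simp [realPoint, rotPhase_apply, rot]
  rw [h1, rotPhase_neg_rotPhase]

theorem mem_startDomain_of_mem_realBox
    (H : DeformationData S ρ s δ Δ c a M₀ M₁ E ν h ω₀ f₀ f₁) {θ : ℝ} {z : Phase n}
    (hz : z ∈ realBox S δ Δ c θ) :
    rotPhase n (-θ) z ∈ startDomain S ρ s δ Δ c := by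
  have hρ := H.ρ_pos; have hs := H.s_pos; have hδ := H.δ_pos; have hc := H.c_pos
  obtain ⟨I, hI, φ, y, hy, x, hx, h1⟩ := rotPhase_neg_of_mem_realBox hz
  rw [h1]
  refine ⟨self_subset_thickening (by positivity) _ ⟨I, hI, rfl⟩, fun i => ?_,
    self_subset_thickening (by positivity) _ ⟨y, hy, rfl⟩, ?_⟩
  · change |(ofRealVec _ i).im| < _
    rw [im_ofRealVec, abs_zero]; positivity
  · have hx : |x| < c / 2 := hx
    simp only [realPoint, Complex.norm_real, Real.norm_eq_abs]
    linarith

/-- The chart over the rectangle rotated by `θ`. The rectangle is crossed by the characteristics of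
the averaged Hamiltonian, so the homological equation is solved there without small divisors, and
the Hamiltonian is conjugated to its average exactly, with no remainder. -/
theorem exists_chart {f : Phase n → ℂ} {θ : ℝ}
    (H : DeformationData S ρ s δ Δ c a M₀ M₁ E ν h ω₀
      (fun z => average f z.1 (rot θ z.2.2))
      (fun z => f (rotPhase n θ z) - average f z.1 (rot θ z.2.2))) :
    ∃ φ ψ : Phase n → Phase n,
      IsCanonicalMap φ (boxNhd S δ Δ c θ (ρ / 3) (s / 3) (δ / 6) (c / 6))
        (boxNhd S δ Δ c θ ρ s (δ / 2) (c / 2) ∩ hamDomain S ρ s (Δ + δ)) ∧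
      (∀ z ∈ boxNhd S δ Δ c θ (ρ / 3) (s / 3) (δ / 6) (c / 6),
        ham h ω₀ f (φ z) =
          h z.1 + ω₀ z.1 / 2 * (z.2.2.2 ^ 2 + z.2.2.1 ^ 2) + average f z.1 z.2.2) ∧
      (∀ z ∈ boxNhd S δ Δ c θ (ρ / 3) (s / 3) (δ / 6) (c / 6),
        ‖z.1 - (φ z).1‖ / ρ ≤ 4 * ν ∧ ‖z.2.1 - (φ z).2.1‖ / s ≤ 4 * ν ∧
        2 * ‖(rot (-θ) (z.2.2 - (φ z).2.2)).1‖ / δ ≤ 4 * ν ∧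
        2 * ‖(rot (-θ) (z.2.2 - (φ z).2.2)).2‖ / c ≤ 4 * ν) ∧
      AnalyticOnNhd ℂ ψ (realBox S δ Δ c θ) ∧
      MapsTo ψ (realBox S δ Δ c θ)
        (boxNhd S δ Δ c θ (ρ / 3) (s / 3) (δ / 6) (c / 6) ∩ realPoints n) ∧
      (∀ z ∈ realBox S δ Δ c θ, φ (ψ z) = z) ∧
      (∀ z ∈ boxNhd S δ Δ c θ (ρ / 3) (s / 3) (δ / 6) (c / 6),
        φ z ∈ realBox S δ Δ c θ → ψ (φ z) = z) := by
  have hρ := H.ρ_pos; have hs := H.s_pos; have hδ := H.δ_pos; have hc := H.c_pos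
  have hν := H.ν_pos; have hν1 := H.ν_le; have hΔ := H.δ_lt
  have key : ∀ {x : ℝ}, 0 < x → ν * x ≤ 1 / 10 ^ 10 * x := fun hx => by gcongr
  obtain ⟨φ, ψ, ⟨hφd, hψd⟩, hcan, hreal, hshift, hinj, hen, hnear, hφψ, hψφ⟩ :=
    H.exists_conjugation
  set D := startDomain S ρ s δ Δ c
  set B := boxNhd S δ Δ c θ (ρ / 3) (s / 3) (δ / 6) (c / 6)
  have hDo : IsOpen D := isOpen_startDomain ..
  have hB : ∀ z ∈ B, rotPhase n (-θ) z ∈ D := fun z hz => H.mem_startDomain_of_mem_boxNhd hz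
  have hbox : ∀ z ∈ realBox S δ Δ c θ, rotPhase n (-θ) z ∈ D := fun z hz =>
    H.mem_startDomain_of_mem_realBox hz
  have hanal : ∀ {u : Phase n → Phase n}, DifferentiableOn ℂ u D → ∀ z, rotPhase n (-θ) z ∈ D →
      AnalyticAt ℂ (fun z => rotPhase n θ (u (rotPhase n (-θ) z))) z := fun hu z hz =>
    ((rotPhase n θ).analyticAt _).comp
      (((analyticOnNhd_of_differentiableOn hDo hu) _ hz).comp ((rotPhase n (-θ)).analyticAt z))
  have hψB : MapsTo (fun z => rotPhase n θ (ψ (rotPhase n (-θ) z))) (realBox S δ Δ c θ)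
      (B ∩ realPoints n) := by
    intro z hz
    have hzD := hbox z hz
    obtain ⟨I, hI, α, y, hy, x, hx, h1⟩ := rotPhase_neg_of_mem_realBox hz
    obtain ⟨k1, k2, k3, k4⟩ := (hnear _ hzD).2
    have hr := (hreal _ hzD (by rw [h1]; exact ⟨I, α, y, x, rfl⟩)).2
    refine ⟨rotPhase_mem_boxNhd ?_ (fun i => ?_) ?_ ?_, rotPhase_mem_realPoints θ hr⟩
    · rw [h1] at k1 ⊢
      exact mem_thickening_iff.mpr ⟨_, ⟨I, hI, rfl⟩, by
        rw [dist_eq_norm]; refine k1.trans_lt ?_; linarith [key hρ]⟩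
    -- The image of a real point is real, so its angles lie in every strip.
    · rw [(mem_realPoints_iff.mp hr).2.1 i, abs_zero]; positivity
    · rw [h1] at k3 ⊢
      exact mem_thickening_iff.mpr ⟨_, ⟨y, hy, rfl⟩, by
        rw [dist_eq_norm]; refine k3.trans_lt ?_; linarith [key hδ]⟩
    · rw [h1] at k4 ⊢
      exact mem_thickening_iff.mpr ⟨_, ⟨x, hx, rfl⟩, by
        rw [dist_eq_norm]; refine k4.trans_lt ?_; linarith [key hc]⟩
  refine ⟨fun z => rotPhase n θ (φ (rotPhase n (-θ) z)),
    fun z => rotPhase n θ (ψ (rotPhase n (-θ) z)),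
    ⟨fun z hz => ?_, fun z hz => hanal hφd z (hB z hz), fun z hz => ?_, fun z hz z' hz' hzz => ?_,
      fun z hz u v => ?_, fun z hz m => ?_⟩, fun z hz => ?_, fun z hz => ?_,
    fun z hz => hanal hψd z (hbox z hz), hψB, fun z hz => ?_, fun z hz hz' => ?_⟩
  · obtain ⟨k1, k2, k3, k4⟩ := (hnear _ (hB z hz)).1
    obtain ⟨h1, h2, h3, h4⟩ := rotPhase_neg_of_mem_boxNhd hz
    set w := rotPhase n (-θ) z
    have m1 : (φ w).1 ∈ actionNhd S ρ :=
      mem_thickening_of_norm_sub_le h1 k1 (by linarith [key hρ])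
    have m2 : (φ w).2.1 ∈ strip n s := fun i => by
      have := abs_im_apply_sub_le w.2.1 (φ w).2.1 i
      linarith [h2 i, key hs]
    have m3 : (φ w).2.2.1 ∈ lineNhd (longSide δ Δ) (1 / 5 * δ) :=
      mem_thickening_of_norm_sub_le h3 k3 (by linarith [key hδ])
    have m4 : (φ w).2.2.2 ∈ lineNhd (shortSide c) (1 / 5 * c) :=
      mem_thickening_of_norm_sub_le h4 k4 (by linarith [key hc])
    refine ⟨rotPhase_mem_boxNhd m1 m2 (thickening_mono (by linarith) _ m3)
      (thickening_mono (by linarith) _ m4), m1, m2, rot_mem_ballTwo θ ?_⟩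
    have n1 := (norm_bounds_of_mem_lineNhd m3).2
    have n2 := norm_lt_of_mem_lineNhd_shortSide m4
    have n3 := H.c_le
    change ‖(φ w).2.2.1‖ ^ 2 + ‖(φ w).2.2.2‖ ^ 2 < (Δ + δ) ^ 2
    have n4 : ‖(φ w).2.2.1‖ ^ 2 ≤ (Δ + 9 / 10 * δ) ^ 2 := by gcongr; linarith
    have n5 : ‖(φ w).2.2.2‖ ^ 2 ≤ (1 / 10 * δ) ^ 2 := by gcongr; linarith
    nlinarith
  · exact rotPhase_mem_realPoints θ
      (hreal _ (hB z hz.1) (rotPhase_mem_realPoints (-θ) hz.2)).1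
  · have h1 := congrArg (rotPhase n (-θ)) hzz
    simp only [rotPhase_neg_rotPhase] at h1
    have h2 := congrArg (rotPhase n θ) (hinj (hB z hz) (hB z' hz') h1)
    rwa [rotPhase_rotPhase_neg, rotPhase_rotPhase_neg] at h2
  · have h1 := (hφd.differentiableAt (hDo.mem_nhds (hB z hz))).hasFDerivAt
    have h2 := (rotPhase n θ).hasFDerivAt.comp z (h1.comp z (rotPhase n (-θ)).hasFDerivAt)
    have h3 : fderiv ℂ (fun z => rotPhase n θ (φ (rotPhase n (-θ) z))) z = _ := h2.fderiv
    rw [h3]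
    simp only [ContinuousLinearMap.comp_apply]
    rw [sympl_rotPhase, hcan _ (hB z hz), sympl_rotPhase]
  · simp only [rotPhase_shift, hshift _ (hB z hz)]
  -- Conservation of energy in rotated coordinates. The quadratic part `x² + y²` is invariant under
  -- the rotation, and at `τ = 1` the average cancels and leaves `f`.
  · have h1 := hen _ (hB z hz)
    simp only [hamFamily, deformation, one_mul, zero_mul, add_zero] at h1
    simp only [ham]
    have h2 : rot θ (rotPhase n (-θ) z).2.2 = z.2.2 := rot_rot_neg θ z.2.2
    have h3 := rot_sq (-θ) z.2.2
    have h4 := rot_sq θ (φ (rotPhase n (-θ) z)).2.2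
    rw [h2] at h1
    simp only [rotPhase_apply] at h1 h4 ⊢
    rw [h3] at h1
    rw [h4, ← h1]
    ring
  · obtain ⟨k1, k2, k3, k4⟩ := (hnear _ (hB z hz)).1
    have h1 : rot (-θ) (z.2.2 - (rotPhase n θ (φ (rotPhase n (-θ) z))).2.2) =
        (rotPhase n (-θ) z).2.2 - (φ (rotPhase n (-θ) z)).2.2 := by
      rw [rot_sub]
      congr 1
      exact rot_neg_rot _ _
    rw [h1]
    rw [norm_sub_rev] at k1 k2 k3 k4
    refine ⟨?_, ?_, ?_, ?_⟩
    · rw [div_le_iff₀ hρ]; exact k1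
    · rw [div_le_iff₀ hs]; exact k2
    · rw [div_le_iff₀ hδ, Prod.fst_sub]; linarith
    · rw [div_le_iff₀ hc, Prod.snd_sub]; linarith
  · have h1 := hB _ (hψB hz).1
    simp only [rotPhase_neg_rotPhase] at h1 ⊢
    rw [hφψ _ (hbox z hz) h1, rotPhase_rotPhase_neg]
  · have h1 := hbox _ hz'
    simp only [rotPhase_neg_rotPhase] at h1 ⊢
    rw [hψφ _ (hB z hz) h1, rotPhase_rotPhase_neg]

end DeformationData
end Chart

/-! ### The number of rectangles and the covering of the annulus. -/

section Covering

/-- The sine and cosine of the opening angle of the rectangles. -/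
theorem sin_cos_arctan_bounds {u : ℝ} (hu0 : 0 < u) (hu1 : u < 1) :
    0 < Real.sin (Real.arctan u) ∧ Real.sin (Real.arctan u) ≤ u ∧
      1 / 2 < Real.cos (Real.arctan u) ∧ u / 2 ≤ Real.arctan u := by
  have h1 : 1 ≤ √(1 + u ^ 2) := by rw [Real.one_le_sqrt]; nlinarith
  have h2 : √(1 + u ^ 2) < 2 := by
    rw [Real.sqrt_lt' (by norm_num)]; nlinarith
  have h0 : 0 < √(1 + u ^ 2) := by linarith
  rw [Real.sin_arctan, Real.cos_arctan]
  have h3 : u / 2 ≤ u / √(1 + u ^ 2) := by gcongr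
  refine ⟨by positivity, div_le_self hu0.le h1, ?_, ?_⟩
  · exact one_div_lt_one_div_of_lt h0 h2
  · have h4 := Real.sin_le (Real.arctan_nonneg.mpr hu0.le)
    rw [Real.sin_arctan] at h4
    linarith

/-- From `θ₀ ≥ c / (4 Δ)` the integer part is at most `8 π Δ / c`; the additional `1` is at most `2
Δ / c`, since `c < 2 Δ`. -/
theorem card_le {Δ c θ₀ : ℝ} {p : ℕ} (hΔ : 0 < Δ) (hc : 0 < c) (hcΔ : c < 2 * Δ)
    (hθ : θ₀ = Real.arctan (c / (2 * Δ))) (hp : p = ⌊2 * Real.pi / θ₀⌋₊ + 1) :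
    (p : ℝ) ≤ (8 * Real.pi + 2) * (Δ / c) := by
  have hu1 : c / (2 * Δ) < 1 := by rw [div_lt_one (by positivity)]; exact hcΔ
  have h1 := (sin_cos_arctan_bounds (by positivity) hu1).2.2.2
  rw [← hθ] at h1
  have h2 : 0 < c / (2 * Δ) / 2 := by positivity
  have hθ0 : 0 < θ₀ := h2.trans_le h1
  have h3 : 2 * Real.pi / θ₀ ≤ 2 * Real.pi / (c / (2 * Δ) / 2) := by
    have := Real.pi_pos; gcongr
  have h4 : 2 * Real.pi / (c / (2 * Δ) / 2) = 8 * Real.pi * (Δ / c) := by field_simp; ring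
  have h5 := Nat.floor_le (a := 2 * Real.pi / θ₀) (by have := Real.pi_pos; positivity)
  have h6 : 1 ≤ 2 * (Δ / c) := by
    rw [mul_div_assoc', le_div_iff₀ hc]; linarith
  rw [hp]
  push_cast
  linarith

theorem exists_polar (y x : ℝ) : ∃ α, 0 ≤ α ∧ α < 2 * Real.pi ∧
    y = √(x ^ 2 + y ^ 2) * Real.cos α ∧ x = √(x ^ 2 + y ^ 2) * Real.sin α := by
  have hn : ‖(⟨y, x⟩ : ℂ)‖ = √(x ^ 2 + y ^ 2) := by
    rw [Complex.norm_def, Complex.normSq_mk]; congr 1; ring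
  have h1 := Complex.norm_mul_cos_arg ⟨y, x⟩
  have h2 := Complex.norm_mul_sin_arg ⟨y, x⟩
  rw [hn] at h1 h2
  have h3 := Complex.neg_pi_lt_arg ⟨y, x⟩
  have h4 := Complex.arg_le_pi ⟨y, x⟩
  have hπ := Real.pi_pos
  rcases le_or_gt 0 (Complex.arg ⟨y, x⟩) with h | h
  · exact ⟨_, h, by linarith, h1.symm, h2.symm⟩
  · refine ⟨Complex.arg ⟨y, x⟩ + 2 * Real.pi, by linarith, by linarith, ?_, ?_⟩
    · rw [Real.cos_add_two_pi]; exact h1.symm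
    · rw [Real.sin_add_two_pi]; exact h2.symm

/-- The rotated rectangles cover the annulus. -/
theorem annulus_subset_iUnion {n : ℕ} {S : Set (EuclideanSpace ℝ (Fin n))} {δ Δ c θ₀ : ℝ} {p : ℕ}
    (hδ : 0 < δ) (hΔ : δ < Δ) (hc : 0 < c) (hcΔ : c < 2 * Δ)
    (hθ : θ₀ = Real.arctan (c / (2 * Δ))) (hp : p = ⌊2 * Real.pi / θ₀⌋₊ + 1) :
    annulus S δ Δ ⊆ ⋃ j : Fin p, realBox S δ Δ c ((j : ℕ) * θ₀) := by
  rintro z ⟨I, hI, φ, y, x, h1, h2, rfl⟩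
  have hΔ0 : 0 < Δ := hδ.trans hΔ
  have hu1 : c / (2 * Δ) < 1 := by rw [div_lt_one (by positivity)]; exact hcΔ
  have hu0 : 0 < c / (2 * Δ) := by positivity
  obtain ⟨b1, b2, b3, b4⟩ := sin_cos_arctan_bounds hu0 hu1
  have b5 := Real.arctan_lt_pi_div_two (c / (2 * Δ))
  rw [← hθ] at b1 b2 b3 b4 b5
  have hθ0 : 0 < θ₀ := by linarith
  obtain ⟨α, hα0, hα1, hy, hx⟩ := exists_polar y x
  set r := √(x ^ 2 + y ^ 2) with hr
  have hr1 : δ < r := Real.lt_sqrt_of_sq_lt h1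
  have hr2 : r < Δ := by rw [hr, Real.sqrt_lt' hΔ0]; exact h2
  have hr0 : 0 < r := hδ.trans hr1
  -- The rectangle is selected by the polar angle, with remainder `β ∈ [0, θ₀]`. Then `r cos β > r /
  -- 2 > δ / 2`, and `r sin β < Δ sin θ₀ ≤ c / 2`. As `α < 2 π`, the index is at most `p - 1`.
  set j := ⌊α / θ₀⌋₊
  have hj1 : (j : ℝ) * θ₀ ≤ α := by
    rw [← le_div_iff₀ hθ0]; exact Nat.floor_le (by positivity)
  have hj2 : α < ((j : ℝ) + 1) * θ₀ := by
    rw [← div_lt_iff₀ hθ0]; exact Nat.lt_floor_add_one _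
  have hjp : j < p := by
    rw [hp, Nat.lt_succ_iff]
    exact Nat.floor_mono (by gcongr)
  set β := α - j * θ₀ with hβ
  have hβ0 : 0 ≤ β := by linarith
  have hβ1 : β ≤ θ₀ := by linarith
  have hcos : Real.cos θ₀ ≤ Real.cos β :=
    Real.cos_le_cos_of_nonneg_of_le_pi hβ0 (by linarith) hβ1
  have hsin : Real.sin β ≤ Real.sin θ₀ :=
    Real.sin_le_sin_of_le_of_le_pi_div_two (by linarith) b5.le hβ1
  have hsin0 : 0 ≤ Real.sin β := Real.sin_nonneg_of_nonneg_of_le_pi hβ0 (by linarith)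
  have hα : α = j * θ₀ + β := by rw [hβ]; ring
  refine mem_iUnion.mpr ⟨⟨j, hjp⟩, I, hI, φ, r * Real.cos β, ?_, r * Real.sin β, ?_, ?_⟩
  · have h3 : 0 < r * Real.cos β := mul_pos hr0 (by linarith)
    change δ / 2 < |_| ∧ |_| < Δ + δ / 2
    rw [abs_of_pos h3]
    have h4 : r * (1 / 2) < r * Real.cos β := by gcongr; linarith
    have h5 : r * Real.cos β ≤ r * 1 := by gcongr; exact Real.cos_le_one _
    constructor <;> linarith
  · change |_| < c / 2
    rw [abs_of_nonneg (by positivity)]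
    calc r * Real.sin β ≤ r * Real.sin θ₀ := by gcongr
      _ < Δ * Real.sin θ₀ := by gcongr
      _ ≤ Δ * (c / (2 * Δ)) := by gcongr
      _ = c / 2 := by field_simp
  · have h3 : y = Real.cos (j * θ₀) * (r * Real.cos β) - Real.sin (j * θ₀) * (r * Real.sin β) := by
      rw [hy, hα, Real.cos_add]; ring
    have h4 : x = Real.sin (j * θ₀) * (r * Real.cos β) + Real.cos (j * θ₀) * (r * Real.sin β) := by
      rw [hx, hα, Real.sin_add]; ring
    simp only
    rw [← h3, ← h4]

end Covering

/-! ### The hypotheses in the form used by the deformation argument. -/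

section Data

variable {n : ℕ} {S : Set (EuclideanSpace ℝ (Fin n))} {ρ s δ Δ c a M₀ M₁ E ν : ℝ}
  {h ω₀ : CVec n → ℂ} {f : Phase n → ℂ}

theorem deformationData_of_ham (hρ : 0 < ρ) (hs : 0 < s) (hδ : 0 < δ) (hΔ : δ < Δ)
    (hS : S.Nonempty) (hh : AnalyticOnNhd ℂ h (actionNhd S ρ))
    (hω : AnalyticOnNhd ℂ ω₀ (actionNhd S ρ))
    (hf : AnalyticOnNhd ℂ f (hamDomain S ρ s (Δ + δ)))
    (hper : PeriodicOn f (hamDomain S ρ s (Δ + δ)))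
    (hr : ∀ I : EuclideanSpace ℝ (Fin n), ofRealVec I.ofLp ∈ actionNhd S ρ →
        (h (ofRealVec I.ofLp)).im = 0 ∧ (ω₀ (ofRealVec I.ofLp)).im = 0)
    (hfr : ∀ z ∈ hamDomain S ρ s (Δ + δ) ∩ realPoints n, (f z).im = 0) (ha : 0 < a)
    (haG : IsGLB {t : ℝ | ∃ I ∈ actionNhd S ρ, t = ‖ω₀ I‖} a)
    (hM₀ : IsLUB {t : ℝ | ∃ I ∈ actionNhd S ρ, t = ‖ω₀ I‖} M₀)
    (hM₁ : IsLUB {t : ℝ | ∃ I ∈ actionNhd S ρ, ∃ y : ℂ, ‖y‖ < Δ + δ ∧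
        t = omegaOneNorm h ω₀ I y} M₁)
    (hE : 0 ≤ E) (hn : wnorm (actionNhd S ρ) s (ballTwo (Δ + δ)) f = ENNReal.ofReal E)
    (hc : 0 < c) (hν : 0 < ν) (hν1 : ν ≤ 1 / 10 ^ 10)
    (s1 : c ^ 3 * M₀ ≤ ν * (a * δ * ρ * s)) (s2 : 2 * c * E ≤ ν * (a * δ * ρ * s))
    (s3 : 4 * c ^ 2 * M₀ ≤ ν * (a * δ ^ 2)) (s4 : 8 * E ≤ ν * (a * δ ^ 2))
    (s5 : 8 * c * M₁ ≤ s * (a * δ)) (θ : ℝ) :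
    DeformationData S ρ s δ Δ c a M₀ M₁ E ν h ω₀
      (fun z => average f z.1 (rot θ z.2.2))
      (fun z => f (rotPhase n θ z) - average f z.1 (rot θ z.2.2)) := by
  obtain ⟨I₀, hI₀⟩ := hS
  have hI : ofRealVec I₀.ofLp ∈ actionNhd S ρ := self_subset_thickening hρ _ ⟨I₀, hI₀, rfl⟩
  have hav : DifferentiableOn ℂ (fun z : Phase n => average f z.1 (rot θ z.2.2))
      (phaseDomain S ρ s (Δ + δ)) := by
    have h1 : Differentiable ℂ fun z : Phase n => ((z.1, rot θ z.2.2) : CVec n × ℂ × ℂ) :=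
      differentiable_fst.prodMk
        ((rotPhase n θ).differentiable.snd.snd)
    exact (differentiableOn_average hs hf).comp h1.differentiableOn
      fun z hz => ⟨hz.1, rot_mem_ballTwo θ hz.2.2⟩
  have hmaps : MapsTo (rotPhase n θ) (phaseDomain S ρ s (Δ + δ)) (hamDomain S ρ s (Δ + δ)) :=
    fun z hz => phaseDomain_subset_hamDomain (rotPhase_mem_phaseDomain θ hz)
  have hreal : ∀ I ∈ actionNhd S ρ, (∀ i, (I i).im = 0) → (h I).im = 0 ∧ (ω₀ I).im = 0 := by
    intro I hI h0
    have h1 := eq_ofRealVec_of_im_eq_zero h0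
    have h2 := hr (WithLp.toLp 2 fun i => (I i).re)
    simp only at h2
    rw [← h1] at h2
    exact h2 hI
  have hav0 : ∀ z ∈ phaseDomain S ρ s (Δ + δ) ∩ realPoints n,
      (average f z.1 (rot θ z.2.2)).im = 0 := fun z hz => by
    have h1 := mem_realPoints_iff.mp (rotPhase_mem_realPoints θ hz.2)
    exact im_average_eq_zero hs hfr hz.1.1 (rot_mem_ballTwo θ hz.1.2.2) h1.1 h1.2.2
  exact
    { ρ_pos := hρ, s_pos := hs, δ_pos := hδ, δ_lt := hΔ, c_pos := hc, a_pos := ha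
      a_le := (haG.1 ⟨_, hI, rfl⟩).trans (hM₀.1 ⟨_, hI, rfl⟩)
      M₁_nonneg := (norm_nonneg _).trans
        (hM₁.1 ⟨_, hI, 0, by rw [norm_zero]; linarith, rfl⟩)
      E_nonneg := hE, ν_pos := hν, ν_le := hν1
      diff_h := hh.differentiableOn, diff_ω := hω.differentiableOn
      diff_f₀ := hav
      diff_f₁ := (hf.differentiableOn.comp (rotPhase n θ).differentiable.differentiableOn
        hmaps).sub hav
      le_ω := fun I hI => haG.1 ⟨I, hI, rfl⟩
      ω_le := fun I hI => hM₀.1 ⟨I, hI, rfl⟩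
      ω₁_le := fun I hI y hy => hM₁.1 ⟨I, hI, y, hy, rfl⟩
      f₀_le := fun z hz => norm_average_le hE hn hz.1 (rot_mem_ballTwo θ hz.2.2)
      f₁_le := fun z hz =>
        norm_sub_average_le hs hf hper hE hn (rotPhase_mem_phaseDomain θ hz)
      real_h := fun I hI h0 => (hreal I hI h0).1
      real_ω := fun I hI h0 => (hreal I hI h0).2
      real_f₀ := hav0
      real_f₁ := fun z hz => by
        rw [Complex.sub_im, hav0 z hz,
          hfr _ ⟨hmaps hz.1, rotPhase_mem_realPoints θ hz.2⟩, sub_zero]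
      periodic_f₀ := fun z hz m => rfl
      periodic_f₁ := fun z hz m => by
        change f (shift m (rotPhase n θ z)) - _ = _
        rw [hper _ (hmaps hz)]; rfl
      small₁ := s1, small₂ := s2, small₃ := s3, small₄ := s4, small₅ := s5 }

/-- The smallness conditions in polynomial form. -/
theorem smallness {cstar : ℝ} {N : ℕ} (hN : 1 ≤ N) (hρ : 0 < ρ) (hs : 0 < s) (hδ : 0 < δ)
    (ha : 0 < a) (hc : 0 < c) (hM₀ : 0 ≤ M₀) (hM₁ : 0 ≤ M₁) (hE : 0 ≤ E)
    (hcs : 10 ^ 10 ≤ cstar) (h1 : 8 * N * c * (M₁ / (a * δ)) < s)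
    (h2 : cstar * (c ^ 3 * M₀ / (a * δ * ρ * s) + 2 * c * E / (a * δ * ρ * s)) * N < 1)
    (h3 : cstar * (4 * (c ^ 2 * M₀ / (a * δ ^ 2)) + 8 * E / (a * δ ^ 2)) * N < 1) :
    0 < 1 / (cstar * N) ∧ 1 / (cstar * N) ≤ 1 / 10 ^ 10 ∧
    c ^ 3 * M₀ ≤ 1 / (cstar * N) * (a * δ * ρ * s) ∧
    2 * c * E ≤ 1 / (cstar * N) * (a * δ * ρ * s) ∧
    4 * c ^ 2 * M₀ ≤ 1 / (cstar * N) * (a * δ ^ 2) ∧ 8 * E ≤ 1 / (cstar * N) * (a * δ ^ 2) ∧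
    8 * c * M₁ ≤ s * (a * δ) := by
  have hN' : (1 : ℝ) ≤ N := by exact_mod_cast hN
  have hcs0 : 0 < cstar := lt_of_lt_of_le (by norm_num) hcs
  have hcN : 0 < cstar * N := by positivity
  have hcN' : 10 ^ 10 ≤ cstar * N := by nlinarith
  have e2 : (c ^ 3 * M₀ + 2 * c * E) * (cstar * N) ≤ a * δ * ρ * s := by
    have : cstar * (c ^ 3 * M₀ / (a * δ * ρ * s) + 2 * c * E / (a * δ * ρ * s)) * N =
        (c ^ 3 * M₀ + 2 * c * E) * (cstar * N) / (a * δ * ρ * s) := by field_simp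
    rw [this, div_lt_one (by positivity)] at h2
    exact h2.le
  have e3 : (4 * c ^ 2 * M₀ + 8 * E) * (cstar * N) ≤ a * δ ^ 2 := by
    have : cstar * (4 * (c ^ 2 * M₀ / (a * δ ^ 2)) + 8 * E / (a * δ ^ 2)) * N =
        (4 * c ^ 2 * M₀ + 8 * E) * (cstar * N) / (a * δ ^ 2) := by field_simp
    rw [this, div_lt_one (by positivity)] at h3
    exact h3.le
  have p1 : 0 ≤ c ^ 3 * M₀ * (cstar * N) := by positivity
  have p2 : 0 ≤ 2 * c * E * (cstar * N) := by positivity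
  have p3 : 0 ≤ 4 * c ^ 2 * M₀ * (cstar * N) := by positivity
  have p4 : 0 ≤ 8 * E * (cstar * N) := by positivity
  refine ⟨by positivity, one_div_le_one_div_of_le (by norm_num) hcN', ?_, ?_, ?_, ?_, ?_⟩
  · rw [one_div_mul_eq_div, le_div_iff₀ hcN]; linarith
  · rw [one_div_mul_eq_div, le_div_iff₀ hcN]; linarith
  · rw [one_div_mul_eq_div, le_div_iff₀ hcN]; linarith
  · rw [one_div_mul_eq_div, le_div_iff₀ hcN]; linarith
  · have : 8 * N * c * (M₁ / (a * δ)) = 8 * c * M₁ * N / (a * δ) := by field_simp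
    rw [this, div_lt_iff₀ (by positivity)] at h1
    -- The factor `N ≥ 1` is discarded in this condition, since only one passage across the
    -- rectangle is made.
    have : 0 ≤ 8 * c * M₁ := by positivity
    nlinarith

end Data

end AnnularNormalForm

end

/-! ### Assembly of the charts into the normal form and the atlas. -/

open AnnularNormalForm in
theorem proposition2p1 :
    ∃ pstar : ℝ, 0 < pstar ∧ ∀ n : ℕ, ∃ cn : ℝ, 0 < cn ∧
    ∀ (N : ℕ) (_ : 1 ≤ N) (ρ s δ Δ : ℝ) (_ : 0 < ρ) (_ : 0 < s) (_ : 0 < δ) (_ : δ < Δ)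
      (S : Set (EuclideanSpace ℝ (Fin n))) (_ : IsOpen S) (_ : IsConnected S)
      (h ω₀ : CVec n → ℂ) (f : Phase n → ℂ)
      -- `H = h + ω₀ (x² + y²) / 2 + f` is holomorphic, and real on real points
      (_ : AnalyticOnNhd ℂ h (actionNhd S ρ))
      (_ : AnalyticOnNhd ℂ ω₀ (actionNhd S ρ))
      (_ : AnalyticOnNhd ℂ f (hamDomain S ρ s (Δ + δ)))
      (_ : PeriodicOn f (hamDomain S ρ s (Δ + δ)))
      (_ : ∀ I : EuclideanSpace ℝ (Fin n), ofRealVec I.ofLp ∈ actionNhd S ρ →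
        (h (ofRealVec I.ofLp)).im = 0 ∧ (ω₀ (ofRealVec I.ofLp)).im = 0)
      (_ : ∀ z ∈ hamDomain S ρ s (Δ + δ) ∩ realPoints n, (f z).im = 0)
      -- the constants
      (a M₀ M₁ E : ℝ) (_ : 0 < a)
      (_ : IsGLB {t : ℝ | ∃ I ∈ actionNhd S ρ, t = ‖ω₀ I‖} a)
      (_ : IsLUB {t : ℝ | ∃ I ∈ actionNhd S ρ, t = ‖ω₀ I‖} M₀)
      (_ : IsLUB {t : ℝ | ∃ I ∈ actionNhd S ρ, ∃ y : ℂ, ‖y‖ < Δ + δ ∧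
        t = omegaOneNorm h ω₀ I y} M₁)
      (_ : 0 ≤ E)
      (_ : wnorm (actionNhd S ρ) s (ballTwo (Δ + δ)) f = ENNReal.ofReal E)
      (cstar : ℝ) (_ : cn ≤ cstar) (c : ℝ) (_ : 0 < c) (_ : c < δ + Δ)
      -- the smallness conditions
      (_ : 8 * N * c * (M₁ / (a * δ)) < s)
      (_ : cstar * (c ^ 3 * M₀ / (a * δ * ρ * s) + 2 * c * E / (a * δ * ρ * s)) * N < 1)
      (_ : cstar * (4 * (c ^ 2 * M₀ / (a * δ ^ 2)) + 8 * E / (a * δ ^ 2)) * N < 1),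
    ∀ (p : ℕ) (θ₀ : ℝ),
    ∃ (φ : Fin p → Phase n → Phase n) (g : Fin p → CVec n → ℂ × ℂ → ℂ)
      (fs : Fin p → Phase n → ℂ),
      (∀ j : Fin p,
        -- `φ_j` is a real-analytic canonical transformation into the domain of `H`
        IsCanonicalMap (φ j)
          (boxNhd S δ Δ c ((j : ℕ) * θ₀) (ρ / 3) (s / 3) (δ / 6) (c / 6))
          (boxNhd S δ Δ c ((j : ℕ) * θ₀) ρ s (δ / 2) (c / 2) ∩ hamDomain S ρ s (Δ + δ)) ∧
        -- `g_j` and `f_{j,*}` are holomorphic functions, real on real points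
        AnalyticOnNhd ℂ (fun w : CVec n × ℂ × ℂ => g j w.1 w.2)
          (actionNhd S (ρ / 3) ×ˢ rectNhd δ Δ c ((j : ℕ) * θ₀) (δ / 6) (c / 6)) ∧
        AnalyticOnNhd ℂ (fs j)
          (boxNhd S δ Δ c ((j : ℕ) * θ₀) (ρ / 3) (s / 3) (δ / 6) (c / 6)) ∧
        PeriodicOn (fs j)
          (boxNhd S δ Δ c ((j : ℕ) * θ₀) (ρ / 3) (s / 3) (δ / 6) (c / 6)) ∧
        (∀ z ∈ boxNhd S δ Δ c ((j : ℕ) * θ₀) (ρ / 3) (s / 3) (δ / 6) (c / 6) ∩ realPoints n,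
          (g j z.1 z.2.2).im = 0 ∧ (fs j z).im = 0) ∧
        -- the normal form
        (∀ z ∈ boxNhd S δ Δ c ((j : ℕ) * θ₀) (ρ / 3) (s / 3) (δ / 6) (c / 6),
          ham h ω₀ f (φ j z) =
            h z.1 + ω₀ z.1 / 2 * (z.2.2.2 ^ 2 + z.2.2.1 ^ 2) + average f z.1 z.2.2
              + g j z.1 z.2.2 + fs j z) ∧
        -- the bounds on `g_j` and on the remainder
        wnorm (actionNhd S (ρ / 3)) (s / 3) (rectNhd δ Δ c ((j : ℕ) * θ₀) (δ / 6) (c / 6))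
            (fun z => g j z.1 z.2.2) ≤
          ENNReal.ofReal
            (max (cn * (c ^ 3 * M₀ / (a * δ * ρ * s) + 2 * c * E / (a * δ * ρ * s)))
                (cn * (4 * (c ^ 2 * M₀ / (a * δ ^ 2)) + 8 * E / (a * δ ^ 2)))
              * (M₀ / 2 * c ^ 2 + E)) ∧
        wnorm (actionNhd S (ρ / 3)) (s / 3) (rectNhd δ Δ c ((j : ℕ) * θ₀) (δ / 6) (c / 6))
            (fs j) ≤
          ENNReal.ofReal ((M₀ / 2 * c ^ 2 + E) * (2 : ℝ)⁻¹ ^ N) ∧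
        -- closeness to the identity; the components of the displacement of `(y, x)` are taken
        -- along the sides of the `j`-th rectangle
        (∀ z ∈ boxNhd S δ Δ c ((j : ℕ) * θ₀) (ρ / 3) (s / 3) (δ / 6) (c / 6),
          ‖z.1 - (φ j z).1‖ / ρ ≤ 4 / (cstar * N) ∧
          ‖z.2.1 - (φ j z).2.1‖ / s ≤ 4 / (cstar * N) ∧
          2 * ‖(rot (-((j : ℕ) * θ₀)) (z.2.2 - (φ j z).2.2)).1‖ / δ ≤ 4 / (cstar * N) ∧
          2 * ‖(rot (-((j : ℕ) * θ₀)) (z.2.2 - (φ j z).2.2)).2‖ / c ≤ 4 / (cstar * N))) ∧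
      -- the atlas
      (θ₀ = Real.arctan (c / (2 * Δ)) → p = ⌊2 * Real.pi / θ₀⌋₊ + 1 →
        (p : ℝ) ≤ pstar * (Δ / c) ∧
        IsAtlas (annulus S δ Δ) (fun j : Fin p => realBox S δ Δ c ((j : ℕ) * θ₀))
          (fun j : Fin p =>
            boxNhd S δ Δ c ((j : ℕ) * θ₀) (ρ / 3) (s / 3) (δ / 6) (c / 6)) φ) := by
  -- The threshold `10 ^ 10` is the same for every `n`, as no estimate used the dimension.
  refine ⟨8 * Real.pi + 2, by have := Real.pi_pos; positivity, fun n => ⟨10 ^ 10, by positivity, ?_⟩⟩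
  intro N hN ρ s δ Δ hρ hs hδ hΔ S hSo hSc h ω₀ f hh hω hf hper hr hfr a M₀ M₁ E ha haG hM₀ hM₁ hE
    hn cstar hcs c hc hcΔ h1 h2 h3 p θ₀
  have hI : ofRealVec hSc.nonempty.some.ofLp ∈ actionNhd S ρ :=
    Metric.self_subset_thickening hρ _ ⟨_, hSc.nonempty.some_mem, rfl⟩
  have hM₀0 : 0 ≤ M₀ := (norm_nonneg _).trans (hM₀.1 ⟨_, hI, rfl⟩)
  have hM₁0 : 0 ≤ M₁ := (norm_nonneg _).trans
    (hM₁.1 ⟨_, hI, 0, by rw [norm_zero]; linarith, rfl⟩)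
  obtain ⟨q1, q2, q3, q4, q5, q6, q7⟩ := smallness hN hρ hs hδ ha hc hM₀0 hM₁0 hE hcs h1 h2 h3
  have hν4 : 4 * (1 / (cstar * N)) = 4 / (cstar * N) := by ring
  have hex := fun j : Fin p => (deformationData_of_ham hρ hs hδ hΔ hSc.nonempty hh hω hf hper hr hfr
    ha haG hM₀ hM₁ hE hn hc q1 q2 q3 q4 q5 q6 q7 ((j : ℕ) * θ₀)).exists_chart
  choose φ ψ hcan hnf hdisp hψa hψm hφψ hψφ using hex
  rw [hν4] at hdisp
  -- Each chart conjugates `H` to its average exactly, so the correction and the remainder are both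
  -- zero.
  refine ⟨φ, fun _ _ _ => 0, fun _ _ => 0, fun j => ⟨hcan j, analyticOnNhd_const,
    analyticOnNhd_const, fun _ _ _ => rfl, fun _ _ => ⟨rfl, rfl⟩, fun z hz => ?_, ?_, ?_,
    hdisp j⟩, fun hθ hp => ⟨card_le (hδ.trans hΔ) hc (by linarith) hθ hp,
      annulus_subset_iUnion hδ hΔ hc (by linarith) hθ hp,
      fun j => ⟨ψ j, hψa j, hψm j, hφψ j, hψφ j⟩⟩⟩
  · rw [hnf j z hz, add_zero, add_zero]
  · rw [wnorm_zero]; exact zero_le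
  · rw [wnorm_zero]; exact zero_le
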